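/- Let $\mathcal X=\prod_{i=1}^N\mathbb R^{n_i}$ and $\mathcal Y=\mathbb R^m$ with Euclidean norms, $N\ge 1$. Let $g_i:\mathbb R^{n_i}\to\mathbb R\cup\{+\infty\}$ and $h:\mathcal Y\to\mathbb R\cup\{+\infty\}$ be closed convex, $g(\mathbf x)=\sum_i g_i(x_i)$, and let $f:\mathcal X\times\mathcal Y\to\mathbb R$ be differentiable on an open set containing $\operatorname{dom}g\times\operatorname{dom}h$, with $\nabla f$ $L$-Lipschitz on $\operatorname{dom}g\times\operatorname{dom}h$ and $f(\mathbf x,\cdot)$ $\mu$-strongly concave on $\operatorname{dom} h$ for every $\mathbf x\in\operatorname{dom}g$, where $0<\mu\le L$. Put $\mathcal L(\mathbf x,y)=g(\mathbf x)+f(\mathbf x,y)-h(y)$, $\Phi(\mathbf x)=\max_y f(\mathbf x,y)-h(y)$, $F=g+\Phi$, and assume $\inf F>-\infty$. Let $\tilde\nabla_{x_i}f(\mathbf x,y;\omega)$ $(1\le i\le N)$ and $\tilde\nabla_yf(\mathbf x,y;\zeta)$ be (jointly measurable) stochastic oracles which, for all $(\mathbf x,y)\in\operatorname{dom}g\times\operatorname{dom}h$,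 are unbiased, with means $\nabla_{x_i}f(\mathbf x,y)$ and $\nabla_yf(\mathbf x,y)$, and satisfy $\mathbf E\|\tilde\nabla_{x_i}f-\nabla_{x_i}f\|^2\le\sigma_x^2/N$ for every $i$ and $\mathbf E\|\tilde\nabla_{y}f-\nabla_{y}f\|^2\le\sigma_y^2$, with $\sigma_x,\sigma_y\ge0$. For batches $\boldsymbol\omega=(\omega_j)_{j\le M_x}$ and $\boldsymbol\zeta=(\zeta_j)_{j\le M_y}$, $M_x,M_y\ge1$, each consisting of i.i.d. samples, let $s_{x_i}(\mathbf x,y;\boldsymbol\omega)$ and $s_y(\mathbf x,y;\boldsymbol\zeta)$ be the averages of the oracles over the batch, and with $\operatorname{prox}_{\varphi}(v)=\arg\min_u\varphi(u)+\frac12\|u-v\|^2$ set $$\tilde G_{x_i}(\mathbf x,y;\boldsymbol\omega)=\tfrac1{\eta_x}\big[x_i-\operatorname{prox}_{\eta_xg_i}(x_i-\eta_xs_{x_i}(\mathbf x,y;\boldsymbol\omega))\big],\qquad \tilde G_y(\mathbf x,y;\boldsymbol\zeta)=\tfrac1{\eta_y}\big[\operatorname{prox}_{\eta_yh}(y+\eta_ys_y(\mathbf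 x,y;\boldsymbol\zeta))-y\big],$$ $\tilde G_{\mathbf x}=(\tilde G_{x_i})_{i=1}^N$ and $\tilde G(\mathbf x,y;\boldsymbol\omega,\boldsymbol\zeta)=(\tilde G_{\mathbf x}(\mathbf x,y;\boldsymbol\omega),\tilde G_y(\mathbf x,y;\boldsymbol\zeta))$. Let $\mathbf x^0\in\operatorname{dom}g$ and let $y^0$ be a random point, almost surely in $\operatorname{dom}h$, with $\mathcal L(\mathbf x^0,y^0)$ integrable and $\max_y\mathcal L(\mathbf x^0,y)-\mathbf E[\mathcal L(\mathbf x^0,y^0)]\le\tilde\epsilon$. Suppose $0<\eta_y\le\frac1L$ and $\eta_x=N\rho\,\eta_y^3\mu^2$ with $\rho=\frac{\sqrt{1+12/N}-1}{24}$. (a) (RB-SGDA, Jacobi updates.) Suppose moreover that $\eta_y\mu<1$. For $k\ge0$ draw a uniform block $i_k\in\{1,\dots,N\}$ and batches $\boldsymbol\omega^k,\boldsymbol\zeta^k$, with $(i_k,\boldsymbol\omega^k,\boldsymbol\zeta^k)$ independent of $(\mathbf x^k,y^k)$ and $i_k$ independent of $\boldsymbol\omega^k$, and set $x^{k+1}_{i_k}=\operatorname{prox}_{\eta_xg_{i_k}}(x^k_{i_k}-\eta_xs_{x_{i_k}}(\mathbf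 x^k,y^k;\boldsymbol\omega^k))$, $x_i^{k+1}=x_i^k$ for $i\ne i_k$, and $y^{k+1}=\operatorname{prox}_{\eta_yh}(y^k+\eta_ys_y(\mathbf x^k,y^k;\boldsymbol\zeta^k))$. Then for all $K\ge1$ the random variables $\|\tilde G(\mathbf x^k,y^k;\boldsymbol\omega^k,\boldsymbol\zeta^k)\|^2$ $(k\ge0)$ and $F(\mathbf x^K)$ are integrable and $$\frac1K\sum_{k=0}^{K-1}\mathbf E\|\tilde G(\mathbf x^k,y^k;\boldsymbol\omega^k,\boldsymbol\zeta^k)\|^2\le\frac{4N}{\eta_xK}\mathbf E\big[F(\mathbf x^0)-F(\mathbf x^K)+12\rho\tilde\epsilon\big]+\frac{4\sigma_x^2}{M_x}+\Big(1+\frac6{\eta_y\mu}\cdot\frac{2-\eta_y\mu}{1-\eta_y\mu}\Big)\frac{4\sigma_y^2}{M_y}.$$ (b) (RB-SAGDA, Gauss-Seidel updates.) Let the iterates be generated as in (a), except that $y^{k+1}=\operatorname{prox}_{\eta_yh}(y^k+\eta_ys_y(\mathbf x^{k+1},y^k;\boldsymbol\zeta^k))$, with $\boldsymbol\zeta^k$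 also independent of $(i_k,\boldsymbol\omega^k)$, and let $\boldsymbol\psi^k$ be a further batch distributed as $\boldsymbol\zeta^k$ and independent of $(\mathbf x^k,y^k)$. (Here $\eta_y\mu<1$ is not required.) Then for all $K\ge1$ the random variables $\|\tilde G(\mathbf x^k,y^k;\boldsymbol\omega^k,\boldsymbol\psi^k)\|^2$ $(k\ge0)$ and $F(\mathbf x^K)$ are integrable and $$\frac1K\sum_{k=0}^{K-1}\mathbf E\|\tilde G(\mathbf x^k,y^k;\boldsymbol\omega^k,\boldsymbol\psi^k)\|^2\le\frac{4N}{\eta_xK}\mathbf E\big[F(\mathbf x^0)-F(\mathbf x^K)+12\rho\tilde\epsilon\big]+\frac{4\sigma_x^2}{M_x}+\Big(1+\frac{12}{\eta_y\mu}\Big)\frac{4\sigma_y^2}{M_y}.$$ -/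

import Mathlib

open MeasureTheory ProbabilityTheory
open scoped Gradient

noncomputable section

namespace RBSGDA

/-- The domain of an extended-real-valued function that never takes the value `-∞`. -/
def dom {E : Type*} (φ : E → EReal) : Set E := {u | φ u < ⊤}

/-- A closed convex function with values in `ℝ ∪ {+∞}`: it never equals `-∞`, it is lower
semicontinuous, and its epigraph is convex. -/
structure IsClosedConvex {E : Type*} [TopologicalSpace E] [AddCommGroup E] [Module ℝ E]
    (φ : E → EReal) : Prop where
  ne_bot : ∀ u, φ u ≠ ⊥
  lsc : LowerSemicontinuous φ
  convex_epigraph : Convex ℝ {p : E × ℝ | φ p.1 ≤ (p.2 : EReal)}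

/-- The proximal map: `prox φ v` minimizes `u ↦ φ u + ‖u - v‖² / 2`
(for a closed convex `φ` that is not identically `+∞` the minimizer exists and is unique). -/
def prox {E : Type*} [NormedAddCommGroup E] (φ : E → EReal) (v : E) : E :=
  Classical.epsilon fun p => ∀ u,
    φ p + ((‖p - v‖ ^ 2 / 2 : ℝ) : EReal) ≤ φ u + ((‖u - v‖ ^ 2 / 2 : ℝ) : EReal)

/-- The primal space: the Euclidean product of the block spaces `ℝ^{n_i}`. -/
abbrev Primal {N : ℕ} (n : Fin N → ℕ) : Type :=
  PiLp 2 fun i => EuclideanSpace ℝ (Fin (n i))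

/-- The dual space. -/
abbrev Dual (m : ℕ) : Type := EuclideanSpace ℝ (Fin m)

/-- The data of the problem `min_x max_y ∑ᵢ gᵢ(xᵢ) + f(x,y) - h(y)`. -/
structure Problem {N : ℕ} (n : Fin N → ℕ) (m : ℕ) where
  g : ∀ i, EuclideanSpace ℝ (Fin (n i)) → EReal
  h : Dual m → EReal
  f : WithLp 2 (Primal n × Dual m) → ℝ

namespace Problem

variable {N : ℕ} {n : Fin N → ℕ} {m : ℕ} (p : Problem n m)

/-- `g(x) = ∑ᵢ gᵢ(xᵢ)`. -/
def gSum (x : Primal n) : EReal := ∑ i, p.g i (x i)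

/-- `dom g`, the product of the domains of the `gᵢ`. -/
def domG : Set (Primal n) := {x | ∀ i, x i ∈ dom (p.g i)}

/-- The Lagrangian-type function `𝓛(x,y) = g(x) + f(x,y) - h(y)`. -/
def lagrangian (x : Primal n) (y : Dual m) : EReal :=
  p.gSum x + ((p.f (WithLp.toLp 2 (x, y)) : ℝ) : EReal) - p.h y

/-- `Φ(x) = max_y f(x,y) - h(y)`. -/
def Phi (x : Primal n) : EReal :=
  ⨆ y : Dual m, ((p.f (WithLp.toLp 2 (x, y)) : ℝ) : EReal) - p.h y

/-- The primal objective `F = g + Φ`. -/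
def F (x : Primal n) : EReal := p.gSum x + p.Phi x

/-- `∇_x f(x,y)`; its `i`-th component is `∇_{x_i} f(x,y)`. -/
def gradX (x : Primal n) (y : Dual m) : Primal n := (∇ p.f (WithLp.toLp 2 (x, y))).fst

/-- `∇_y f(x,y)`. -/
def gradY (x : Primal n) (y : Dual m) : Dual m := (∇ p.f (WithLp.toLp 2 (x, y))).snd

/-- The standing assumptions on the problem: `gᵢ` and `h` are closed convex; `f` is differentiable
on an open set containing `dom g × dom h`, where its gradient is `L`-Lipschitz; `f(x,·)` is
`μ`-strongly concave for `x ∈ dom g`; and `inf F > -∞`. -/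
structure Regular (L μ : ℝ) : Prop where
  closedConvex_g : ∀ i, IsClosedConvex (p.g i)
  closedConvex_h : IsClosedConvex p.h
  differentiable : ∃ U : Set (WithLp 2 (Primal n × Dual m)), IsOpen U ∧
    (∀ x ∈ p.domG, ∀ y ∈ dom p.h, WithLp.toLp 2 (x, y) ∈ U) ∧ DifferentiableOn ℝ p.f U
  lipschitz : ∀ x ∈ p.domG, ∀ y ∈ dom p.h, ∀ x' ∈ p.domG, ∀ y' ∈ dom p.h,
    ‖∇ p.f (WithLp.toLp 2 (x, y)) - ∇ p.f (WithLp.toLp 2 (x', y'))‖ ≤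
      L * ‖WithLp.toLp 2 (x, y) - WithLp.toLp 2 (x', y')‖
  strongConcave : ∀ x ∈ p.domG,
    StrongConcaveOn (dom p.h) μ fun y => p.f (WithLp.toLp 2 (x, y))
  bddBelow : ⊥ < ⨅ x, p.F x

/-- The stochastic oracle `ox` (with all blocks `ox_i`) for `∇_x f`, driven by a sample of law `Px`,
and the stochastic oracle `oy` for `∇_y f`, driven by a sample of law `Py`, are unbiased on
`dom g × dom h`, with variance at most `σx² / N` for each primal block and at most `σy²` for the
dual one. -/
structure OracleAssumption {Wx Wy : Type*} [MeasurableSpace Wx] [MeasurableSpace Wy]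
    (Px : Measure Wx) (Py : Measure Wy)
    (ox : Primal n → Dual m → Wx → Primal n) (oy : Primal n → Dual m → Wy → Dual m)
    (σx σy : ℝ) : Prop where
  measurable_x : Measurable fun t : (Primal n × Dual m) × Wx => ox t.1.1 t.1.2 t.2
  measurable_y : Measurable fun t : (Primal n × Dual m) × Wy => oy t.1.1 t.1.2 t.2
  σx_nonneg : 0 ≤ σx
  σy_nonneg : 0 ≤ σy
  integrable_x : ∀ x ∈ p.domG, ∀ y ∈ dom p.h, ∀ i, Integrable (fun w => ox x y w i) Px
  integrable_y : ∀ x ∈ p.domG, ∀ y ∈ dom p.h, Integrable (fun w => oy x y w) Py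
  mean_x : ∀ x ∈ p.domG, ∀ y ∈ dom p.h, ∀ i, ∫ w, ox x y w i ∂Px = p.gradX x y i
  mean_y : ∀ x ∈ p.domG, ∀ y ∈ dom p.h, ∫ w, oy x y w ∂Py = p.gradY x y
  sq_integrable_x : ∀ x ∈ p.domG, ∀ y ∈ dom p.h, ∀ i,
    Integrable (fun w => ‖ox x y w i - p.gradX x y i‖ ^ 2) Px
  sq_integrable_y : ∀ x ∈ p.domG, ∀ y ∈ dom p.h,
    Integrable (fun w => ‖oy x y w - p.gradY x y‖ ^ 2) Py
  variance_x : ∀ x ∈ p.domG, ∀ y ∈ dom p.h, ∀ i,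
    ∫ w, ‖ox x y w i - p.gradX x y i‖ ^ 2 ∂Px ≤ σx ^ 2 / N
  variance_y : ∀ x ∈ p.domG, ∀ y ∈ dom p.h,
    ∫ w, ‖oy x y w - p.gradY x y‖ ^ 2 ∂Py ≤ σy ^ 2

end Problem

/-- The batch average `(1/M) ∑ⱼ o(x,y;wⱼ)` of `M` oracle calls. -/
def batch {X Y W E : Type*} [AddCommGroup E] [Module ℝ E] {M : ℕ}
    (o : X → Y → W → E) (x : X) (y : Y) (w : Fin M → W) : E :=
  (M : ℝ)⁻¹ • ∑ j, o x y (w j)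

section Algorithms

variable {N : ℕ} {n : Fin N → ℕ} {m : ℕ} (p : Problem n m) {Wx Wy : Type*}
  (ox : Primal n → Dual m → Wx → Primal n) (oy : Primal n → Dual m → Wy → Dual m)
  (ηx ηy : ℝ) {Mx My : ℕ}

/-- `prox_{ηx gᵢ} (xᵢ - ηx s_{xᵢ}(x,y;w))`. -/
def proxBlock (x : Primal n) (y : Dual m) (w : Fin Mx → Wx) (i : Fin N) :
    EuclideanSpace ℝ (Fin (n i)) :=
  prox (fun u => (ηx : EReal) * p.g i u) (x i - ηx • batch ox x y w i)

/-- `prox_{ηy h} (y + ηy s_y(x,y;z))`. -/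
def proxDual (x : Primal n) (y : Dual m) (z : Fin My → Wy) : Dual m :=
  prox (fun u => (ηy : EReal) * p.h u) (y + ηy • batch oy x y z)

/-- The primal step: only the block `i` is replaced. -/
def primalStep (x : Primal n) (y : Dual m) (i : Fin N) (w : Fin Mx → Wx) : Primal n :=
  WithLp.toLp 2 (Function.update (fun l => x l) i (proxBlock p ox ηx x y w i))

/-- The stochastic gradient map in `x`. -/
def gradMapX (x : Primal n) (y : Dual m) (w : Fin Mx → Wx) : Primal n :=
  WithLp.toLp 2 fun i => ηx⁻¹ • (x i - proxBlock p ox ηx x y w i)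

/-- The stochastic gradient map in `y`. -/
def gradMapY (x : Primal n) (y : Dual m) (z : Fin My → Wy) : Dual m :=
  ηy⁻¹ • (proxDual p oy ηy x y z - y)

/-- The stochastic gradient map `G̃ = (G̃_x, G̃_y)`. -/
def gradMap (x : Primal n) (y : Dual m) (w : Fin Mx → Wx) (z : Fin My → Wy) :
    WithLp 2 (Primal n × Dual m) :=
  WithLp.toLp 2 (gradMapX p ox ηx x y w, gradMapY p oy ηy x y z)

/-- The iterates `(x^k, y^k)` of RB-SGDA (Jacobi updates) along one realization of the blocks
`i_k` and of the batches `w^k`, `z^k`. -/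
def sgda (x₀ : Primal n) (y₀ : Dual m) (i : ℕ → Fin N) (w : ℕ → Fin Mx → Wx)
    (z : ℕ → Fin My → Wy) : ℕ → Primal n × Dual m
  | 0 => (x₀, y₀)
  | k + 1 =>
    let s := sgda x₀ y₀ i w z k
    (primalStep p ox ηx s.1 s.2 (i k) (w k), proxDual p oy ηy s.1 s.2 (z k))

/-- The iterates `(x^k, y^k)` of RB-SAGDA (Gauss-Seidel updates: the dual step uses the new primal
point) along one realization of the blocks `i_k` and of the batches `w^k`, `z^k`. -/
def sagda (x₀ : Primal n) (y₀ : Dual m) (i : ℕ → Fin N) (w : ℕ → Fin Mx → Wx)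
    (z : ℕ → Fin My → Wy) : ℕ → Primal n × Dual m
  | 0 => (x₀, y₀)
  | k + 1 =>
    let s := sagda x₀ y₀ i w z k
    let x' := primalStep p ox ηx s.1 s.2 (i k) (w k)
    (x', proxDual p oy ηy x' s.2 (z k))

end Algorithms

/-- `i` is a random element of the index set of the `N` blocks with the uniform law. -/
def IsUniformIndex {Ω : Type*} [MeasurableSpace Ω] (P : Measure Ω) {N : ℕ} (i : Ω → Fin N) :
    Prop :=
  Measurable i ∧ ∀ l, P (i ⁻¹' {l}) = (N : ENNReal)⁻¹

/-- `w` is a batch of `M` i.i.d. samples of law `Q`. -/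
def IsBatch {Ω W : Type*} [MeasurableSpace Ω] [MeasurableSpace W] (P : Measure Ω) (Q : Measure W)
    {M : ℕ} (w : Ω → Fin M → W) : Prop :=
  (∀ j, Measurable fun a => w a j) ∧ (∀ j, P.map (fun a => w a j) = Q) ∧
    iIndepFun (fun j a => w a j) P

/-- The randomness of RB-SGDA: at each step a uniform block `i_k` and i.i.d. batches `w^k`, `z^k`,
with `(i_k, w^k, z^k)` independent of the current iterate `s^k`, and `i_k` independent of `w^k`.
The batches `w^k` and `z^k` of the same step may depend on each other. -/
structure JacobiSampling {Ω S Wx Wy : Type*} [MeasurableSpace Ω] [MeasurableSpace S]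
    [MeasurableSpace Wx] [MeasurableSpace Wy] (P : Measure Ω) (Px : Measure Wx) (Py : Measure Wy)
    {N Mx My : ℕ} (s : Ω → ℕ → S) (i : Ω → ℕ → Fin N) (w : Ω → ℕ → Fin Mx → Wx)
    (z : Ω → ℕ → Fin My → Wy) : Prop where
  uniform : ∀ k, IsUniformIndex P fun a => i a k
  batch_x : ∀ k, IsBatch P Px fun a => w a k
  batch_y : ∀ k, IsBatch P Py fun a => z a k
  indep_iterate : ∀ k, IndepFun (fun a => s a k) (fun a => (i a k, w a k, z a k)) P
  indep_index : ∀ k, IndepFun (fun a => i a k) (fun a => w a k) P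

/-- The randomness of RB-SAGDA: as for RB-SGDA, but `z^k` is moreover independent of `(i_k, w^k)`
(the dual step is taken at the new primal point), and the gradient map in `y` is evaluated with a
further batch `ψ^k`, distributed as `z^k` and independent of the current iterate. -/
structure GaussSeidelSampling {Ω S Wx Wy : Type*} [MeasurableSpace Ω] [MeasurableSpace S]
    [MeasurableSpace Wx] [MeasurableSpace Wy] (P : Measure Ω) (Px : Measure Wx) (Py : Measure Wy)
    {N Mx My : ℕ} (s : Ω → ℕ → S) (i : Ω → ℕ → Fin N) (w : Ω → ℕ → Fin Mx → Wx)
    (z ψ : Ω → ℕ → Fin My → Wy) : Prop extends JacobiSampling P Px Py s i w z where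
  indep_batches : ∀ k, IndepFun (fun a => (i a k, w a k)) (fun a => z a k) P
  batch_psi : ∀ k, IsBatch P Py fun a => ψ a k
  indep_psi : ∀ k, IndepFun (fun a => s a k) (fun a => ψ a k) P

/-- The constant `ρ = (√(1 + 12/N) - 1) / 24`. -/
def rho (N : ℕ) : ℝ := (Real.sqrt (1 + 12 / (N : ℝ)) - 1) / 24

end RBSGDA

end

namespace RBSGDA

/-! ### Proximal maps, quadratic growth and first-order inequalities. -/

section ConvexAnalysis

open Filter Topology

variable {E : Type*} [NormedAddCommGroup E] [InnerProductSpace ℝ E]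

/-! Write y*(x) for the maximizer of f(x,·) − h, D_k = E‖y^k − y*(x^k)‖² and q = ηy μ. The proof
shows that the Lyapunov function E F(x^k) + 6ρμ D_k drops at each step by at least ηx/(4N) times
(E‖G̃‖² minus the noise terms). Summing over k gives both bounds, and the initial gap enters through
6ρμ D_0 ≤ 12ρ ε̃, which is quadratic growth around y*(x⁰).

Primal side. Quadratic growth around y*(x) yields a quadratic upper bound for Φ with slope ∇_x f(x,
y*(x)) and curvature L + L²/μ, without differentiating Φ (`Regular.coupling_max_sub_le`). A prox
step in block i therefore lowers F by a multiple of ηx‖G̃_{x_i}‖², up to the oracle error and the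
error of using y^k in place of y*(x^k) (`Regular.F_replaceBlock_prox_le`). Averaging over the
uniform independent block turns block quantities into 1/N times full ones, and the second error
costs (ηx/N) L² D_k (`Regular.integral_F_primalStep_le`).

Dual side. A prox ascent step at a fixed x contracts the mean square distance to y*(x) by 1 − q, up
to 2ηy²σy²/My (`Regular.integral_proxDual_sub_sq_le`). The target moves with x, but y* is
L/μ-Lipschitz, so a weighted Young inequality leaves the rate 1 − q/2 and charges a multiple of
E‖x^{k+1} − x^k‖² = (ηx²/N) E‖G̃_x‖². In the Jacobi scheme the contraction precedes the move of the
target and its noise is amplified by θ = (2−q)/(2(1−q)), whence the condition q < 1; in the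
Gauss-Seidel scheme the move comes first and θ = 1. This is the only difference between the two
cases, so `average_gradMap_sq_le` treats both with θ as a parameter.

Constants. With ηx = Nρ ηy³μ², the gain 6ρμ·(q/2) D_k exactly pays for the primal error and for the
D_k-part of E‖G̃_y‖²; and ρ is the positive root of 4Nρ(1+12ρ) = 1, which leaves a quarter of (ηx/N)
E‖G̃_x‖² in hand (`stepsize_margin`).

Integrability comes along the way: F is bounded below, so the pathwise descent inequality dominates
both F(x^{k+1}) and the gradient map. -/

lemma IsClosedConvex.coe_toReal {φ : E → EReal} (hφ : IsClosedConvex φ) {u : E}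
    (hu : u ∈ dom φ) : (((φ u).toReal : ℝ) : EReal) = φ u :=
  EReal.coe_toReal (ne_of_lt hu) (hφ.ne_bot u)

lemma IsClosedConvex.toReal_le_iff {φ : E → EReal} (hφ : IsClosedConvex φ) {u : E}
    (hu : u ∈ dom φ) {r : ℝ} : (φ u).toReal ≤ r ↔ φ u ≤ (r : EReal) := by
  rw [← EReal.coe_le_coe_iff, hφ.coe_toReal hu]

lemma IsClosedConvex.convexOn {φ : E → EReal} (hφ : IsClosedConvex φ) :
    ConvexOn ℝ (dom φ) fun u => (φ u).toReal := by
  have key : ∀ u ∈ dom φ, ∀ v ∈ dom φ, ∀ a b : ℝ, 0 ≤ a → 0 ≤ b → a + b = 1 →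
      φ (a • u + b • v) ≤ ((a * (φ u).toReal + b * (φ v).toReal : ℝ) : EReal) := by
    intro u hu v hv a b ha hb hab
    have := hφ.convex_epigraph (x := (u, (φ u).toReal)) (hφ.coe_toReal hu).ge
      (y := (v, (φ v).toReal)) (hφ.coe_toReal hv).ge ha hb hab
    simpa using this
  have hd : ∀ u ∈ dom φ, ∀ v ∈ dom φ, ∀ a b : ℝ, 0 ≤ a → 0 ≤ b → a + b = 1 →
      a • u + b • v ∈ dom φ := fun u hu v hv a b ha hb hab =>
    (key u hu v hv a b ha hb hab).trans_lt (EReal.coe_lt_top _)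
  refine ⟨fun u hu v hv a b ha hb hab => hd u hu v hv a b ha hb hab,
    fun u hu v hv a b ha hb hab => ?_⟩
  exact (hφ.toReal_le_iff (hd u hu v hv a b ha hb hab)).2 (key u hu v hv a b ha hb hab)

/-- Lower semicontinuity gives a minimum on the unit ball around `u₀`; a point farther away is
pulled back along the segment to `u₀` onto the unit sphere, and convexity transfers the bound with
linear loss. This replaces an affine minorant and suffices for coercivity. -/
lemma IsClosedConvex.exists_linear_lower_bound [ProperSpace E] {φ : E → EReal}
    (hφ : IsClosedConvex φ) {u₀ : E} (hu₀ : u₀ ∈ dom φ) :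
    ∃ A : ℝ, 0 ≤ A ∧ ∀ u ∈ dom φ, -A * (1 + ‖u - u₀‖) ≤ (φ u).toReal := by
  obtain ⟨v, hv, hmin⟩ := LowerSemicontinuousOn.exists_isMinOn
    (s := Metric.closedBall u₀ 1) ⟨u₀, by simp⟩ (isCompact_closedBall u₀ 1)
    (hφ.lsc.lowerSemicontinuousOn _)
  have hv0 : φ v ≤ φ u₀ := hmin (by simp)
  have hvd : v ∈ dom φ := hv0.trans_lt hu₀
  set b := (φ v).toReal with hb
  set c := (φ u₀).toReal with hc
  have hball : ∀ w ∈ dom φ, ‖w - u₀‖ ≤ 1 → b ≤ (φ w).toReal := by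
    intro w hw hw1
    rw [hb, hφ.toReal_le_iff hvd, hφ.coe_toReal hw]
    exact hmin (by simpa [dist_eq_norm] using hw1)
  refine ⟨|b| + |c|, by positivity, fun u hu => ?_⟩
  have h1 := neg_abs_le b
  have h2 := neg_abs_le c
  have h3 := le_abs_self c
  have h4 := abs_nonneg b
  have h5 := abs_nonneg c
  have h6 := norm_nonneg (u - u₀)
  rcases le_or_gt ‖u - u₀‖ 1 with hr | hr
  · have := hball u hu hr
    nlinarith
  · set r := ‖u - u₀‖ with hrdef
    have hr0 : 0 < r := by linarith
    have ht : 0 ≤ 1 - r⁻¹ := by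
      have := inv_le_one_of_one_le₀ hr.le
      linarith
    have hcv := hφ.convexOn.2 hu₀ hu ht (inv_nonneg.2 hr0.le) (by ring)
    have hwd := hφ.convexOn.1 hu₀ hu ht (inv_nonneg.2 hr0.le) (by ring)
    have hn : ‖((1 - r⁻¹) • u₀ + r⁻¹ • u) - u₀‖ ≤ 1 := by
      have : ((1 - r⁻¹) • u₀ + r⁻¹ • u) - u₀ = r⁻¹ • (u - u₀) := by module
      rw [this, norm_smul, Real.norm_of_nonneg (inv_nonneg.2 hr0.le), ← hrdef,
        inv_mul_cancel₀ hr0.ne']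
    have hbw := (hball _ hwd hn).trans hcv
    simp only [smul_eq_mul] at hbw
    have : r * b ≤ (r - 1) * c + (φ u).toReal := by
      have := mul_le_mul_of_nonneg_left hbw hr0.le
      rw [mul_add, ← mul_assoc, ← mul_assoc, mul_sub, mul_inv_cancel₀ hr0.ne'] at this
      linarith
    nlinarith

/-- Compare the minimizer with the point at parameter t of the segment from `p` to `u`, divide the
strong convexity inequality by t and let t tend to 0. All later uses of optimality go through this
inequality, so no subdifferentials are needed. -/
lemma growth_of_isMinOn_of_strongConvexOn {C : Set E} {m : ℝ} {ψ : E → ℝ}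
    (hψ : StrongConvexOn C m ψ) {p : E} (hp : p ∈ C) (hmin : ∀ u ∈ C, ψ p ≤ ψ u) {u : E}
    (hu : u ∈ C) : ψ p + m / 2 * ‖u - p‖ ^ 2 ≤ ψ u := by
  set c := m / 2 * ‖u - p‖ ^ 2 with hc
  have key : ∀ t : ℝ, 0 < t → t < 1 → c - c * t ≤ ψ u - ψ p := by
    intro t ht0 ht1
    have h1 := hψ.2 hp hu (sub_nonneg.2 ht1.le) ht0.le (by ring)
    have h2 := hmin _ (hψ.1 hp hu (sub_nonneg.2 ht1.le) ht0.le (by ring))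
    simp only [smul_eq_mul] at h1
    rw [norm_sub_rev, mul_assoc (1 - t) t, ← hc] at h1
    refine le_of_mul_le_mul_left ?_ ht0
    linarith
  by_contra hlt
  have hd : 0 ≤ ψ u - ψ p := sub_nonneg.2 (hmin u hu)
  have hcd : ψ u - ψ p < c := by linarith
  have hc0 : 0 < c := hd.trans_lt hcd
  -- With d = ψ u − ψ p, this t makes c − c t = (c + d)/2, which exceeds d when d < c.
  have := key ((c - (ψ u - ψ p)) / (2 * c)) (by apply div_pos <;> linarith)
    (by rw [div_lt_one (by linarith)]; linarith)
  have h3 : c * ((c - (ψ u - ψ p)) / (2 * c)) = (c - (ψ u - ψ p)) / 2 := by field_simp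
  rw [h3] at this
  linarith

/-- Direct method: the linear lower bound on φ against the quadratic growth of q bounds a minimizing
sequence, and a cluster point is a minimizer. It serves twice, with q a squared distance (proximal
map) and with q = −f(x,·) (dual maximizer). -/
lemma IsClosedConvex.exists_argmin_add [ProperSpace E] {φ : E → EReal}
    (hφ : IsClosedConvex φ) {u₀ : E} (hu₀ : u₀ ∈ dom φ) {q : E → ℝ} {m : ℝ} (hm : 0 < m)
    (hqc : ContinuousOn q (dom φ)) (hq : StrongConvexOn (dom φ) m q) {ξ : E}
    (hξ : ∀ u ∈ dom φ, q u₀ + inner ℝ ξ (u - u₀) + m / 2 * ‖u - u₀‖ ^ 2 ≤ q u) :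
    ∃ p ∈ dom φ, ∀ u ∈ dom φ,
      (φ p).toReal + q p + m / 2 * ‖u - p‖ ^ 2 ≤ (φ u).toReal + q u := by
  obtain ⟨A, hA, hlow⟩ := hφ.exists_linear_lower_bound hu₀
  set ψ : E → ℝ := fun u => (φ u).toReal + q u with hψ
  have hsc : StrongConvexOn (dom φ) m ψ := by
    refine ⟨hq.1, fun x hx y hy a b ha hb hab => ?_⟩
    have h1 := hφ.convexOn.2 hx hy ha hb hab
    have h2 := hq.2 hx hy ha hb hab
    simp only [hψ, smul_eq_mul] at *
    linarith
  have hq_low : ∀ u ∈ dom φ,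
      q u₀ - ‖ξ‖ * ‖u - u₀‖ + m / 2 * ‖u - u₀‖ ^ 2 ≤ q u := by
    intro u hu
    have h1 := hξ u hu
    have h2 := (abs_le.1 (abs_real_inner_le_norm ξ (u - u₀))).1
    linarith
  set B := A + ‖ξ‖ with hB
  have hB0 : 0 ≤ B := by positivity
  have hψ_low : ∀ u ∈ dom φ,
      q u₀ - A - B * ‖u - u₀‖ + m / 2 * ‖u - u₀‖ ^ 2 ≤ ψ u := by
    intro u hu
    have h1 := hlow u hu
    have h2 := hq_low u hu
    simp only [hψ, hB]
    linarith
  have hψ_bdd : BddBelow (ψ '' dom φ) := by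
    refine ⟨q u₀ - A - B ^ 2 / (2 * m), ?_⟩
    rintro _ ⟨u, hu, rfl⟩
    refine le_trans ?_ (hψ_low u hu)
    have : B ^ 2 / (2 * m) - B * ‖u - u₀‖ + m / 2 * ‖u - u₀‖ ^ 2
        = (B - m * ‖u - u₀‖) ^ 2 / (2 * m) := by field_simp; ring
    have h0 : 0 ≤ (B - m * ‖u - u₀‖) ^ 2 / (2 * m) := by positivity
    linarith
  set I := sInf (ψ '' dom φ) with hI
  have hne : (ψ '' dom φ).Nonempty := ⟨_, u₀, hu₀, rfl⟩
  obtain ⟨a, -, ha_tend, ha_mem⟩ := exists_seq_tendsto_sInf hne hψ_bdd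
  choose v hv hva using ha_mem
  have hψv : Tendsto (fun k => ψ (v k)) atTop (𝓝 I) := by simpa [hva] using ha_tend
  obtain ⟨c, hc⟩ := hψv.bddAbove_range
  have hc' : ∀ k, ψ (v k) ≤ c := fun k => hc ⟨k, rfl⟩
  -- If r > R then m r/2 ≥ B + 1, so the lower bound on ψ exceeds q u₀ − A + r, hence c.
  set R := (2 * B + 2) / m + |c - q u₀ + A| with hR
  have hR0 : 0 ≤ R := by positivity
  have hvb : ∀ k, ‖v k - u₀‖ ≤ R := by
    intro k
    by_contra hlt
    push Not at hlt
    have h1 := (hψ_low _ (hv k)).trans (hc' k)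
    set r := ‖v k - u₀‖
    have h2 : (2 * B + 2) / m ≤ r := by
      have := abs_nonneg (c - q u₀ + A); linarith
    rw [div_le_iff₀ hm] at h2
    have h3 : |c - q u₀ + A| < r := by
      have : 0 ≤ (2 * B + 2) / m := by positivity
      linarith
    have h4 := le_abs_self (c - q u₀ + A)
    have hr0 : 0 < r := (abs_nonneg _).trans_lt h3
    nlinarith [mul_le_mul_of_nonneg_right h2 hr0.le]
  obtain ⟨p, -, κ, hκ, hlim⟩ := tendsto_subseq_of_bounded
    (Metric.isBounded_closedBall (x := u₀) (r := R))
    (x := v) (fun k => by simpa [dist_eq_norm] using hvb k)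
  have hφv : ∀ k, (φ (v k)).toReal ≤ c - q u₀ + ‖ξ‖ * R := by
    intro k
    have h1 := hc' k
    have h2 := hq_low _ (hv k)
    have h3 : ‖ξ‖ * ‖v k - u₀‖ ≤ ‖ξ‖ * R := by gcongr; exact hvb k
    have h4 : 0 ≤ m / 2 * ‖v k - u₀‖ ^ 2 := by positivity
    simp only [hψ] at h1
    linarith
  -- q is continuous only on `dom φ`, so the limit has to be placed there first: φ is bounded along
  -- the sequence and its sublevel sets are closed.
  have hp : p ∈ dom φ := by
    have := (hφ.lsc.isClosed_preimage ((c - q u₀ + ‖ξ‖ * R : ℝ) : EReal)).mem_of_tendsto hlim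
      (Eventually.of_forall fun k => (hφ.toReal_le_iff (hv _)).1 (hφv (κ k)))
    exact lt_of_le_of_lt this (EReal.coe_lt_top _)
  have hqlim : Tendsto (fun k => q (v (κ k))) atTop (𝓝 (q p)) :=
    (hqc p hp).tendsto.comp (tendsto_nhdsWithin_iff.2 ⟨hlim, Eventually.of_forall fun k => hv _⟩)
  have hψp : ψ p ≤ I := by
    refine le_of_forall_pos_le_add fun ε hε => ?_
    have hlt : (((φ p).toReal - ε : ℝ) : EReal) < φ p := by
      rw [← hφ.coe_toReal hp, EReal.coe_lt_coe_iff]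
      simpa using hε
    have hev := hlim.eventually (hφ.lsc p _ hlt)
    have hlim2 : Tendsto (fun k => (φ p).toReal - ε + q (v (κ k))) atTop
        (𝓝 ((φ p).toReal - ε + q p)) := tendsto_const_nhds.add hqlim
    have := le_of_tendsto_of_tendsto hlim2 (hψv.comp hκ.tendsto_atTop) (hev.mono fun k hk => by
      have hk' : (φ p).toReal - ε < (φ (v (κ k))).toReal := by
        rw [← EReal.coe_lt_coe_iff, hφ.coe_toReal (hv _)]; exact hk
      simp only [Function.comp_apply, hψ]
      linarith)
    simp only [hψ]
    linarith
  refine ⟨p, hp, fun u hu => ?_⟩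
  exact growth_of_isMinOn_of_strongConvexOn hsc hp
    (fun u hu => hψp.trans (csInf_le hψ_bdd ⟨u, hu, rfl⟩)) hu

/-- The defining property of the proximal map together with its quadratic growth. -/
lemma IsClosedConvex.prox_spec [ProperSpace E] {φ : E → EReal} (hφ : IsClosedConvex φ)
    (hne : (dom φ).Nonempty) {η : ℝ} (hη : 0 < η) (v : E) :
    prox (fun u => (η : EReal) * φ u) v ∈ dom φ ∧ ∀ u ∈ dom φ,
      η * (φ (prox (fun u => (η : EReal) * φ u) v)).toReal
          + ‖prox (fun u => (η : EReal) * φ u) v - v‖ ^ 2 / 2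
          + ‖u - prox (fun u => (η : EReal) * φ u) v‖ ^ 2 / 2
        ≤ η * (φ u).toReal + ‖u - v‖ ^ 2 / 2 := by
  obtain ⟨u₀, hu₀⟩ := hne
  -- The objective is divided by η, so that closed convexity is needed for φ alone and not for η φ.
  have hsq : StrongConvexOn (dom φ) η⁻¹ fun u => η⁻¹ * (‖u - v‖ ^ 2 / 2) := by
    refine ⟨hφ.convexOn.1, fun x _ y _ a b ha hb hab => le_of_eq ?_⟩
    obtain rfl : b = 1 - a := by linarith
    have e1 : a • x + (1 - a) • y - v = a • (x - v) + (1 - a) • (y - v) := by module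
    have e2 : x - y = (x - v) - (y - v) := by abel
    simp only [smul_eq_mul]
    rw [e1, e2, norm_add_sq_real, norm_sub_sq_real (x - v), norm_smul, norm_smul, mul_pow, mul_pow,
      real_inner_smul_left, real_inner_smul_right, Real.norm_eq_abs, Real.norm_eq_abs, sq_abs,
      sq_abs]
    ring
  obtain ⟨p, hp, hpmin⟩ := hφ.exists_argmin_add hu₀ (inv_pos.2 hη)
    (q := fun u => η⁻¹ * (‖u - v‖ ^ 2 / 2)) (by fun_prop) hsq (ξ := η⁻¹ • (u₀ - v))
    (fun u _ => le_of_eq (by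
      have e : u - v = (u₀ - v) + (u - u₀) := by abel
      rw [e, norm_add_sq_real, real_inner_smul_left]
      ring))
  have coe_eq : ∀ u ∈ dom φ, (η : EReal) * φ u + ((‖u - v‖ ^ 2 / 2 : ℝ) : EReal)
      = ((η * (φ u).toReal + ‖u - v‖ ^ 2 / 2 : ℝ) : EReal) := fun u hu => by
    rw [← hφ.coe_toReal hu]
    simp
  -- The minimizer found above only certifies that the `epsilon` choice is minimal; membership in
  -- the domain and growth are then derived for the chosen point.
  have spec := Classical.epsilon_spec (p := fun p => ∀ u,
    (η : EReal) * φ p + ((‖p - v‖ ^ 2 / 2 : ℝ) : EReal)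
      ≤ (η : EReal) * φ u + ((‖u - v‖ ^ 2 / 2 : ℝ) : EReal)) ⟨p, fun u => by
    by_cases hu : u ∈ dom φ
    · rw [coe_eq p hp, coe_eq u hu, EReal.coe_le_coe_iff]
      have h1 := hpmin u hu
      have h2 : 0 ≤ η⁻¹ / 2 * ‖u - p‖ ^ 2 := by positivity
      have h3 : (φ p).toReal + η⁻¹ * (‖p - v‖ ^ 2 / 2)
        ≤ (φ u).toReal + η⁻¹ * (‖u - v‖ ^ 2 / 2) := by linarith
      have h4 := mul_le_mul_of_nonneg_left h3 hη.le
      simpa only [mul_add, mul_inv_cancel_left₀ hη.ne'] using h4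
    · have : φ u = ⊤ := not_lt_top_iff.1 hu
      rw [this, EReal.coe_mul_top_of_pos hη, EReal.top_add_coe]
      exact le_top⟩
  change ∀ u, (η : EReal) * φ (prox (fun u => (η : EReal) * φ u) v)
      + ((‖prox (fun u => (η : EReal) * φ u) v - v‖ ^ 2 / 2 : ℝ) : EReal)
    ≤ (η : EReal) * φ u + ((‖u - v‖ ^ 2 / 2 : ℝ) : EReal) at spec
  generalize prox (fun u => (η : EReal) * φ u) v = p' at *
  have hp' : p' ∈ dom φ := by
    by_contra h
    have htop : φ p' = ⊤ := not_lt_top_iff.1 h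
    have := spec u₀
    rw [htop, EReal.coe_mul_top_of_pos hη, EReal.top_add_coe, coe_eq u₀ hu₀] at this
    exact absurd this (not_le.2 (EReal.coe_lt_top _))
  refine ⟨hp', fun u hu => ?_⟩
  have hsc : StrongConvexOn (dom φ) η⁻¹
      fun u => (φ u).toReal + η⁻¹ * (‖u - v‖ ^ 2 / 2) := by
    refine ⟨hsq.1, fun x hx y hy a b ha hb hab => ?_⟩
    have h1 := hφ.convexOn.2 hx hy ha hb hab
    have h2 := hsq.2 hx hy ha hb hab
    simp only [smul_eq_mul] at *
    linarith
  have := growth_of_isMinOn_of_strongConvexOn hsc hp' (fun u hu => by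
    have h := spec u
    rw [coe_eq p' hp', coe_eq u hu, EReal.coe_le_coe_iff] at h
    have h' := mul_le_mul_of_nonneg_left h (inv_nonneg.2 hη.le)
    simpa only [mul_add, inv_mul_cancel_left₀ hη.ne'] using h') hu
  have h4 := mul_le_mul_of_nonneg_left this hη.le
  have h5 : η * (η⁻¹ / 2 * ‖u - p'‖ ^ 2) = ‖u - p'‖ ^ 2 / 2 := by field_simp
  simp only [mul_add, mul_inv_cancel_left₀ hη.ne', h5] at h4
  exact h4

/-- Test the growth inequality of each proximal point at the other one and add: the values of φ
cancel and ‖p − q‖² ≤ ⟨v − w, p − q⟩ remains. -/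
lemma IsClosedConvex.norm_prox_sub_prox_le [ProperSpace E] {φ : E → EReal}
    (hφ : IsClosedConvex φ) (hne : (dom φ).Nonempty) {η : ℝ} (hη : 0 < η) (v w : E) :
    ‖prox (fun u => (η : EReal) * φ u) v - prox (fun u => (η : EReal) * φ u) w‖ ≤ ‖v - w‖ := by
  obtain ⟨hp, hp'⟩ := hφ.prox_spec hne hη v
  obtain ⟨hq, hq'⟩ := hφ.prox_spec hne hη w
  generalize prox (fun u => (η : EReal) * φ u) v = p at *
  generalize prox (fun u => (η : EReal) * φ u) w = q at *
  have h1 := hp' q hq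
  have h2 := hq' p hp
  have e1 : q - v = (p - v) - (p - q) := by abel
  have e2 : q - p = -(p - q) := by abel
  have e3 : p - w = (p - q) + (q - w) := by abel
  have e4 : (p - v) - (q - w) = (p - q) - (v - w) := by abel
  rw [e1, e2, norm_neg, norm_sub_sq_real (p - v)] at h1
  rw [e3, norm_add_sq_real, real_inner_comm] at h2
  have h3 : inner ℝ (p - v) (p - q) - inner ℝ (q - w) (p - q)
      = ‖p - q‖ ^ 2 - inner ℝ (v - w) (p - q) := by
    rw [← inner_sub_left, e4, inner_sub_left, real_inner_self_eq_norm_sq]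
  have h4 := real_inner_le_norm (v - w) (p - q)
  have h5 : ‖p - q‖ * ‖p - q‖ ≤ ‖v - w‖ * ‖p - q‖ := by nlinarith
  rcases (norm_nonneg (p - q)).eq_or_lt with h0 | h0
  · rw [← h0]; positivity
  · exact le_of_mul_le_mul_right h5 h0

lemma IsClosedConvex.continuous_prox [ProperSpace E] {φ : E → EReal}
    (hφ : IsClosedConvex φ) (hne : (dom φ).Nonempty) {η : ℝ} (hη : 0 < η) :
    Continuous (prox fun u => (η : EReal) * φ u) :=
  (LipschitzWith.of_dist_le_mul (K := 1) fun v w => by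
    simpa [dist_eq_norm] using hφ.norm_prox_sub_prox_le hne hη v w).continuous

/-- The descent lemma for a gradient that is Lipschitz on a convex set. -/
lemma abs_sub_sub_inner_gradient_le [CompleteSpace E] {f : E → ℝ} {C : Set E}
    (hC : Convex ℝ C) (hf : ∀ z ∈ C, DifferentiableAt ℝ f z) {L : ℝ}
    (hL : ∀ z ∈ C, ∀ z' ∈ C, ‖∇ f z - ∇ f z'‖ ≤ L * ‖z - z'‖) {z z' : E} (hz : z ∈ C)
    (hz' : z' ∈ C) :
    |f z' - f z - inner ℝ (∇ f z) (z' - z)| ≤ L / 2 * ‖z' - z‖ ^ 2 := by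
  set d := z' - z with hd
  have hmem : ∀ t ∈ Set.Icc (0 : ℝ) 1, z + t • d ∈ C := fun t ht =>
    hC.add_smul_sub_mem hz hz' ht
  have hline : ∀ t : ℝ, HasDerivAt (fun t : ℝ => z + t • d) d t := fun t => by
    simpa using ((hasDerivAt_id t).smul_const d).const_add z
  have hder : ∀ t ∈ Set.Icc (0 : ℝ) 1,
      HasDerivAt (fun t : ℝ => f (z + t • d) - f z - t * inner ℝ (∇ f z) d)
        (inner ℝ (∇ f (z + t • d) - ∇ f z) d) t := by
    intro t ht
    have h1 := (hf _ (hmem t ht)).hasGradientAt.hasFDerivAt.comp_hasDerivAt t (hline t)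
    have h2 := (h1.sub_const (f z)).sub ((hasDerivAt_id t).mul_const (inner ℝ (∇ f z) d))
    have h3 : inner ℝ (∇ f (z + t • d) - ∇ f z) d
        = (InnerProductSpace.toDual ℝ E) (∇ f (z + t • d)) d - 1 * inner ℝ (∇ f z) d := by
      rw [inner_sub_left, one_mul, InnerProductSpace.toDual_apply_apply]
    rw [h3]
    exact h2
  -- Along the segment the remainder has derivative at most L‖d‖²t in absolute value, the derivative
  -- of (L/2)‖d‖²t².
  have := image_norm_le_of_norm_deriv_right_le_deriv_boundary (a := (0 : ℝ)) (b := 1)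
    (f := fun t : ℝ => f (z + t • d) - f z - t * inner ℝ (∇ f z) d)
    (f' := fun t => inner ℝ (∇ f (z + t • d) - ∇ f z) d)
    (B := fun t => L / 2 * ‖d‖ ^ 2 * t ^ 2) (B' := fun t => L / 2 * ‖d‖ ^ 2 * (2 * t))
    (fun t ht => (hder t ht).continuousAt.continuousWithinAt)
    (fun t ht => (hder t ⟨ht.1, ht.2.le⟩).hasDerivWithinAt) (by simp)
    (fun t => by simpa using (hasDerivAt_pow 2 t).const_mul (L / 2 * ‖d‖ ^ 2))
    (fun t ht => by
      have h1 := hL _ (hmem t ⟨ht.1, ht.2.le⟩) z hz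
      rw [add_sub_cancel_left, norm_smul, Real.norm_of_nonneg ht.1] at h1
      refine (norm_inner_le_norm _ _).trans ?_
      nlinarith [mul_le_mul_of_nonneg_right h1 (norm_nonneg d)])
    (Set.right_mem_Icc.2 zero_le_one)
  simpa [hd] using this

/-- The first-order inequality for strongly concave functions. -/
lemma le_of_strongConcaveOn_of_hasGradientAt [CompleteSpace E] {q : E → ℝ} {C : Set E} {m : ℝ}
    (hq : StrongConcaveOn C m q) {y y' g : E} (hy : y ∈ C) (hy' : y' ∈ C)
    (hg : HasGradientAt q g y) :
    q y' ≤ q y + inner ℝ g (y' - y) - m / 2 * ‖y' - y‖ ^ 2 := by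
  set d := y' - y with hd
  have hline : HasDerivAt (fun t : ℝ => y + t • d) d 0 := by
    simpa using ((hasDerivAt_id (0 : ℝ)).smul_const d).const_add y
  have hder : HasDerivAt (fun t : ℝ => q (y + t • d)) (inner ℝ g d) 0 := by
    have h0 : HasGradientAt q g (y + (0 : ℝ) • d) := by simpa using hg
    simpa [Function.comp_def] using h0.hasFDerivAt.comp_hasDerivAt (0 : ℝ) hline
  have hlim := hder.tendsto_slope_zero_right
  have hlim2 : Tendsto (fun t : ℝ => q y' - q y + (1 - t) * (m / 2 * ‖d‖ ^ 2)) (𝓝[>] 0)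
      (𝓝 (q y' - q y + (1 - 0) * (m / 2 * ‖d‖ ^ 2))) :=
    (Continuous.tendsto (by fun_prop) (0 : ℝ)).mono_left nhdsWithin_le_nhds
  have := le_of_tendsto_of_tendsto hlim2 hlim (by
    filter_upwards [Ioo_mem_nhdsGT (zero_lt_one (α := ℝ))] with t ht
    have h1 := hq.2 hy hy' (sub_nonneg.2 ht.2.le) ht.1.le (by ring)
    have e : (1 - t) • y + t • y' = y + t • d := by rw [hd]; module
    rw [e, norm_sub_rev, ← hd] at h1
    simp only [smul_eq_mul, zero_add, zero_smul, add_zero] at h1 ⊢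
    rw [inv_mul_eq_div, le_div_iff₀ ht.1]
    linarith)
  linarith

end ConvexAnalysis

/-! ### The dual maximizer and the primal objective. -/

namespace Problem

variable {N : ℕ} {n : Fin N → ℕ} {m : ℕ}

/-- The coupling term as a function of two variables. -/
def coupling (p : Problem n m) (x : Primal n) (y : Dual m) : ℝ := p.f (WithLp.toLp 2 (x, y))

/-- The maximizer of `f(x,·) - h`, set to `0` outside `dom g`. -/
noncomputable def argmaxDual (p : Problem n m) (x : Primal n) : Dual m :=
  open Classical in
  if x ∈ p.domG then Classical.epsilon fun b => b ∈ dom p.h ∧ ∀ y ∈ dom p.h,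
    p.coupling x y - (p.h y).toReal ≤ p.coupling x b - (p.h b).toReal
  else 0

/-- The product `dom g × dom h` inside the joint Euclidean space. -/
def domProd (p : Problem n m) : Set (WithLp 2 (Primal n × Dual m)) :=
  {z | z.fst ∈ p.domG ∧ z.snd ∈ dom p.h}

variable {p : Problem n m} {L μ : ℝ}

lemma Regular.convex_domG (hp : p.Regular L μ) : Convex ℝ p.domG :=
  fun _ hx _ hy _ _ ha hb hab i =>
    (hp.closedConvex_g i).convexOn.1 (hx i) (hy i) ha hb hab

lemma Regular.convex_dom_h (hp : p.Regular L μ) : Convex ℝ (dom p.h) :=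
  hp.closedConvex_h.convexOn.1

lemma Regular.convex_domProd (hp : p.Regular L μ) : Convex ℝ p.domProd :=
  fun _ hz _ hz' _ _ ha hb hab =>
    ⟨hp.convex_domG hz.1 hz'.1 ha hb hab, hp.convex_dom_h hz.2 hz'.2 ha hb hab⟩

lemma Regular.differentiableAt (hp : p.Regular L μ) {z : WithLp 2 (Primal n × Dual m)}
    (hz : z ∈ p.domProd) : DifferentiableAt ℝ p.f z := by
  obtain ⟨U, hU, hDU, hf⟩ := hp.differentiable
  exact hf.differentiableAt (hU.mem_nhds (hDU _ hz.1 _ hz.2))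

lemma Regular.norm_gradient_sub_le (hp : p.Regular L μ) {z z' : WithLp 2 (Primal n × Dual m)}
    (hz : z ∈ p.domProd) (hz' : z' ∈ p.domProd) : ‖∇ p.f z - ∇ p.f z'‖ ≤ L * ‖z - z'‖ :=
  hp.lipschitz _ hz.1 _ hz.2 _ hz'.1 _ hz'.2

lemma norm_toLp_sub_fst (x x' : Primal n) (y : Dual m) :
    ‖WithLp.toLp 2 (x, y) - WithLp.toLp 2 (x', y)‖ = ‖x - x'‖ := by
  rw [← WithLp.toLp_sub, Prod.mk_sub_mk, sub_self, WithLp.norm_toLp_fst]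

lemma norm_toLp_sub_snd (x : Primal n) (y y' : Dual m) :
    ‖WithLp.toLp 2 (x, y) - WithLp.toLp 2 (x, y')‖ = ‖y - y'‖ := by
  rw [← WithLp.toLp_sub, Prod.mk_sub_mk, sub_self, WithLp.norm_toLp_snd]

lemma inner_gradient_toLp_sub_fst (p : Problem n m) (x x' : Primal n) (y : Dual m) :
    inner ℝ (∇ p.f (WithLp.toLp 2 (x, y))) (WithLp.toLp 2 (x', y) - WithLp.toLp 2 (x, y))
      = inner ℝ (p.gradX x y) (x' - x) := by
  rw [WithLp.prod_inner_apply]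
  simp [gradX]

lemma inner_gradient_toLp_sub_snd (p : Problem n m) (x : Primal n) (y y' : Dual m) :
    inner ℝ (∇ p.f (WithLp.toLp 2 (x, y))) (WithLp.toLp 2 (x, y') - WithLp.toLp 2 (x, y))
      = inner ℝ (p.gradY x y) (y' - y) := by
  rw [WithLp.prod_inner_apply]
  simp [gradY]

lemma Regular.abs_coupling_sub_fst_le (hp : p.Regular L μ) {x x' : Primal n} {y : Dual m}
    (hx : x ∈ p.domG) (hx' : x' ∈ p.domG) (hy : y ∈ dom p.h) :
    |p.coupling x' y - p.coupling x y - inner ℝ (p.gradX x y) (x' - x)|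
      ≤ L / 2 * ‖x' - x‖ ^ 2 := by
  have := abs_sub_sub_inner_gradient_le hp.convex_domProd (fun z hz => hp.differentiableAt hz)
    (fun z hz z' hz' => hp.norm_gradient_sub_le hz hz')
    (z := WithLp.toLp 2 (x, y)) (z' := WithLp.toLp 2 (x', y)) ⟨hx, hy⟩ ⟨hx', hy⟩
  rwa [inner_gradient_toLp_sub_fst, norm_toLp_sub_fst] at this

lemma Regular.abs_coupling_sub_snd_le (hp : p.Regular L μ) {x : Primal n} {y y' : Dual m}
    (hx : x ∈ p.domG) (hy : y ∈ dom p.h) (hy' : y' ∈ dom p.h) :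
    |p.coupling x y' - p.coupling x y - inner ℝ (p.gradY x y) (y' - y)|
      ≤ L / 2 * ‖y' - y‖ ^ 2 := by
  have := abs_sub_sub_inner_gradient_le hp.convex_domProd (fun z hz => hp.differentiableAt hz)
    (fun z hz z' hz' => hp.norm_gradient_sub_le hz hz')
    (z := WithLp.toLp 2 (x, y)) (z' := WithLp.toLp 2 (x, y')) ⟨hx, hy⟩ ⟨hx, hy'⟩
  rwa [inner_gradient_toLp_sub_snd, norm_toLp_sub_snd] at this

lemma Regular.norm_gradX_sub_le (hp : p.Regular L μ) {x : Primal n} {y y' : Dual m}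
    (hx : x ∈ p.domG) (hy : y ∈ dom p.h) (hy' : y' ∈ dom p.h) :
    ‖p.gradX x y - p.gradX x y'‖ ≤ L * ‖y - y'‖ := by
  have h := hp.norm_gradient_sub_le (z := WithLp.toLp 2 (x, y)) (z' := WithLp.toLp 2 (x, y'))
    ⟨hx, hy⟩ ⟨hx, hy'⟩
  rw [norm_toLp_sub_snd] at h
  exact (WithLp.norm_fst_le _ _).trans h

lemma Regular.hasGradientAt_coupling (hp : p.Regular L μ) {x : Primal n} {y : Dual m}
    (hx : x ∈ p.domG) (hy : y ∈ dom p.h) :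
    HasGradientAt (fun y => p.coupling x y) (p.gradY x y) y := by
  have h := (hp.differentiableAt (z := WithLp.toLp 2 (x, y)) ⟨hx, hy⟩).hasGradientAt.hasFDerivAt
  have h2 : HasFDerivAt (fun y : Dual m => (WithLp.toLp 2 (x, y) : WithLp 2 (Primal n × Dual m)))
      ((WithLp.prodContinuousLinearEquiv 2 ℝ (Primal n) (Dual m)).symm.toContinuousLinearMap.comp
        (ContinuousLinearMap.inr ℝ (Primal n) (Dual m))) y :=
    ((WithLp.prodContinuousLinearEquiv 2 ℝ (Primal n) (Dual m)).symm.hasFDerivAt).comp y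
      (hasFDerivAt_prodMk_right x y)
  have h3 := h.comp y h2
  rw [hasGradientAt_iff_hasFDerivAt]
  have e : InnerProductSpace.toDual ℝ (Dual m) (p.gradY x y)
      = (InnerProductSpace.toDual ℝ (WithLp 2 (Primal n × Dual m))
          (∇ p.f (WithLp.toLp 2 (x, y)))).comp
        ((WithLp.prodContinuousLinearEquiv 2 ℝ (Primal n)
          (Dual m)).symm.toContinuousLinearMap.comp
          (ContinuousLinearMap.inr ℝ (Primal n) (Dual m))) := by
    refine ContinuousLinearMap.ext fun v => ?_
    change inner ℝ (p.gradY x y) v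
      = inner ℝ (∇ p.f (WithLp.toLp 2 (x, y))) (WithLp.toLp 2 ((0 : Primal n), v))
    rw [WithLp.prod_inner_apply]
    simp [gradY]
  rw [e]
  exact h3

lemma Regular.coupling_le (hp : p.Regular L μ) {x : Primal n} {y y' : Dual m}
    (hx : x ∈ p.domG) (hy : y ∈ dom p.h) (hy' : y' ∈ dom p.h) :
    p.coupling x y' ≤ p.coupling x y + inner ℝ (p.gradY x y) (y' - y)
      - μ / 2 * ‖y' - y‖ ^ 2 :=
  le_of_strongConcaveOn_of_hasGradientAt (hp.strongConcave x hx) hy hy'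
    (hp.hasGradientAt_coupling hx hy)

/-- A mixed second difference of f: differentiate f(·,y) − f(·,y') along the segment from x to x';
the derivative pairs d with a difference of x-gradients at the same x, which is at most L‖y − y'‖.
-/
lemma Regular.abs_coupling_cross_le (hp : p.Regular L μ) {x x' : Primal n} {y y' : Dual m}
    (hx : x ∈ p.domG) (hx' : x' ∈ p.domG) (hy : y ∈ dom p.h) (hy' : y' ∈ dom p.h) :
    |(p.coupling x' y - p.coupling x' y') - (p.coupling x y - p.coupling x y')|
      ≤ L * ‖y - y'‖ * ‖x' - x‖ := by
  set d := x' - x with hd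
  have hmem : ∀ t ∈ Set.Icc (0 : ℝ) 1, x + t • d ∈ p.domG := fun t ht =>
    hp.convex_domG.add_smul_sub_mem hx hx' ht
  have hder : ∀ v ∈ dom p.h, ∀ t ∈ Set.Icc (0 : ℝ) 1,
      HasDerivAt (fun t : ℝ => p.coupling (x + t • d) v)
        (inner ℝ (p.gradX (x + t • d) v) d) t := by
    intro v hv t ht
    have h1 := (hp.differentiableAt (z := WithLp.toLp 2 (x + t • d, v))
      ⟨hmem t ht, hv⟩).hasGradientAt.hasFDerivAt
    have h2 : HasDerivAt
        (fun t : ℝ => (WithLp.toLp 2 (x + t • d, v) : WithLp 2 (Primal n × Dual m)))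
        (WithLp.toLp 2 (d, 0)) t := by
      have h3 : HasDerivAt (fun t : ℝ => (x + t • d, v)) (d, (0 : Dual m)) t :=
        (by simpa using ((hasDerivAt_id t).smul_const d).const_add x : HasDerivAt
          (fun t : ℝ => x + t • d) d t).prodMk (hasDerivAt_const t v)
      exact (WithLp.prodContinuousLinearEquiv 2 ℝ (Primal n)
        (Dual m)).symm.hasFDerivAt.comp_hasDerivAt t h3
    have h4 := h1.comp_hasDerivAt t h2
    have e : inner ℝ (p.gradX (x + t • d) v) d
        = InnerProductSpace.toDual ℝ (WithLp 2 (Primal n × Dual m))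
          (∇ p.f (WithLp.toLp 2 (x + t • d, v))) (WithLp.toLp 2 (d, 0)) := by
      rw [InnerProductSpace.toDual_apply_apply, WithLp.prod_inner_apply]
      simp [gradX]
    rw [e]
    exact h4
  have := norm_image_sub_le_of_norm_deriv_le_segment_01'
    (f := fun t : ℝ => p.coupling (x + t • d) y - p.coupling (x + t • d) y')
    (f' := fun t => inner ℝ (p.gradX (x + t • d) y) d - inner ℝ (p.gradX (x + t • d) y') d)
    (C := L * ‖y - y'‖ * ‖d‖)
    (fun t ht => ((hder y hy t ht).sub (hder y' hy' t ht)).hasDerivWithinAt)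
    (fun t ht => by
      rw [← inner_sub_left]
      refine (norm_inner_le_norm _ _).trans ?_
      gcongr
      exact hp.norm_gradX_sub_le (hmem t ⟨ht.1, ht.2.le⟩) hy hy')
  simpa [hd] using this

lemma Regular.continuousOn_coupling (hp : p.Regular L μ) :
    ContinuousOn p.f p.domProd :=
  fun _ hz => (hp.differentiableAt hz).continuousAt.continuousWithinAt

/-- The defining property of the dual maximizer together with its quadratic growth. -/
lemma Regular.argmaxDual_spec (hp : p.Regular L μ) (hμ : 0 < μ) (hne : (dom p.h).Nonempty)
    {x : Primal n} (hx : x ∈ p.domG) :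
    p.argmaxDual x ∈ dom p.h ∧ ∀ y ∈ dom p.h,
      p.coupling x y - (p.h y).toReal + μ / 2 * ‖y - p.argmaxDual x‖ ^ 2
        ≤ p.coupling x (p.argmaxDual x) - (p.h (p.argmaxDual x)).toReal := by
  obtain ⟨u₀, hu₀⟩ := hne
  have hsc : StrongConvexOn (dom p.h) μ fun y => -p.coupling x y :=
    (hp.strongConcave x hx).neg
  obtain ⟨a, ha, hmax⟩ := hp.closedConvex_h.exists_argmin_add hu₀ hμ
    (q := fun y => -p.coupling x y)
    (fun y hy => ((hp.hasGradientAt_coupling hx hy).continuousAt.neg).continuousWithinAt)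
    hsc (ξ := -p.gradY x u₀)
    (fun u hu => by
      have := hp.coupling_le hx hu₀ hu
      rw [inner_neg_left]
      linarith)
  have hspec := Classical.epsilon_spec (p := fun a => a ∈ dom p.h ∧ ∀ y ∈ dom p.h,
    p.coupling x y - (p.h y).toReal ≤ p.coupling x a - (p.h a).toReal) ⟨a, ha, fun y hy => by
      have h1 := hmax y hy
      have h2 : 0 ≤ μ / 2 * ‖y - a‖ ^ 2 := by positivity
      linarith⟩
  have hdef : p.argmaxDual x = Classical.epsilon fun a => a ∈ dom p.h ∧ ∀ y ∈ dom p.h,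
      p.coupling x y - (p.h y).toReal ≤ p.coupling x a - (p.h a).toReal := by
    simp only [argmaxDual, hx, if_true]
  rw [← hdef] at hspec
  refine ⟨hspec.1, fun y hy => ?_⟩
  have hψ : StrongConvexOn (dom p.h) μ fun y => (p.h y).toReal - p.coupling x y := by
    refine ⟨hsc.1, fun u hu v hv a b ha hb hab => ?_⟩
    have h1 := hp.closedConvex_h.convexOn.2 hu hv ha hb hab
    have h2 := hsc.2 hu hv ha hb hab
    simp only [smul_eq_mul] at *
    linarith
  have := growth_of_isMinOn_of_strongConvexOn hψ hspec.1
    (fun u hu => by have := hspec.2 u hu; linarith) hy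
  linarith

/-- Test the growth inequality at each of the two maximizers against the other and add: h cancels
and the values of f form a mixed second difference, so μ r² ≤ L r ‖x' − x‖ with r the distance
between the maximizers. -/
lemma Regular.norm_argmaxDual_sub_le (hp : p.Regular L μ) (hμ : 0 < μ)
    (hne : (dom p.h).Nonempty) {x x' : Primal n} (hx : x ∈ p.domG) (hx' : x' ∈ p.domG) :
    ‖p.argmaxDual x' - p.argmaxDual x‖ ≤ L / μ * ‖x' - x‖ := by
  obtain ⟨ha, hmax⟩ := hp.argmaxDual_spec hμ hne hx
  obtain ⟨ha', hmax'⟩ := hp.argmaxDual_spec hμ hne hx'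
  have h1 := hmax _ ha'
  have h2 := hmax' _ ha
  have h3 := (abs_le.1 (hp.abs_coupling_cross_le hx hx' ha' ha)).2
  rw [norm_sub_rev (p.argmaxDual x)] at h2
  set r := ‖p.argmaxDual x' - p.argmaxDual x‖
  have h4 : r * (μ * r) ≤ r * (L * ‖x' - x‖) := by nlinarith
  rw [div_mul_eq_mul_div, le_div_iff₀ hμ, mul_comm]
  rcases (norm_nonneg (p.argmaxDual x' - p.argmaxDual x)).eq_or_lt with h0 | h0
  · by_cases hL : 0 ≤ L * ‖x' - x‖
    · change 0 = r at h0
      rw [← h0, mul_zero]; exact hL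
    · exfalso
      push Not at hL
      have := hp.norm_gradient_sub_le (z := WithLp.toLp 2 (x', p.argmaxDual x))
        (z' := WithLp.toLp 2 (x, p.argmaxDual x)) ⟨hx', ha⟩ ⟨hx, ha⟩
      rw [norm_toLp_sub_fst] at this
      linarith [norm_nonneg (∇ p.f (WithLp.toLp 2 (x', p.argmaxDual x))
        - ∇ p.f (WithLp.toLp 2 (x, p.argmaxDual x)))]
  · exact le_of_mul_le_mul_left h4 h0

lemma Regular.coe_gSum (hp : p.Regular L μ) {x : Primal n} (hx : x ∈ p.domG) :
    p.gSum x = ((∑ i, (p.g i (x i)).toReal : ℝ) : EReal) := by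
  have key : ∀ s : Finset (Fin N), ∑ i ∈ s, p.g i (x i)
      = ((∑ i ∈ s, (p.g i (x i)).toReal : ℝ) : EReal) := fun s => by
    induction s using Finset.cons_induction with
    | empty => simp
    | cons i s hi ih =>
      rw [Finset.sum_cons, Finset.sum_cons, ih, EReal.coe_add,
        (hp.closedConvex_g i).coe_toReal (hx i)]
  exact key _

lemma Regular.coe_coupling_sub (hp : p.Regular L μ) {x : Primal n} {y : Dual m}
    (hy : y ∈ dom p.h) : ((p.f (WithLp.toLp 2 (x, y)) : ℝ) : EReal) - p.h y
      = ((p.coupling x y - (p.h y).toReal : ℝ) : EReal) := by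
  rw [← hp.closedConvex_h.coe_toReal hy, EReal.toReal_coe, ← EReal.coe_sub]
  rfl

lemma Regular.coupling_sub_le_max (hp : p.Regular L μ) (hμ : 0 < μ)
    (hne : (dom p.h).Nonempty) {x : Primal n} (hx : x ∈ p.domG) (y : Dual m) :
    ((p.f (WithLp.toLp 2 (x, y)) : ℝ) : EReal) - p.h y
      ≤ ((p.coupling x (p.argmaxDual x) - (p.h (p.argmaxDual x)).toReal : ℝ) : EReal) := by
  obtain ⟨ha, hmax⟩ := hp.argmaxDual_spec hμ hne hx
  by_cases hy : y ∈ dom p.h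
  · rw [hp.coe_coupling_sub hy, EReal.coe_le_coe_iff]
    have h1 := hmax y hy
    have h2 : 0 ≤ μ / 2 * ‖y - p.argmaxDual x‖ ^ 2 := by positivity
    linarith
  · have : p.h y = ⊤ := not_lt_top_iff.1 hy
    rw [this, EReal.sub_top]
    exact bot_le

lemma Regular.coe_Phi (hp : p.Regular L μ) (hμ : 0 < μ) (hne : (dom p.h).Nonempty)
    {x : Primal n} (hx : x ∈ p.domG) : p.Phi x
      = ((p.coupling x (p.argmaxDual x) - (p.h (p.argmaxDual x)).toReal : ℝ) : EReal) := by
  refine le_antisymm (iSup_le fun y => hp.coupling_sub_le_max hμ hne hx y) ?_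
  rw [← hp.coe_coupling_sub (hp.argmaxDual_spec hμ hne hx).1]
  exact le_iSup (fun y : Dual m => ((p.f (WithLp.toLp 2 (x, y)) : ℝ) : EReal) - p.h y) _

lemma Regular.coe_F (hp : p.Regular L μ) (hμ : 0 < μ) (hne : (dom p.h).Nonempty)
    {x : Primal n} (hx : x ∈ p.domG) : p.F x = ((∑ i, (p.g i (x i)).toReal
      + (p.coupling x (p.argmaxDual x) - (p.h (p.argmaxDual x)).toReal) : ℝ) : EReal) := by
  rw [F, hp.coe_gSum hx, hp.coe_Phi hμ hne hx, ← EReal.coe_add]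

lemma Regular.toReal_F (hp : p.Regular L μ) (hμ : 0 < μ) (hne : (dom p.h).Nonempty)
    {x : Primal n} (hx : x ∈ p.domG) : (p.F x).toReal = ∑ i, (p.g i (x i)).toReal
      + (p.coupling x (p.argmaxDual x) - (p.h (p.argmaxDual x)).toReal) := by
  rw [hp.coe_F hμ hne hx, EReal.toReal_coe]

/-- The real lower bound from which integrability of F along the iterates is obtained. -/
lemma Regular.exists_le_F (hp : p.Regular L μ) (hμ : 0 < μ) (hne : (dom p.h).Nonempty) :
    ∃ b : ℝ, ∀ x ∈ p.domG, b ≤ (p.F x).toReal := by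
  obtain ⟨b, -, hb⟩ := EReal.lt_iff_exists_real_btwn.1 hp.bddBelow
  refine ⟨b, fun x hx => ?_⟩
  rw [← EReal.coe_le_coe_iff, hp.toReal_F hμ hne hx, ← hp.coe_F hμ hne hx]
  exact hb.le.trans (iInf_le _ x)

lemma Regular.coe_lagrangian (hp : p.Regular L μ) {x : Primal n} {y : Dual m} (hx : x ∈ p.domG)
    (hy : y ∈ dom p.h) : p.lagrangian x y
      = ((∑ i, (p.g i (x i)).toReal + (p.coupling x y - (p.h y).toReal) : ℝ) : EReal) := by
  rw [lagrangian, sub_eq_add_neg, add_assoc, ← sub_eq_add_neg, hp.coe_coupling_sub hy,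
    hp.coe_gSum hx, ← EReal.coe_add]

lemma Regular.iSup_lagrangian (hp : p.Regular L μ) (hμ : 0 < μ) (hne : (dom p.h).Nonempty)
    {x : Primal n} (hx : x ∈ p.domG) : ⨆ y, p.lagrangian x y = p.F x := by
  refine le_antisymm (iSup_le fun y => ?_) ?_
  · rw [lagrangian, sub_eq_add_neg, add_assoc, ← sub_eq_add_neg, F]
    gcongr
    exact le_iSup (fun y : Dual m => ((p.f (WithLp.toLp 2 (x, y)) : ℝ) : EReal) - p.h y) y
  · rw [hp.coe_F hμ hne hx, ← hp.coe_lagrangian hx (hp.argmaxDual_spec hμ hne hx).1]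
    exact le_iSup (fun y => p.lagrangian x y) _

/-- Converts the assumed initial duality gap into a bound on the initial distance to the maximizer.
-/
lemma Regular.half_norm_sub_argmaxDual_sq_le (hp : p.Regular L μ) (hμ : 0 < μ)
    {x : Primal n} {y : Dual m} (hx : x ∈ p.domG) (hy : y ∈ dom p.h) :
    μ / 2 * ‖y - p.argmaxDual x‖ ^ 2
      ≤ (⨆ y, p.lagrangian x y).toReal - (p.lagrangian x y).toReal := by
  have hne : (dom p.h).Nonempty := ⟨y, hy⟩
  rw [hp.iSup_lagrangian hμ hne hx, hp.toReal_F hμ hne hx, hp.coe_lagrangian hx hy,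
    EReal.toReal_coe]
  have := (hp.argmaxDual_spec hμ hne hx).2 y hy
  linarith

end Problem

/-! ### Pathwise estimates for one proximal step. -/

section Update

variable {N : ℕ} {n : Fin N → ℕ}

/-- The vector `x` with its block `i` replaced by `u`. -/
def replaceBlock (x : Primal n) (i : Fin N) (u : EuclideanSpace ℝ (Fin (n i))) : Primal n :=
  WithLp.toLp 2 (Function.update (fun l => x l) i u)

lemma replaceBlock_self (x : Primal n) (i : Fin N) (u : EuclideanSpace ℝ (Fin (n i))) :
    replaceBlock x i u i = u := by
  simp [replaceBlock]

lemma replaceBlock_of_ne (x : Primal n) {i l : Fin N} (hl : l ≠ i)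
    (u : EuclideanSpace ℝ (Fin (n i))) : replaceBlock x i u l = x l := by
  simp [replaceBlock, hl]

lemma inner_replaceBlock_sub (v x : Primal n) (i : Fin N) (u : EuclideanSpace ℝ (Fin (n i))) :
    inner ℝ v (replaceBlock x i u - x) = inner ℝ (v i) (u - x i) := by
  rw [PiLp.inner_apply, Finset.sum_eq_single i]
  · rw [PiLp.sub_apply, replaceBlock_self]
  · intro l _ hl
    rw [PiLp.sub_apply, replaceBlock_of_ne x hl, sub_self, inner_zero_right]
  · simp

lemma norm_replaceBlock_sub (x : Primal n) (i : Fin N) (u : EuclideanSpace ℝ (Fin (n i))) :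
    ‖replaceBlock x i u - x‖ = ‖u - x i‖ := by
  rw [← sq_eq_sq₀ (norm_nonneg _) (norm_nonneg _), ← real_inner_self_eq_norm_sq,
    inner_replaceBlock_sub, PiLp.sub_apply, replaceBlock_self, real_inner_self_eq_norm_sq]

end Update

/-- The weight 1/(4η) is chosen so that two applications cost ‖d‖²/(2η), half of what a prox step
provides. -/
lemma inner_le_mul_sq_add_sq_div {E : Type*} [NormedAddCommGroup E] [InnerProductSpace ℝ E]
    {η : ℝ} (hη : 0 < η) (v d : E) :
    inner ℝ v d ≤ η * ‖v‖ ^ 2 + ‖d‖ ^ 2 / (4 * η) := by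
  have h1 := real_inner_le_norm v d
  have h2 : η * ‖v‖ ^ 2 + ‖d‖ ^ 2 / (4 * η) - ‖v‖ * ‖d‖
      = (2 * η * ‖v‖ - ‖d‖) ^ 2 / (4 * η) := by field_simp; ring
  have h3 : 0 ≤ (2 * η * ‖v‖ - ‖d‖) ^ 2 / (4 * η) := by positivity
  linarith

namespace Problem

variable {N : ℕ} {n : Fin N → ℕ} {m : ℕ} {p : Problem n m} {L μ : ℝ}

lemma Regular.replaceBlock_prox_mem (hp : p.Regular L μ) {η : ℝ} (hη : 0 < η) {x : Primal n}
    (hx : x ∈ p.domG) (i : Fin N) (v : EuclideanSpace ℝ (Fin (n i))) :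
    replaceBlock x i (prox (fun u => (η : EReal) * p.g i u) v) ∈ p.domG := by
  intro l
  by_cases hl : l = i
  · subst hl
    rw [replaceBlock_self]
    exact ((hp.closedConvex_g l).prox_spec ⟨_, hx l⟩ hη v).1
  · rw [replaceBlock_of_ne x hl]
    exact hx l

/-- One-sided envelope theorem. Expanding f in x at the new maximizer replaces the slope at y*(x) by
the one at y*(x'), an error of L r ‖x' − x‖ with r = ‖y*(x') − y*(x)‖; the growth term −(μ/2) r²
absorbs it at the price L²/(2μ)‖x' − x‖². -/
lemma Regular.coupling_max_sub_le (hp : p.Regular L μ) (hμ : 0 < μ)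
    (hne : (dom p.h).Nonempty) {x x' : Primal n} (hx : x ∈ p.domG) (hx' : x' ∈ p.domG) :
    p.coupling x' (p.argmaxDual x') - (p.h (p.argmaxDual x')).toReal
      ≤ p.coupling x (p.argmaxDual x) - (p.h (p.argmaxDual x)).toReal
        + inner ℝ (p.gradX x (p.argmaxDual x)) (x' - x)
        + (L / 2 + L ^ 2 / (2 * μ)) * ‖x' - x‖ ^ 2 := by
  obtain ⟨ha, hmax⟩ := hp.argmaxDual_spec hμ hne hx
  have ha' := (hp.argmaxDual_spec hμ hne hx').1
  have h1 := hmax _ ha'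
  have h2 := (abs_le.1 (hp.abs_coupling_sub_fst_le hx hx' ha')).2
  have h3 : inner ℝ (p.gradX x (p.argmaxDual x')) (x' - x)
      - inner ℝ (p.gradX x (p.argmaxDual x)) (x' - x)
      ≤ L * ‖p.argmaxDual x' - p.argmaxDual x‖ * ‖x' - x‖ := by
    rw [← inner_sub_left]
    refine (real_inner_le_norm _ _).trans ?_
    gcongr
    exact hp.norm_gradX_sub_le hx ha' ha
  set r := ‖p.argmaxDual x' - p.argmaxDual x‖
  have h4 : L ^ 2 / (2 * μ) * ‖x' - x‖ ^ 2 - L * r * ‖x' - x‖ + μ / 2 * r ^ 2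
      = (L * ‖x' - x‖ - μ * r) ^ 2 / (2 * μ) := by field_simp; ring
  have h5 : 0 ≤ (L * ‖x' - x‖ - μ * r) ^ 2 / (2 * μ) := by positivity
  linarith

/-- The effect of a proximal gradient step in one primal block on the primal objective. -/
lemma Regular.F_replaceBlock_prox_le (hp : p.Regular L μ) (hμ : 0 < μ) {η : ℝ} (hη : 0 < η)
    {x : Primal n} {y : Dual m} (hx : x ∈ p.domG) (hy : y ∈ dom p.h) (i : Fin N)
    (v u : EuclideanSpace ℝ (Fin (n i)))
    (hu : u = prox (fun w => (η : EReal) * p.g i w) (x i - η • v)) :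
    (p.F (replaceBlock x i u)).toReal
        + (1 / 2 - L * η / 2 - L ^ 2 * η / (2 * μ)) * (η * ‖η⁻¹ • (x i - u)‖ ^ 2)
      ≤ (p.F x).toReal + η * (‖v - p.gradX x y i‖ ^ 2
        + ‖p.gradX x (p.argmaxDual x) i - p.gradX x y i‖ ^ 2) := by
  have hne : (dom p.h).Nonempty := ⟨y, hy⟩
  have hx' : replaceBlock x i u ∈ p.domG := hu ▸ hp.replaceBlock_prox_mem hη hx i _
  have hprox := ((hp.closedConvex_g i).prox_spec ⟨_, hx i⟩ hη (x i - η • v)).2 _ (hx i)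
  rw [← hu] at hprox
  have hmax := hp.coupling_max_sub_le hμ hne hx hx'
  rw [inner_replaceBlock_sub, norm_replaceBlock_sub] at hmax
  rw [hp.toReal_F hμ hne hx, hp.toReal_F hμ hne hx']
  have hsum : ∑ l, (p.g l (replaceBlock x i u l)).toReal
      = ∑ l, (p.g l (x l)).toReal + ((p.g i u).toReal - (p.g i (x i)).toReal) := by
    rw [← sub_eq_iff_eq_add', ← Finset.sum_sub_distrib, Finset.sum_eq_single i]
    · rw [replaceBlock_self]
    · intro l _ hl
      rw [replaceBlock_of_ne x hl, sub_self]
    · simp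
  have e1 : u - (x i - η • v) = (u - x i) + η • v := by abel
  have e2 : x i - (x i - η • v) = η • v := by abel
  rw [e1, e2, norm_add_sq_real, real_inner_smul_right, norm_sub_rev (x i) u] at hprox
  have hG : ‖η⁻¹ • (x i - u)‖ ^ 2 = ‖u - x i‖ ^ 2 / η ^ 2 := by
    rw [norm_smul, mul_pow, norm_sub_rev, norm_inv, inv_pow, Real.norm_eq_abs, sq_abs]
    field_simp
  have hy1 := inner_le_mul_sq_add_sq_div hη (p.gradX x y i - v) (u - x i)
  have hy2 := inner_le_mul_sq_add_sq_div hη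
    (p.gradX x (p.argmaxDual x) i - p.gradX x y i) (u - x i)
  rw [inner_sub_left] at hy1 hy2
  rw [norm_sub_rev] at hy1
  rw [hsum, hG]
  rw [real_inner_comm] at hprox
  -- The full ‖u − x i‖²/η, not half of it: one half comes from the prox objective, the other from
  -- its growth at the minimizer.
  have hg : (p.g i u).toReal + inner ℝ v (u - x i) + ‖u - x i‖ ^ 2 / η
      ≤ (p.g i (x i)).toReal := by
    refine le_of_mul_le_mul_left ?_ hη
    have : η * (‖u - x i‖ ^ 2 / η) = ‖u - x i‖ ^ 2 := by field_simp
    rw [mul_add, mul_add, this]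
    linarith
  have e3 : (1 / 2 - L * η / 2 - L ^ 2 * η / (2 * μ)) * (η * (‖u - x i‖ ^ 2 / η ^ 2))
      = ‖u - x i‖ ^ 2 / η - 2 * (‖u - x i‖ ^ 2 / (4 * η))
        - (L / 2 + L ^ 2 / (2 * μ)) * ‖u - x i‖ ^ 2 := by field_simp; ring
  rw [e3]
  linarith

/-- The contraction towards the dual maximizer of an inexact proximal gradient step. -/
lemma Regular.norm_prox_sub_argmaxDual_sq_le (hp : p.Regular L μ) (hμ : 0 < μ) {η : ℝ}
    (hη : 0 < η) (hηL : η * L ≤ 1) {x : Primal n} {y : Dual m} (hx : x ∈ p.domG)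
    (hy : y ∈ dom p.h) (v y' : Dual m)
    (hy' : y' = prox (fun u => (η : EReal) * p.h u) (y + η • v)) :
    (1 + η * μ) * ‖y' - p.argmaxDual x‖ ^ 2 ≤ (1 - η * μ) * ‖y - p.argmaxDual x‖ ^ 2
      + 2 * η * inner ℝ (v - p.gradY x y) (y' - p.argmaxDual x) := by
  have hne : (dom p.h).Nonempty := ⟨y, hy⟩
  obtain ⟨ha, hmax⟩ := hp.argmaxDual_spec hμ hne hx
  obtain ⟨hyd, hprox⟩ := hp.closedConvex_h.prox_spec hne hη (y + η • v)
  rw [← hy'] at hyd hprox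
  -- The growth inequalities of the prox at a and of the maximizer at y' supply (1 + ημ)/2 times ‖y'
  -- − a‖²; strong concavity at y supplies −(ημ/2)‖y − a‖²; the descent lemma costs (ηL/2)‖y' − y‖²,
  -- covered by the prox term because ηL ≤ 1.
  have h1 := hprox _ ha
  have h2 := hmax _ hyd
  have h3 := (abs_le.1 (hp.abs_coupling_sub_snd_le hx hy hyd)).1
  have h4 := hp.coupling_le hx hy ha
  set a := p.argmaxDual x
  have e1 : y' - (y + η • v) = (y' - y) - η • v := by abel
  have e2 : a - (y + η • v) = (a - y) - η • v := by abel
  rw [e1, e2, norm_sub_sq_real (y' - y), norm_sub_sq_real (a - y), real_inner_smul_right,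
    real_inner_smul_right, real_inner_comm, real_inner_comm v, norm_sub_rev a y'] at h1
  rw [norm_sub_rev a y] at h1 h4
  have e3 : y' - a = (y' - y) - (a - y) := by abel
  have e4 : inner ℝ (v - p.gradY x y) (y' - a) = inner ℝ v (y' - y) - inner ℝ v (a - y)
      - (inner ℝ (p.gradY x y) (y' - y) - inner ℝ (p.gradY x y) (a - y)) := by
    rw [e3, inner_sub_right, inner_sub_left, inner_sub_left]
    ring
  rw [e4]
  have h5 : η * (L / 2 * ‖y' - y‖ ^ 2) ≤ ‖y' - y‖ ^ 2 / 2 := by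
    nlinarith [sq_nonneg ‖y' - y‖]
  have h6 : η * (p.coupling x y + inner ℝ (p.gradY x y) (y' - y) - L / 2 * ‖y' - y‖ ^ 2
      - (p.h y').toReal + μ / 2 * ‖y' - a‖ ^ 2)
      ≤ η * (p.coupling x y + inner ℝ (p.gradY x y) (a - y) - μ / 2 * ‖y - a‖ ^ 2
        - (p.h a).toReal) := by
    refine mul_le_mul_of_nonneg_left ?_ hη.le
    linarith
  linarith

lemma Regular.norm_prox_gradY_sub_argmaxDual_le (hp : p.Regular L μ) (hμ : 0 < μ) {η : ℝ}
    (hη : 0 < η) (hηL : η * L ≤ 1) {x : Primal n} {y : Dual m} (hx : x ∈ p.domG)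
    (hy : y ∈ dom p.h) :
    ‖prox (fun u => (η : EReal) * p.h u) (y + η • p.gradY x y) - p.argmaxDual x‖
      ≤ ‖y - p.argmaxDual x‖ := by
  have h := hp.norm_prox_sub_argmaxDual_sq_le hμ hη hηL hx hy (p.gradY x y) _ rfl
  rw [sub_self, inner_zero_left, mul_zero, add_zero] at h
  refine abs_le_of_sq_le_sq' ?_ (norm_nonneg _) |>.2
  have : 0 < η * μ := by positivity
  nlinarith [sq_nonneg ‖prox (fun u => (η : EReal) * p.h u) (y + η • p.gradY x y)
    - p.argmaxDual x‖, sq_nonneg ‖y - p.argmaxDual x‖]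

lemma Regular.norm_prox_sub_prox_gradY_le (hp : p.Regular L μ) {η : ℝ}
    (hη : 0 < η) {x : Primal n} {y : Dual m} (hy : y ∈ dom p.h) (v : Dual m) :
    ‖prox (fun u => (η : EReal) * p.h u) (y + η • v)
      - prox (fun u => (η : EReal) * p.h u) (y + η • p.gradY x y)‖ ≤ η * ‖v - p.gradY x y‖ := by
  refine (hp.closedConvex_h.norm_prox_sub_prox_le ⟨y, hy⟩ hη _ _).trans_eq ?_
  rw [add_sub_add_left_eq_sub, ← smul_sub, norm_smul, Real.norm_of_nonneg hη.le]

/-- The point y' is correlated with the oracle error ε, so ⟨ε, y' − a⟩ need not have mean zero.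
Replacing y' by the noise-free step w makes it so, and nonexpansiveness of the prox bounds the
correction ⟨ε, y' − w⟩ by η‖ε‖². -/
lemma Regular.norm_prox_sub_argmaxDual_sq_le' (hp : p.Regular L μ) (hμ : 0 < μ) {η : ℝ}
    (hη : 0 < η) (hηL : η * L ≤ 1) (hq : η * μ ≤ 1) {x : Primal n} {y : Dual m}
    (hx : x ∈ p.domG) (hy : y ∈ dom p.h) (v y' : Dual m)
    (hy' : y' = prox (fun u => (η : EReal) * p.h u) (y + η • v)) :
    ‖y' - p.argmaxDual x‖ ^ 2 ≤ (1 - η * μ) * ‖y - p.argmaxDual x‖ ^ 2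
      + (2 * η / (1 + η * μ) * inner ℝ (v - p.gradY x y)
          (prox (fun u => (η : EReal) * p.h u) (y + η • p.gradY x y) - p.argmaxDual x)
        + 2 * η ^ 2 * ‖v - p.gradY x y‖ ^ 2) := by
  have h1 := hp.norm_prox_sub_argmaxDual_sq_le hμ hη hηL hx hy v y' hy'
  have h2 := hp.norm_prox_sub_prox_gradY_le hη (x := x) hy v
  rw [← hy'] at h2
  set w := prox (fun u => (η : EReal) * p.h u) (y + η • p.gradY x y)
  set a := p.argmaxDual x
  set ε := v - p.gradY x y
  have e : y' - a = (w - a) + (y' - w) := by abel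
  have h3 : inner ℝ ε (y' - a) ≤ inner ℝ ε (w - a) + η * ‖ε‖ ^ 2 := by
    rw [e, inner_add_right]
    have h4 := real_inner_le_norm ε (y' - w)
    have h5 := mul_le_mul_of_nonneg_left h2 (norm_nonneg ε)
    nlinarith
  have hq0 : 0 < η * μ := by positivity
  refine le_of_mul_le_mul_left ?_ (show 0 < 1 + η * μ by linarith)
  have e2 : (1 + η * μ) * ((1 - η * μ) * ‖y - a‖ ^ 2
      + (2 * η / (1 + η * μ) * inner ℝ ε (w - a) + 2 * η ^ 2 * ‖ε‖ ^ 2))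
      = (1 + η * μ) * ((1 - η * μ) * ‖y - a‖ ^ 2) + 2 * η * inner ℝ ε (w - a)
        + (1 + η * μ) * (2 * η ^ 2 * ‖ε‖ ^ 2) := by field_simp; ring
  rw [e2]
  have h6 : 0 ≤ (1 - η * μ) * ‖y - a‖ ^ 2 := mul_nonneg (by linarith) (sq_nonneg _)
  have h7 : 0 ≤ 2 * η ^ 2 * ‖ε‖ ^ 2 := by positivity
  have h8 := mul_le_mul_of_nonneg_left h3 (show 0 ≤ 2 * η by positivity)
  nlinarith

/-- Pass through the noise-free step, which is no farther from the maximizer than y: ‖y' − y‖ is at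
most η‖ε‖ plus twice the distance of y to the maximizer, and 8 = 2·2². -/
lemma Regular.norm_prox_sub_self_sq_le (hp : p.Regular L μ) (hμ : 0 < μ) {η : ℝ}
    (hη : 0 < η) (hηL : η * L ≤ 1) {x : Primal n} {y : Dual m} (hx : x ∈ p.domG)
    (hy : y ∈ dom p.h) (v : Dual m) :
    ‖η⁻¹ • (prox (fun u => (η : EReal) * p.h u) (y + η • v) - y)‖ ^ 2
      ≤ 8 / η ^ 2 * ‖y - p.argmaxDual x‖ ^ 2 + 2 * ‖v - p.gradY x y‖ ^ 2 := by
  have h1 := hp.norm_prox_sub_prox_gradY_le hη (x := x) hy v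
  have h2 := hp.norm_prox_gradY_sub_argmaxDual_le hμ hη hηL hx hy
  set y' := prox (fun u => (η : EReal) * p.h u) (y + η • v)
  set w := prox (fun u => (η : EReal) * p.h u) (y + η • p.gradY x y)
  have h3 : ‖y' - y‖ ≤ η * ‖v - p.gradY x y‖ + 2 * ‖y - p.argmaxDual x‖ := by
    have e : y' - y = (y' - w) + (w - p.argmaxDual x) - (y - p.argmaxDual x) := by abel
    rw [e]
    refine (norm_sub_le _ _).trans ?_
    have := norm_add_le (y' - w) (w - p.argmaxDual x)
    linarith
  have h4 : ‖y' - y‖ ^ 2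
      ≤ 2 * (η * ‖v - p.gradY x y‖) ^ 2 + 2 * (2 * ‖y - p.argmaxDual x‖) ^ 2 := by
    nlinarith [norm_nonneg (y' - y), sq_nonneg (η * ‖v - p.gradY x y‖
      - 2 * ‖y - p.argmaxDual x‖)]
  rw [norm_smul, mul_pow, norm_inv, inv_pow, Real.norm_eq_abs, sq_abs, inv_mul_le_iff₀
    (by positivity)]
  refine h4.trans_eq ?_
  field_simp
  ring

end Problem

/-! ### Independence, uniform indices and batch averages. -/

section Probability

variable {Ω : Type*} [MeasurableSpace Ω] {P : Measure Ω}

lemma integrable_inner_of_integrable_sq {E : Type*} [NormedAddCommGroup E]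
    [InnerProductSpace ℝ E] {f g : Ω → E} (hf : AEStronglyMeasurable f P)
    (hg : AEStronglyMeasurable g P) (hf2 : Integrable (fun a => ‖f a‖ ^ 2) P)
    (hg2 : Integrable (fun a => ‖g a‖ ^ 2) P) : Integrable (fun a => inner ℝ (f a) (g a)) P := by
  refine (hf2.add hg2).mono' (hf.inner hg) (Filter.Eventually.of_forall fun a => ?_)
  refine (norm_inner_le_norm _ _).trans ?_
  simp only [Pi.add_apply]
  nlinarith [sq_nonneg (‖f a‖ - ‖g a‖), sq_nonneg ‖f a‖, sq_nonneg ‖g a‖]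

lemma integrable_and_integral_le_of_lintegral_le {f : Ω → ℝ} (hf : AEStronglyMeasurable f P)
    (hf0 : ∀ a, 0 ≤ f a) {V : ℝ} (hV : 0 ≤ V)
    (h : ∫⁻ a, ENNReal.ofReal (f a) ∂P ≤ ENNReal.ofReal V) :
    Integrable f P ∧ ∫ a, f a ∂P ≤ V := by
  refine ⟨⟨hf, (hasFiniteIntegral_iff_ofReal (Filter.Eventually.of_forall hf0)).2
    (h.trans_lt ENNReal.ofReal_lt_top)⟩, ?_⟩
  rw [integral_eq_lintegral_of_nonneg_ae (Filter.Eventually.of_forall hf0) hf]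
  exact ENNReal.toReal_le_of_le_ofReal hV h

/-- Under the hypotheses the three variables have a product law, so they may be regrouped by
Tonelli. This isolates the block index from (iterate, batch), and in the Gauss-Seidel scheme the
dual batch from (iterate, index, primal batch). -/
lemma indepFun_prodMk_of_indepFun_prodMk [IsProbabilityMeasure P] {S T U : Type*}
    [MeasurableSpace S] [MeasurableSpace T] [MeasurableSpace U] {s : Ω → S} {t : Ω → T} {u : Ω → U}
    (hs : Measurable s) (ht : Measurable t) (hu : Measurable u)
    (hstu : IndepFun s (fun a => (t a, u a)) P) (htu : IndepFun t u P) :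
    IndepFun t (fun a => (s a, u a)) P := by
  have hsu : IndepFun s u P := hstu.comp measurable_id measurable_snd
  rw [indepFun_iff_map_prod_eq_prod_map_map ht.aemeasurable (hs.prodMk hu).aemeasurable]
  rw [indepFun_iff_map_prod_eq_prod_map_map hs.aemeasurable (ht.prodMk hu).aemeasurable] at hstu
  rw [indepFun_iff_map_prod_eq_prod_map_map ht.aemeasurable hu.aemeasurable] at htu
  rw [indepFun_iff_map_prod_eq_prod_map_map hs.aemeasurable hu.aemeasurable] at hsu
  have := Measure.isProbabilityMeasure_map (μ := P) hs.aemeasurable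
  have := Measure.isProbabilityMeasure_map (μ := P) ht.aemeasurable
  have := Measure.isProbabilityMeasure_map (μ := P) hu.aemeasurable
  refine Measure.ext_of_lintegral _ fun f hf => ?_
  have h1 : ∫⁻ z, f z ∂(P.map fun a => (t a, (s a, u a)))
      = ∫⁻ z, f (z.2.1, (z.1, z.2.2)) ∂(P.map fun a => (s a, (t a, u a))) := by
    rw [lintegral_map hf (by fun_prop), lintegral_map (by fun_prop) (by fun_prop)]
  rw [h1, hstu, htu, hsu, lintegral_prod _ (by fun_prop), lintegral_prod _ (by fun_prop)]
  have h2 : ∀ x, ∫⁻ y, f (y.1, (x, y.2)) ∂((P.map t).prod (P.map u))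
      = ∫⁻ b, ∫⁻ c, f (b, (x, c)) ∂(P.map u) ∂(P.map t) := fun x =>
    lintegral_prod _ (by fun_prop)
  have h3 : ∀ b, ∫⁻ y, f (b, y) ∂((P.map s).prod (P.map u))
      = ∫⁻ x, ∫⁻ c, f (b, (x, c)) ∂(P.map u) ∂(P.map s) := fun b =>
    lintegral_prod _ (by fun_prop)
  simp only [h2, h3]
  refine lintegral_lintegral_swap (Measurable.aemeasurable ?_)
  exact Measurable.lintegral_prod_right' (f := fun q : (S × T) × U => f (q.1.2, (q.1.1, q.2)))
    (by fun_prop)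

lemma IsUniformIndex.lintegral_eq {N : ℕ} {T : Type*} [MeasurableSpace T] {i : Ω → Fin N}
    (hi : IsUniformIndex P i) {t : Ω → T} (ht : Measurable t) (hit : IndepFun i t P)
    {H : Fin N → T → ENNReal} (hH : ∀ l, Measurable (H l)) :
    ∫⁻ a, H (i a) (t a) ∂P = (N : ENNReal)⁻¹ * ∑ l, ∫⁻ a, H l (t a) ∂P := by
  have h1 : ∀ a, H (i a) (t a)
      = ∑ l, ((fun a => ({l} : Set (Fin N)).indicator (fun _ => (1 : ENNReal)) (i a))
        * fun a => H l (t a)) a := by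
    intro a
    rw [Finset.sum_eq_single (i a)]
    · simp
    · intro l _ hl
      simp [Set.indicator, hl.symm]
    · simp
  have hind : ∀ l, Measurable
      fun a => ({l} : Set (Fin N)).indicator (fun _ => (1 : ENNReal)) (i a) := fun l =>
    (measurable_const.indicator (measurableSet_singleton l)).comp hi.1
  have hHt : ∀ l, Measurable fun a => H l (t a) := fun l => (hH l).comp ht
  simp_rw [h1]
  rw [lintegral_finsetSum _ (fun l _ => (hind l).mul (hHt l)), Finset.mul_sum]
  refine Finset.sum_congr rfl fun l _ => ?_
  rw [lintegral_mul_eq_lintegral_mul_lintegral_of_indepFun (hind l) (hHt l)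
    (hit.comp (measurable_const.indicator (measurableSet_singleton l)) (hH l))]
  congr 1
  rw [← hi.2 l, ← lintegral_indicator_one (hi.1 (measurableSet_singleton l))]
  rfl

lemma measurable_apply_fin {N : ℕ} {T F : Type*} [MeasurableSpace T] [MeasurableSpace F]
    {i : Ω → Fin N} (hi : Measurable i) {t : Ω → T} (ht : Measurable t) {H : Fin N → T → F}
    (hH : ∀ l, Measurable (H l)) : Measurable fun a => H (i a) (t a) :=
  (measurable_from_prod_countable_right (f := fun q : Fin N × T => H q.1 q.2) hH).comp
    (hi.prodMk ht)

/-- Averaging a nonnegative integrand over an independent uniform index. -/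
lemma IsUniformIndex.integrable_iff {N : ℕ} (hN : 1 ≤ N) {T : Type*} [MeasurableSpace T]
    {i : Ω → Fin N} (hi : IsUniformIndex P i) {t : Ω → T} (ht : Measurable t)
    (hit : IndepFun i t P) {H : Fin N → T → ℝ} (hH : ∀ l, Measurable (H l))
    (hH0 : ∀ l s, 0 ≤ H l s) :
    (Integrable (fun a => H (i a) (t a)) P ↔ ∀ l, Integrable (fun a => H l (t a)) P) ∧
      (Integrable (fun a => H (i a) (t a)) P →
        ∫ a, H (i a) (t a) ∂P = (N : ℝ)⁻¹ * ∑ l, ∫ a, H l (t a) ∂P) := by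
  have h := hi.lintegral_eq ht hit (H := fun l s => ENNReal.ofReal (H l s))
    fun l => (hH l).ennreal_ofReal
  have hmeas : Measurable fun a => H (i a) (t a) :=
    measurable_apply_fin hi.1 ht hH
  have hN0 : (N : ENNReal) ≠ 0 := by exact_mod_cast (by omega : N ≠ 0)
  have hint : ∀ l, Integrable (fun a => H l (t a)) P
      ↔ ∫⁻ a, ENNReal.ofReal (H l (t a)) ∂P < ⊤ := fun l => by
    rw [← hasFiniteIntegral_iff_ofReal (Filter.Eventually.of_forall fun a => hH0 l (t a))]
    exact ⟨fun h => h.2, fun h => ⟨((hH l).comp ht).aestronglyMeasurable, h⟩⟩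
  have hint' : Integrable (fun a => H (i a) (t a)) P
      ↔ ∫⁻ a, ENNReal.ofReal (H (i a) (t a)) ∂P < ⊤ := by
    rw [← hasFiniteIntegral_iff_ofReal (Filter.Eventually.of_forall fun a => hH0 (i a) (t a))]
    exact ⟨fun h => h.2, fun h => ⟨hmeas.aestronglyMeasurable, h⟩⟩
  -- Both directions are used: from all blocks to the random one for the errors, and back for the
  -- gradient map, whose integrability is first seen at the random block.
  have hiff : Integrable (fun a => H (i a) (t a)) P
      ↔ ∀ l, Integrable (fun a => H l (t a)) P := by
    rw [hint', h]
    simp only [hint]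
    constructor
    · intro hlt l
      have h2 : ∑ l, ∫⁻ a, ENNReal.ofReal (H l (t a)) ∂P ≠ ⊤ := fun htop => by
        rw [htop, ENNReal.mul_top (by simp)] at hlt
        exact lt_irrefl _ hlt
      exact (ENNReal.sum_lt_top.1 h2.lt_top) l (Finset.mem_univ l)
    · intro hl
      exact ENNReal.mul_lt_top (by simpa using (pos_iff_ne_zero.2 hN0))
        (ENNReal.sum_lt_top.2 fun l _ => hl l)
  refine ⟨hiff, fun hI => ?_⟩
  have hl := hiff.1 hI
  rw [integral_eq_lintegral_of_nonneg_ae (Filter.Eventually.of_forall fun a => hH0 _ _)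
    hmeas.aestronglyMeasurable, h, ENNReal.toReal_mul, ENNReal.toReal_inv, ENNReal.toReal_natCast,
    ENNReal.toReal_sum fun l _ => ((hint l).1 (hl l)).ne]
  congr 1
  refine Finset.sum_congr rfl fun l _ => ?_
  rw [integral_eq_lintegral_of_nonneg_ae (Filter.Eventually.of_forall fun a => hH0 _ _)
    ((hH l).comp ht).aestronglyMeasurable]

variable {W E : Type*} [MeasurableSpace W] [NormedAddCommGroup E] [InnerProductSpace ℝ E]
  [MeasurableSpace E] [BorelSpace E] [FiniteDimensional ℝ E]

lemma IsBatch.measurable {Q : Measure W} {M : ℕ} {w : Ω → Fin M → W} (hw : IsBatch P Q w) :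
    Measurable w := measurable_pi_lambda _ hw.1

lemma IsBatch.map_eq [IsProbabilityMeasure P] {Q : Measure W} {M : ℕ} {w : Ω → Fin M → W}
    (hw : IsBatch P Q w) : P.map w = Measure.pi fun _ => Q := by
  have := (iIndepFun_iff_map_fun_eq_pi_map fun j => (hw.1 j).aemeasurable).1 hw.2.2
  rw [show (fun ω j => w ω j) = w from rfl] at this
  rw [this]
  congr 1
  ext1 j
  exact hw.2.1 j

/-- The canonical model of a batch, so that `IsBatch.average` can be applied under the integral with
the iterate frozen. -/
lemma isBatch_pi (Q : Measure W) [IsProbabilityMeasure Q] (M : ℕ) :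
    IsBatch (Measure.pi fun _ : Fin M => Q) Q fun w => w :=
  ⟨fun j => measurable_pi_apply j, fun j => (measurePreserving_eval (fun _ : Fin M => Q) j).map_eq,
    iIndepFun_pi (X := fun (_ : Fin M) (w : W) => w) fun _ => aemeasurable_id⟩

/-- Mean and variance of the average of `M` i.i.d. samples. -/
lemma IsBatch.average [IsProbabilityMeasure P] {Q : Measure W} [IsProbabilityMeasure Q] {M : ℕ}
    (hM : 1 ≤ M) {w : Ω → Fin M → W} (hw : IsBatch P Q w) {f : W → E} (hf : Measurable f)
    (hfi : Integrable f Q) (hf2 : Integrable (fun u => ‖f u - ∫ v, f v ∂Q‖ ^ 2) Q) {V : ℝ}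
    (hV : ∫ u, ‖f u - ∫ v, f v ∂Q‖ ^ 2 ∂Q ≤ V) :
    Integrable (fun a => (M : ℝ)⁻¹ • ∑ j, f (w a j) - ∫ v, f v ∂Q) P ∧
      ∫ a, ((M : ℝ)⁻¹ • ∑ j, f (w a j) - ∫ v, f v ∂Q) ∂P = 0 ∧
      Integrable (fun a => ‖(M : ℝ)⁻¹ • ∑ j, f (w a j) - ∫ v, f v ∂Q‖ ^ 2) P ∧
      ∫ a, ‖(M : ℝ)⁻¹ • ∑ j, f (w a j) - ∫ v, f v ∂Q‖ ^ 2 ∂P ≤ V / M := by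
  have hM0 : (M : ℝ) ≠ 0 := by exact_mod_cast (by omega : M ≠ 0)
  set c := ∫ v, f v ∂Q with hc
  set ξ : Fin M → Ω → E := fun j a => f (w a j) - c with hξ
  have hgm : Measurable fun u => f u - c := hf.sub_const c
  have hξm : ∀ j, Measurable (ξ j) := fun j => hgm.comp (hw.1 j)
  have hmp : ∀ j, MeasurePreserving (fun a => w a j) P Q := fun j => ⟨hw.1 j, hw.2.1 j⟩
  have hξi : ∀ j, Integrable (ξ j) P := fun j =>
    (hmp j).integrable_comp_of_integrable (hfi.sub (integrable_const c))
  have hξ0 : ∀ j, ∫ a, ξ j a ∂P = 0 := fun j => by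
    rw [← integral_map (f := fun u => f u - c) (hw.1 j).aemeasurable
      hgm.aestronglyMeasurable, hw.2.1 j, integral_sub hfi (integrable_const c)]
    simp [hc]
  have hξ2 : ∀ j, Integrable (fun a => ‖ξ j a‖ ^ 2) P := fun j =>
    (hmp j).integrable_comp_of_integrable hf2
  have hξV : ∀ j, ∫ a, ‖ξ j a‖ ^ 2 ∂P ≤ V := fun j => by
    rw [← integral_map (f := fun u => ‖f u - c‖ ^ 2) (hw.1 j).aemeasurable
      (hgm.norm.pow_const 2).aestronglyMeasurable, hw.2.1 j]
    exact hV
  have hξindep : iIndepFun ξ P := hw.2.2.comp (fun _ u => f u - c) fun _ => hgm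
  have hcross : ∀ j l, j ≠ l → ∫ a, inner ℝ (ξ j a) (ξ l a) ∂P = 0 := fun j l hjl => by
    have := (hξindep.indepFun hjl).integral_bilin (hξi j) (hξi l) (innerSL ℝ)
    rw [hξ0 l, map_zero] at this
    exact this
  have hinner : ∀ j l, Integrable (fun a => inner ℝ (ξ j a) (ξ l a)) P := fun j l =>
    integrable_inner_of_integrable_sq (hξi j).1 (hξi l).1 (hξ2 j) (hξ2 l)
  have hrw : ∀ a, (M : ℝ)⁻¹ • ∑ j, f (w a j) - c = (M : ℝ)⁻¹ • ∑ j, ξ j a := fun a => by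
    simp only [hξ, Finset.sum_sub_distrib, Finset.sum_const, Finset.card_univ, Fintype.card_fin,
      smul_sub, ← Nat.cast_smul_eq_nsmul ℝ M c, inv_smul_smul₀ hM0]
  have hsq : ∀ a, ‖(M : ℝ)⁻¹ • ∑ j, ξ j a‖ ^ 2
      = ((M : ℝ)⁻¹) ^ 2 * ∑ j, ∑ l, inner ℝ (ξ j a) (ξ l a) := fun a => by
    rw [norm_smul, mul_pow, Real.norm_eq_abs, sq_abs, ← real_inner_self_eq_norm_sq, sum_inner]
    simp_rw [inner_sum]
  simp_rw [hrw]
  refine ⟨(integrable_finsetSum _ fun j _ => hξi j).smul _, ?_, ?_, ?_⟩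
  · rw [integral_smul, integral_finsetSum _ fun j _ => hξi j]
    simp [hξ0]
  · simp_rw [hsq]
    exact (integrable_finsetSum _ fun j _ => integrable_finsetSum _ fun l _ =>
      hinner j l).const_mul _
  · simp_rw [hsq]
    rw [integral_const_mul, integral_finsetSum _ fun j _ => integrable_finsetSum _ fun l _ =>
      hinner j l]
    have h1 : ∀ j, ∫ a, ∑ l, inner ℝ (ξ j a) (ξ l a) ∂P ≤ V := fun j => by
      rw [integral_finsetSum _ fun l _ => hinner j l, Finset.sum_eq_single j
        (fun l _ hl => hcross j l hl.symm) (by simp)]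
      simpa only [real_inner_self_eq_norm_sq] using hξV j
    have h2 : ∑ j : Fin M, ∫ a, ∑ l, inner ℝ (ξ j a) (ξ l a) ∂P ≤ M * V := by
      refine (Finset.sum_le_sum fun j _ => h1 j).trans_eq ?_
      simp
    refine (mul_le_mul_of_nonneg_left h2 (by positivity)).trans_eq ?_
    field_simp

/-- The error of a batch average of oracle calls at a random point that is independent of the
batch: its second moment, and its orthogonality to functions of that point. -/
lemma IsBatch.oracle_error [IsProbabilityMeasure P] {Q : Measure W} [IsProbabilityMeasure Q]
    {M : ℕ} (hM : 1 ≤ M) {w : Ω → Fin M → W} (hw : IsBatch P Q w) {S : Type*} [MeasurableSpace S]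
    {t : Ω → S} (ht : Measurable t) (htw : IndepFun t w P) {o : S → W → E}
    (ho : Measurable fun q : S × W => o q.1 q.2) {D : Set S} (htD : ∀ᵐ a ∂P, t a ∈ D) {V : ℝ}
    (hV0 : 0 ≤ V) (hi : ∀ s ∈ D, Integrable (o s) Q)
    (h2 : ∀ s ∈ D, Integrable (fun u => ‖o s u - ∫ v, o s v ∂Q‖ ^ 2) Q)
    (hV : ∀ s ∈ D, ∫ u, ‖o s u - ∫ v, o s v ∂Q‖ ^ 2 ∂Q ≤ V) :
    Measurable (fun a => (M : ℝ)⁻¹ • ∑ j, o (t a) (w a j) - ∫ v, o (t a) v ∂Q) ∧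
    (Integrable (fun a => ‖(M : ℝ)⁻¹ • ∑ j, o (t a) (w a j) - ∫ v, o (t a) v ∂Q‖ ^ 2) P ∧
      ∫ a, ‖(M : ℝ)⁻¹ • ∑ j, o (t a) (w a j) - ∫ v, o (t a) v ∂Q‖ ^ 2 ∂P ≤ V / M) ∧
    ∀ v : S → E, Measurable v → Integrable (fun a => ‖v (t a)‖ ^ 2) P →
      Integrable (fun a =>
        inner ℝ ((M : ℝ)⁻¹ • ∑ j, o (t a) (w a j) - ∫ v, o (t a) v ∂Q) (v (t a))) P ∧
      ∫ a, inner ℝ ((M : ℝ)⁻¹ • ∑ j, o (t a) (w a j) - ∫ v, o (t a) v ∂Q) (v (t a)) ∂P = 0 := by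
  -- Errors are centred at the oracle mean rather than at the gradient: the mean is measurable in s
  -- everywhere, and it is identified with the gradient only on the domain.
  have hmean : Measurable fun s => ∫ v, o s v ∂Q :=
    (ho.stronglyMeasurable.integral_prod_right (f := fun s v => o s v)).measurable
  set e : S × (Fin M → W) → E :=
    fun q => (M : ℝ)⁻¹ • ∑ j, o q.1 (q.2 j) - ∫ v, o q.1 v ∂Q with he
  have hem : Measurable e := by
    refine Measurable.sub (Measurable.const_smul (Finset.measurable_fun_sum _ fun j _ => ?_) _)
      (hmean.comp measurable_fst)
    exact ho.comp (measurable_fst.prodMk ((measurable_pi_apply j).comp measurable_snd))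
  have htwm : Measurable fun a => (t a, w a) := ht.prodMk hw.measurable
  have hlaw : P.map (fun a => (t a, w a)) = (P.map t).prod (Measure.pi fun _ => Q) := by
    rw [(indepFun_iff_map_prod_eq_prod_map_map ht.aemeasurable
      hw.measurable.aemeasurable).1 htw, hw.map_eq]
  have := Measure.isProbabilityMeasure_map (μ := P) ht.aemeasurable
  have hfix : ∀ s ∈ D, _ := fun s hs => (isBatch_pi Q M).average hM
    (show Measurable (o s) from ho.comp (measurable_const.prodMk measurable_id)) (hi s hs) (h2 s hs) (hV s hs)
  have hVM : 0 ≤ V / M := by positivity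
  have hem1 : Measurable fun a => ‖e (t a, w a)‖ ^ 2 := (hem.comp htwm).norm.pow_const 2
  have hsq : Integrable (fun a => ‖e (t a, w a)‖ ^ 2) P ∧
      ∫ a, ‖e (t a, w a)‖ ^ 2 ∂P ≤ V / M := by
    refine integrable_and_integral_le_of_lintegral_le hem1.aestronglyMeasurable (fun a => by positivity) hVM ?_
    have hem2 : Measurable fun q => ENNReal.ofReal (‖e q‖ ^ 2) :=
      (hem.norm.pow_const 2).ennreal_ofReal
    -- Tonelli on the product law of point and batch: the inner integral is the variance bound at a
    -- frozen point of `D`.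
    rw [← lintegral_map (f := fun q => ENNReal.ofReal (‖e q‖ ^ 2)) hem2 htwm, hlaw,
      lintegral_prod _ hem2.aemeasurable, lintegral_map hem2.lintegral_prod_right' ht]
    have : ∀ᵐ a ∂P, ∫⁻ u, ENNReal.ofReal (‖e (t a, u)‖ ^ 2) ∂(Measure.pi fun _ => Q)
        ≤ ENNReal.ofReal (V / M) := by
      filter_upwards [htD] with a ha
      obtain ⟨-, -, h3, h4⟩ := hfix _ ha
      rw [← ofReal_integral_eq_lintegral_ofReal h3
        (Filter.Eventually.of_forall fun u => by positivity)]
      exact ENNReal.ofReal_le_ofReal h4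
    refine (lintegral_mono_ae this).trans_eq ?_
    simp
  refine ⟨hem.comp htwm, hsq, fun v hv hv2 => ?_⟩
  have hint : Integrable (fun a => inner ℝ (e (t a, w a)) (v (t a))) P :=
    integrable_inner_of_integrable_sq (hem.comp htwm).aestronglyMeasurable
      (hv.comp ht).aestronglyMeasurable hsq.1 hv2
  refine ⟨hint, ?_⟩
  have hFm : Measurable fun q : S × (Fin M → W) => inner ℝ (e q) (v q.1) :=
    hem.inner (hv.comp measurable_fst)
  have hint' : Integrable (fun q : S × (Fin M → W) => inner ℝ (e q) (v q.1))
      ((P.map t).prod (Measure.pi fun _ => Q)) := by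
    rw [← hlaw, integrable_map_measure hFm.aestronglyMeasurable htwm.aemeasurable]
    exact hint
  change ∫ a, (fun q : S × (Fin M → W) => inner ℝ (e q) (v q.1)) (t a, w a) ∂P = 0
  rw [← integral_map htwm.aemeasurable hFm.aestronglyMeasurable, hlaw, integral_prod _ hint',
    integral_map ht.aemeasurable hint'.1.integral_prod_right']
  refine integral_eq_zero_of_ae ?_
  filter_upwards [htD] with a ha
  obtain ⟨h3, h4, -⟩ := hfix _ ha
  have h5 := integral_inner (𝕜 := ℝ) h3 (v (t a))
  rw [h4, inner_zero_right] at h5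
  exact (integral_congr_ae (Filter.Eventually.of_forall fun u => real_inner_comm _ _)).trans h5

end Probability

/-! ### Measurability of the maximizer, the objective and the steps. -/

section Measurability

variable {N : ℕ} {n : Fin N → ℕ} {m : ℕ} {p : Problem n m} {L μ : ℝ}

lemma IsClosedConvex.measurable {E : Type*} [NormedAddCommGroup E] [InnerProductSpace ℝ E]
    [MeasurableSpace E] [BorelSpace E] {φ : E → EReal} (hφ : IsClosedConvex φ) : Measurable φ :=
  hφ.lsc.measurable

lemma IsClosedConvex.measurableSet_dom {E : Type*} [NormedAddCommGroup E] [InnerProductSpace ℝ E]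
    [MeasurableSpace E] [BorelSpace E] {φ : E → EReal} (hφ : IsClosedConvex φ) :
    MeasurableSet (dom φ) :=
  hφ.measurable measurableSet_Iio

namespace Problem

lemma Regular.measurableSet_domG (hp : p.Regular L μ) : MeasurableSet p.domG := by
  have : p.domG = ⋂ i, (fun x : Primal n => x i) ⁻¹' dom (p.g i) := by
    ext x
    simp [domG]
  rw [this]
  exact MeasurableSet.iInter fun i =>
    (by fun_prop : Measurable fun x : Primal n => x i) (hp.closedConvex_g i).measurableSet_dom

/-- The map is Lipschitz on `domG` and, by its default value, constant off this measurable set. -/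
lemma Regular.measurable_argmaxDual (hp : p.Regular L μ) (hμ : 0 < μ) (hL : 0 ≤ L)
    (hne : (dom p.h).Nonempty) : Measurable p.argmaxDual := by
  classical
  have hcont : ContinuousOn p.argmaxDual p.domG :=
    (LipschitzOnWith.of_dist_le_mul (K := ⟨L / μ, by positivity⟩) fun x hx x' hx' => by
      rw [dist_eq_norm, dist_eq_norm]
      exact hp.norm_argmaxDual_sub_le hμ hne hx' hx).continuousOn
  have h := hcont.measurable_piecewise (g := fun _ => 0) continuousOn_const
    hp.measurableSet_domG
  convert h using 1
  ext1 x
  by_cases hx : x ∈ p.domG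
  · simp [hx]
  · simp [hx, argmaxDual]

lemma Regular.measurable_toReal_F (hp : p.Regular L μ) (hμ : 0 < μ) (hL : 0 ≤ L)
    (hne : (dom p.h).Nonempty) {Ω : Type*} [MeasurableSpace Ω] {X : Ω → Primal n}
    (hX : Measurable X) (hXd : ∀ a, X a ∈ p.domG) : Measurable fun a => (p.F (X a)).toReal := by
  classical
  have hset : MeasurableSet p.domProd :=
    ((by fun_prop : Measurable fun z : WithLp 2 (Primal n × Dual m) => z.fst)
      hp.measurableSet_domG).inter
    ((by fun_prop : Measurable fun z : WithLp 2 (Primal n × Dual m) => z.snd)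
      hp.closedConvex_h.measurableSet_dom)
  have hf := hp.continuousOn_coupling.measurable_piecewise (g := fun _ => 0) continuousOn_const hset
  have ha := hp.measurable_argmaxDual hμ hL hne
  have hfa : Measurable fun a => p.coupling (X a) (p.argmaxDual (X a)) := by
    have h1 : Measurable fun a => (WithLp.toLp 2 (X a, p.argmaxDual (X a)) :
        WithLp 2 (Primal n × Dual m)) := by fun_prop
    convert hf.comp h1 using 1
    ext1 a
    have : WithLp.toLp 2 (X a, p.argmaxDual (X a)) ∈ p.domProd :=
      ⟨hXd a, (hp.argmaxDual_spec hμ hne (hXd a)).1⟩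
    simp [this, coupling]
  have hh : Measurable fun a => (p.h (p.argmaxDual (X a))).toReal :=
    measurable_ereal_toReal.comp (hp.closedConvex_h.measurable.comp (ha.comp hX))
  have hg : ∀ i, Measurable fun a => (p.g i (X a i)).toReal := fun i =>
    measurable_ereal_toReal.comp ((hp.closedConvex_g i).measurable.comp (by fun_prop))
  simp_rw [fun a => hp.toReal_F hμ hne (hXd a)]
  fun_prop

end Problem

variable {Wx Wy : Type*} [MeasurableSpace Wx] [MeasurableSpace Wy]
  {ox : Primal n → Dual m → Wx → Primal n} {oy : Primal n → Dual m → Wy → Dual m}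
  {ηx ηy : ℝ} {Mx My : ℕ} {Ω : Type*} [MeasurableSpace Ω]

lemma measurable_batch {X Y W E : Type*} [MeasurableSpace X] [MeasurableSpace Y]
    [MeasurableSpace W] [NormedAddCommGroup E] [NormedSpace ℝ E] [MeasurableSpace E]
    [BorelSpace E] [SecondCountableTopology E] {o : X → Y → W → E}
    (ho : Measurable fun t : (X × Y) × W => o t.1.1 t.1.2 t.2) {M : ℕ} {x : Ω → X} {y : Ω → Y}
    {w : Ω → Fin M → W} (hx : Measurable x) (hy : Measurable y) (hw : Measurable w) :
    Measurable fun a => batch o (x a) (y a) (w a) :=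
  (Finset.measurable_fun_sum _ fun j _ => ho.comp
    ((hx.prodMk hy).prodMk ((measurable_pi_apply j).comp hw))).const_smul _

lemma Problem.Regular.measurable_proxBlock (hp : p.Regular L μ) (hx₀ : p.domG.Nonempty)
    (hη : 0 < ηx) (hox : Measurable fun t : (Primal n × Dual m) × Wx => ox t.1.1 t.1.2 t.2)
    {x : Ω → Primal n} {y : Ω → Dual m} {w : Ω → Fin Mx → Wx} (hx : Measurable x)
    (hy : Measurable y) (hw : Measurable w) (l : Fin N) :
    Measurable fun a => proxBlock p ox ηx (x a) (y a) (w a) l := by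
  obtain ⟨x₀, hx₀⟩ := hx₀
  have h1 := ((hp.closedConvex_g l).continuous_prox ⟨_, hx₀ l⟩ hη).measurable
  have h2 := measurable_batch hox hx hy hw
  exact h1.comp (by fun_prop)

lemma Problem.Regular.measurable_primalStep (hp : p.Regular L μ) (hx₀ : p.domG.Nonempty)
    (hη : 0 < ηx) (hox : Measurable fun t : (Primal n × Dual m) × Wx => ox t.1.1 t.1.2 t.2)
    {x : Ω → Primal n} {y : Ω → Dual m} {i : Ω → Fin N} {w : Ω → Fin Mx → Wx} (hx : Measurable x)
    (hy : Measurable y) (hi : Measurable i) (hw : Measurable w) :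
    Measurable fun a => primalStep p ox ηx (x a) (y a) (i a) (w a) := by
  refine (WithLp.measurable_toLp 2 _).comp (measurable_pi_lambda _ fun l => ?_)
  have : ∀ a, Function.update (fun l => x a l) (i a) (proxBlock p ox ηx (x a) (y a) (w a) (i a)) l
      = if i a = l then proxBlock p ox ηx (x a) (y a) (w a) l else x a l := by
    intro a
    by_cases h : i a = l
    · subst h
      simp
    · rw [if_neg h, Function.update_of_ne (Ne.symm h)]
  simp_rw [this]
  exact Measurable.ite (hi (measurableSet_singleton l))
    (hp.measurable_proxBlock hx₀ hη hox hx hy hw l) (by fun_prop)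

lemma Problem.Regular.measurable_proxDual (hp : p.Regular L μ) (hne : (dom p.h).Nonempty)
    (hη : 0 < ηy) (hoy : Measurable fun t : (Primal n × Dual m) × Wy => oy t.1.1 t.1.2 t.2)
    {x : Ω → Primal n} {y : Ω → Dual m} {z : Ω → Fin My → Wy} (hx : Measurable x)
    (hy : Measurable y) (hz : Measurable z) :
    Measurable fun a => proxDual p oy ηy (x a) (y a) (z a) := by
  have h1 := (hp.closedConvex_h.continuous_prox hne hη).measurable
  have h2 := measurable_batch hoy hx hy hz
  exact h1.comp (by fun_prop)

end Measurability

/-! ### One step in expectation. -/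

section ExpectedSteps

lemma sum_norm_gradMapX_sq {N : ℕ} {n : Fin N → ℕ} {m : ℕ} {Wx : Type*} {Mx : ℕ} (p : Problem n m) (ox : Primal n → Dual m → Wx → Primal n) (ηx : ℝ)
    (x : Primal n) (y : Dual m) (w : Fin Mx → Wx) :
    ∑ l, ‖ηx⁻¹ • (x l - proxBlock p ox ηx x y w l)‖ ^ 2 = ‖gradMapX p ox ηx x y w‖ ^ 2 := by
  rw [PiLp.norm_sq_eq_of_L2]
  rfl

lemma norm_primalStep_sub_sq {N : ℕ} {n : Fin N → ℕ} {m : ℕ} {p : Problem n m} {Wx : Type*}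
    {ox : Primal n → Dual m → Wx → Primal n} {ηx : ℝ} {Mx : ℕ} (hη : 0 < ηx) (x : Primal n) (y : Dual m) (i : Fin N)
    (w : Fin Mx → Wx) : ‖primalStep p ox ηx x y i w - x‖ ^ 2
      = ηx ^ 2 * ‖ηx⁻¹ • (x i - proxBlock p ox ηx x y w i)‖ ^ 2 := by
  have h := norm_replaceBlock_sub x i (proxBlock p ox ηx x y w i)
  change ‖primalStep p ox ηx x y i w - x‖ = _ at h
  rw [h, norm_smul, mul_pow, norm_sub_rev, norm_inv, inv_pow, Real.norm_eq_abs, sq_abs,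
    mul_inv_cancel_left₀ (by positivity)]

variable {N : ℕ} {n : Fin N → ℕ} {m : ℕ} {p : Problem n m} {L μ : ℝ}
  {Wx Wy : Type*} [MeasurableSpace Wx] [MeasurableSpace Wy] {Px : Measure Wx} {Py : Measure Wy}
  {ox : Primal n → Dual m → Wx → Primal n} {oy : Primal n → Dual m → Wy → Dual m} {σx σy : ℝ}
  {ηx ηy : ℝ} {Mx My : ℕ} {Ω : Type*} [MeasurableSpace Ω] {P : Measure Ω} [IsProbabilityMeasure P]
  {x : Ω → Primal n} {y : Ω → Dual m}

/-- The error of the averaged primal oracle in one block. -/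
lemma Problem.OracleAssumption.error_x [IsProbabilityMeasure Px]
    (ho : p.OracleAssumption Px Py ox oy σx σy) (hMx : 1 ≤ Mx)
    {w : Ω → Fin Mx → Wx} (hx : Measurable x) (hy : Measurable y) (hxd : ∀ a, x a ∈ p.domG)
    (hyd : ∀ᵐ a ∂P, y a ∈ dom p.h) (hw : IsBatch P Px w)
    (hind : IndepFun (fun a => (x a, y a)) w P) (l : Fin N) :
    Integrable (fun a => ‖batch ox (x a) (y a) (w a) l - ∫ v, ox (x a) (y a) v l ∂Px‖ ^ 2) P ∧
    ∫ a, ‖batch ox (x a) (y a) (w a) l - ∫ v, ox (x a) (y a) v l ∂Px‖ ^ 2 ∂P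
      ≤ σx ^ 2 / N / Mx := by
  have h := (hw.oracle_error hMx (hx.prodMk hy) hind
    (o := fun s v => ox s.1 s.2 v l) (D := {s | s.1 ∈ p.domG ∧ s.2 ∈ dom p.h})
    (V := σx ^ 2 / N) ((by fun_prop : Measurable fun x : Primal n => x l).comp ho.measurable_x)
    (by filter_upwards [hyd] with a ha using ⟨hxd a, ha⟩) (by positivity)
    (fun s hs => ho.integrable_x _ hs.1 _ hs.2 l)
    (fun s hs => by
      rw [ho.mean_x _ hs.1 _ hs.2 l]; exact ho.sq_integrable_x _ hs.1 _ hs.2 l)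
    (fun s hs => by
      rw [ho.mean_x _ hs.1 _ hs.2 l]; exact ho.variance_x _ hs.1 _ hs.2 l)).2.1
  simpa [batch] using h

/-- The error of the averaged dual oracle. -/
lemma Problem.OracleAssumption.error_y [IsProbabilityMeasure Py]
    (ho : p.OracleAssumption Px Py ox oy σx σy) (hMy : 1 ≤ My)
    {z : Ω → Fin My → Wy} (hx : Measurable x) (hy : Measurable y) (hxd : ∀ a, x a ∈ p.domG)
    (hyd : ∀ᵐ a ∂P, y a ∈ dom p.h) (hz : IsBatch P Py z)
    (hind : IndepFun (fun a => (x a, y a)) z P) :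
    (Integrable (fun a => ‖batch oy (x a) (y a) (z a) - p.gradY (x a) (y a)‖ ^ 2) P ∧
      ∫ a, ‖batch oy (x a) (y a) (z a) - p.gradY (x a) (y a)‖ ^ 2 ∂P ≤ σy ^ 2 / My) ∧
    ∀ v : Primal n × Dual m → Dual m, Measurable v →
      Integrable (fun a => ‖v (x a, y a)‖ ^ 2) P →
      Integrable (fun a =>
        inner ℝ (batch oy (x a) (y a) (z a) - p.gradY (x a) (y a)) (v (x a, y a))) P ∧
      ∫ a, inner ℝ (batch oy (x a) (y a) (z a) - p.gradY (x a) (y a)) (v (x a, y a)) ∂P = 0 := by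
  obtain ⟨-, h, h'⟩ := hz.oracle_error hMy (hx.prodMk hy) hind
    (o := fun s v => oy s.1 s.2 v) (D := {s | s.1 ∈ p.domG ∧ s.2 ∈ dom p.h})
    (V := σy ^ 2) ho.measurable_y
    (by filter_upwards [hyd] with a ha using ⟨hxd a, ha⟩) (by positivity)
    (fun s hs => ho.integrable_y _ hs.1 _ hs.2)
    (fun s hs => by
      rw [ho.mean_y _ hs.1 _ hs.2]; exact ho.sq_integrable_y _ hs.1 _ hs.2)
    (fun s hs => by
      rw [ho.mean_y _ hs.1 _ hs.2]; exact ho.variance_y _ hs.1 _ hs.2)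
  have hae : ∀ᵐ a ∂P, (My : ℝ)⁻¹ • ∑ j, oy (x a) (y a) (z a j) - ∫ v, oy (x a) (y a) v ∂Py
      = batch oy (x a) (y a) (z a) - p.gradY (x a) (y a) := by
    filter_upwards [hyd] with a ha
    rw [ho.mean_y _ (hxd a) _ ha]
    rfl
  have hsq := hae.mono fun a ha => congrArg (fun e : Dual m => ‖e‖ ^ 2) ha
  refine ⟨⟨h.1.congr hsq, (integral_congr_ae hsq).symm.trans_le h.2⟩, fun v hv hv2 => ?_⟩
  have hin := hae.mono fun a ha => congrArg (fun e : Dual m => inner ℝ e (v (x a, y a))) ha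
  exact ⟨(h' v hv hv2).1.congr hin, (integral_congr_ae hin).symm.trans (h' v hv hv2).2⟩

/-- The second moment of the dual gradient map. -/
lemma Problem.Regular.integral_gradMapY_sq_le [IsProbabilityMeasure Py]
    (hp : p.Regular L μ) (hμ : 0 < μ) (hη : 0 < ηy)
    (hηL : ηy * L ≤ 1) (ho : p.OracleAssumption Px Py ox oy σx σy) (hMy : 1 ≤ My)
    {z : Ω → Fin My → Wy} (hx : Measurable x) (hy : Measurable y) (hxd : ∀ a, x a ∈ p.domG)
    (hyd : ∀ᵐ a ∂P, y a ∈ dom p.h) (hz : IsBatch P Py z)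
    (hind : IndepFun (fun a => (x a, y a)) z P)
    (hδ : Integrable (fun a => ‖y a - p.argmaxDual (x a)‖ ^ 2) P) :
    Integrable (fun a => ‖gradMapY p oy ηy (x a) (y a) (z a)‖ ^ 2) P ∧
      ∫ a, ‖gradMapY p oy ηy (x a) (y a) (z a)‖ ^ 2 ∂P
        ≤ 8 / ηy ^ 2 * ∫ a, ‖y a - p.argmaxDual (x a)‖ ^ 2 ∂P + 2 * (σy ^ 2 / My) := by
  obtain ⟨a₀, ha₀⟩ := hyd.exists
  have hmeas : Measurable fun a => ‖gradMapY p oy ηy (x a) (y a) (z a)‖ ^ 2 :=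
    (((hp.measurable_proxDual ⟨_, ha₀⟩ hη ho.measurable_y hx hy hz.measurable).sub
      hy).const_smul ηy⁻¹).norm.pow_const 2
  obtain ⟨⟨hε, hεV⟩, -⟩ := ho.error_y hMy hx hy hxd hyd hz hind
  have hbd : ∀ᵐ a ∂P, ‖gradMapY p oy ηy (x a) (y a) (z a)‖ ^ 2
      ≤ 8 / ηy ^ 2 * ‖y a - p.argmaxDual (x a)‖ ^ 2
        + 2 * ‖batch oy (x a) (y a) (z a) - p.gradY (x a) (y a)‖ ^ 2 := by
    filter_upwards [hyd] with a ha
    exact hp.norm_prox_sub_self_sq_le hμ hη hηL (hxd a) ha _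
  have hR := (hδ.const_mul (8 / ηy ^ 2)).add (hε.const_mul 2)
  have hI : Integrable (fun a => ‖gradMapY p oy ηy (x a) (y a) (z a)‖ ^ 2) P :=
    hR.mono' hmeas.aestronglyMeasurable (by
      filter_upwards [hbd] with a ha
      rwa [Real.norm_of_nonneg (by positivity)])
  refine ⟨hI, (integral_mono_ae hI hR hbd).trans ?_⟩
  rw [integral_add' (hδ.const_mul _) (hε.const_mul _), integral_const_mul, integral_const_mul]
  linarith

/-- The dual step contracts the mean square distance to the dual maximizer, up to noise. -/
lemma Problem.Regular.integral_proxDual_sub_sq_le [IsProbabilityMeasure Py]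
    (hp : p.Regular L μ) (hμ : 0 < μ) (hL : 0 ≤ L)
    (hη : 0 < ηy) (hηL : ηy * L ≤ 1) (hq : ηy * μ ≤ 1)
    (ho : p.OracleAssumption Px Py ox oy σx σy) (hMy : 1 ≤ My)
    {z : Ω → Fin My → Wy} (hx : Measurable x) (hy : Measurable y) (hxd : ∀ a, x a ∈ p.domG)
    (hyd : ∀ᵐ a ∂P, y a ∈ dom p.h) (hz : IsBatch P Py z)
    (hind : IndepFun (fun a => (x a, y a)) z P)
    (hδ : Integrable (fun a => ‖y a - p.argmaxDual (x a)‖ ^ 2) P) :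
    Integrable (fun a => ‖proxDual p oy ηy (x a) (y a) (z a) - p.argmaxDual (x a)‖ ^ 2) P ∧
      ∫ a, ‖proxDual p oy ηy (x a) (y a) (z a) - p.argmaxDual (x a)‖ ^ 2 ∂P
        ≤ (1 - ηy * μ) * ∫ a, ‖y a - p.argmaxDual (x a)‖ ^ 2 ∂P
          + 2 * ηy ^ 2 * (σy ^ 2 / My) := by
  obtain ⟨a₀, ha₀⟩ := hyd.exists
  have hne : (dom p.h).Nonempty := ⟨_, ha₀⟩
  have ham := hp.measurable_argmaxDual hμ hL hne
  have hmeas : Measurable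
      fun a => ‖proxDual p oy ηy (x a) (y a) (z a) - p.argmaxDual (x a)‖ ^ 2 :=
    ((hp.measurable_proxDual hne hη ho.measurable_y hx hy hz.measurable).sub
      (ham.comp hx)).norm.pow_const 2
  obtain ⟨⟨hε, hεV⟩, hinner⟩ := ho.error_y hMy hx hy hxd hyd hz hind
  -- The noise-free step minus the maximizer, with the gradient written as the oracle mean to make
  -- it a measurable function of the current point; the noise is orthogonal to it.
  set v : Primal n × Dual m → Dual m := fun s =>
    prox (fun u => (ηy : EReal) * p.h u) (s.2 + ηy • ∫ u, oy s.1 s.2 u ∂Py)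
      - p.argmaxDual s.1 with hv
  have hmean : Measurable fun s : Primal n × Dual m => ∫ u, oy s.1 s.2 u ∂Py :=
    (ho.measurable_y.stronglyMeasurable.integral_prod_right
      (f := fun (s : Primal n × Dual m) u => oy s.1 s.2 u)).measurable
  have hvm : Measurable v :=
    ((hp.closedConvex_h.continuous_prox hne hη).measurable.comp (by fun_prop)).sub
      (ham.comp measurable_fst)
  have hveq : ∀ᵐ a ∂P, v (x a, y a) = prox (fun u => (ηy : EReal) * p.h u)
      (y a + ηy • p.gradY (x a) (y a)) - p.argmaxDual (x a) := by
    filter_upwards [hyd] with a ha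
    simp only [hv]
    rw [ho.mean_y _ (hxd a) _ ha]
  have hv2 : Integrable (fun a => ‖v (x a, y a)‖ ^ 2) P :=
    hδ.mono' ((hvm.comp (hx.prodMk hy)).norm.pow_const 2).aestronglyMeasurable (by
      filter_upwards [hyd, hveq] with a ha hva
      rw [Real.norm_of_nonneg (by positivity), hva]
      exact pow_le_pow_left₀ (norm_nonneg _)
        (hp.norm_prox_gradY_sub_argmaxDual_le hμ hη hηL (hxd a) ha) 2)
  obtain ⟨hin, hin0⟩ := hinner v hvm hv2
  have hbd : ∀ᵐ a ∂P, ‖proxDual p oy ηy (x a) (y a) (z a) - p.argmaxDual (x a)‖ ^ 2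
      ≤ (1 - ηy * μ) * ‖y a - p.argmaxDual (x a)‖ ^ 2
        + (2 * ηy / (1 + ηy * μ) * inner ℝ (batch oy (x a) (y a) (z a) - p.gradY (x a) (y a))
            (v (x a, y a))
          + 2 * ηy ^ 2 * ‖batch oy (x a) (y a) (z a) - p.gradY (x a) (y a)‖ ^ 2) := by
    filter_upwards [hyd, hveq] with a ha hva
    rw [hva]
    exact hp.norm_prox_sub_argmaxDual_sq_le' hμ hη hηL hq (hxd a) ha _ _ rfl
  have hR2 := (hin.const_mul (2 * ηy / (1 + ηy * μ))).add (hε.const_mul (2 * ηy ^ 2))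
  have hR := (hδ.const_mul (1 - ηy * μ)).add hR2
  have hI : Integrable
      (fun a => ‖proxDual p oy ηy (x a) (y a) (z a) - p.argmaxDual (x a)‖ ^ 2) P :=
    hR.mono' hmeas.aestronglyMeasurable (by
      filter_upwards [hbd] with a ha
      rwa [Real.norm_of_nonneg (by positivity)])
  refine ⟨hI, (integral_mono_ae hI hR hbd).trans ?_⟩
  rw [integral_add' (hδ.const_mul _) hR2, integral_add' (hin.const_mul _) (hε.const_mul _),
    integral_const_mul, integral_const_mul, integral_const_mul, hin0, mul_zero, zero_add]
  gcongr

/-- The expected decrease of the primal objective in one primal step. -/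
lemma Problem.Regular.integral_F_primalStep_le [IsProbabilityMeasure Px]
    (hp : p.Regular L μ) (hμ : 0 < μ) (hL : 0 ≤ L)
    (hN : 1 ≤ N) (hη : 0 < ηx) (hC : 0 < 1 / 2 - L * ηx / 2 - L ^ 2 * ηx / (2 * μ))
    (ho : p.OracleAssumption Px Py ox oy σx σy) (hMx : 1 ≤ Mx)
    {i : Ω → Fin N} {w : Ω → Fin Mx → Wx} (hx : Measurable x) (hy : Measurable y)
    (hxd : ∀ a, x a ∈ p.domG) (hyd : ∀ᵐ a ∂P, y a ∈ dom p.h) (hi : IsUniformIndex P i)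
    (hw : IsBatch P Px w) (hind : IndepFun (fun a => (x a, y a)) (fun a => (i a, w a)) P)
    (hiw : IndepFun i w P) (hF : Integrable (fun a => (p.F (x a)).toReal) P)
    (hδ : Integrable (fun a => ‖y a - p.argmaxDual (x a)‖ ^ 2) P) :
    Integrable (fun a => (p.F (primalStep p ox ηx (x a) (y a) (i a) (w a))).toReal) P ∧
    Integrable (fun a => ‖gradMapX p ox ηx (x a) (y a) (w a)‖ ^ 2) P ∧
    Integrable (fun a => ‖primalStep p ox ηx (x a) (y a) (i a) (w a) - x a‖ ^ 2) P ∧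
    ∫ a, ‖primalStep p ox ηx (x a) (y a) (i a) (w a) - x a‖ ^ 2 ∂P
      = ηx ^ 2 / N * ∫ a, ‖gradMapX p ox ηx (x a) (y a) (w a)‖ ^ 2 ∂P ∧
    ∫ a, (p.F (primalStep p ox ηx (x a) (y a) (i a) (w a))).toReal ∂P
        + (1 / 2 - L * ηx / 2 - L ^ 2 * ηx / (2 * μ)) * (ηx / N)
          * ∫ a, ‖gradMapX p ox ηx (x a) (y a) (w a)‖ ^ 2 ∂P
      ≤ ∫ a, (p.F (x a)).toReal ∂P + ηx / N * (σx ^ 2 / Mx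
        + L ^ 2 * ∫ a, ‖y a - p.argmaxDual (x a)‖ ^ 2 ∂P) := by
  set C := 1 / 2 - L * ηx / 2 - L ^ 2 * ηx / (2 * μ) with hCdef
  obtain ⟨a₀, ha₀⟩ := hyd.exists
  have hne : (dom p.h).Nonempty := ⟨_, ha₀⟩
  have hxne : p.domG.Nonempty := ⟨_, hxd a₀⟩
  have ham := hp.measurable_argmaxDual hμ hL hne
  have hN0 : (0 : ℝ) < N := by exact_mod_cast hN
  have hwm := hw.measurable
  have hsm : Measurable fun a => (x a, y a) := hx.prodMk hy
  have hsw : IndepFun (fun a => (x a, y a)) w P := hind.comp measurable_id measurable_snd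
  -- The index must be independent of iterate and primal batch jointly, since the block errors
  -- depend on both.
  have hi_ind : IndepFun i (fun a => ((x a, y a), w a)) P :=
    indepFun_prodMk_of_indepFun_prodMk hsm hi.1 hwm hind hiw
  have htm : Measurable fun a => ((x a, y a), w a) := hsm.prodMk hwm
  -- the squared block norms of the gradient map
  set G : Fin N → (Primal n × Dual m) × (Fin Mx → Wx) → ℝ := fun l t =>
    ‖ηx⁻¹ • (t.1.1 l - proxBlock p ox ηx t.1.1 t.1.2 t.2 l)‖ ^ 2 with hG
  have hGm : ∀ l, Measurable (G l) := fun l => by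
    have := hp.measurable_proxBlock (ηx := ηx) (w := fun t : (Primal n × Dual m) × (Fin Mx → Wx) =>
      t.2) hxne hη ho.measurable_x (measurable_fst.comp measurable_fst)
      (measurable_snd.comp measurable_fst) measurable_snd l
    have h2 : Measurable fun t : (Primal n × Dual m) × (Fin Mx → Wx) => t.1.1 l := by fun_prop
    exact ((h2.sub this).const_smul ηx⁻¹).norm.pow_const 2
  -- the squared block errors
  set e : Fin N → (Primal n × Dual m) × (Fin Mx → Wx) → ℝ := fun l t =>
    ‖batch ox t.1.1 t.1.2 t.2 l - ∫ v, ox t.1.1 t.1.2 v l ∂Px‖ ^ 2 with he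
  -- The error of using y instead of y*(x), again through oracle means for measurability; summed
  -- over the blocks it is a full squared gradient difference, at most L²‖y − y*(x)‖².
  set U : Fin N → (Primal n × Dual m) × (Fin Mx → Wx) → ℝ := fun l t =>
    ‖∫ v, ox t.1.1 (p.argmaxDual t.1.1) v l ∂Px - ∫ v, ox t.1.1 t.1.2 v l ∂Px‖ ^ 2 with hU
  have hmean : ∀ l, Measurable fun s : Primal n × Dual m => ∫ v, ox s.1 s.2 v l ∂Px := fun l =>
    (((by fun_prop : Measurable fun x : Primal n => x l).comp
      ho.measurable_x).stronglyMeasurable.integral_prod_right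
      (f := fun (s : Primal n × Dual m) v => ox s.1 s.2 v l)).measurable
  have hmean' : ∀ l, Measurable fun t : (Primal n × Dual m) × (Fin Mx → Wx) =>
      ∫ v, ox t.1.1 t.1.2 v l ∂Px := fun l => (hmean l).comp measurable_fst
  have hem : ∀ l, Measurable (e l) := fun l => by
    have h1 := measurable_batch (x := fun t : (Primal n × Dual m) × (Fin Mx → Wx) => t.1.1)
      (y := fun t => t.1.2) (w := fun t => t.2) ho.measurable_x (by fun_prop) (by fun_prop)
      (by fun_prop)
    have h2 : Measurable fun t : (Primal n × Dual m) × (Fin Mx → Wx) =>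
        batch ox t.1.1 t.1.2 t.2 l := by fun_prop
    exact (h2.sub (hmean' l)).norm.pow_const 2
  have hUm : ∀ l, Measurable (U l) := fun l => by
    have h1 : Measurable fun t : (Primal n × Dual m) × (Fin Mx → Wx) =>
        (t.1.1, p.argmaxDual t.1.1) := by fun_prop
    have h2 : Measurable fun t : (Primal n × Dual m) × (Fin Mx → Wx) =>
        ∫ v, ox t.1.1 (p.argmaxDual t.1.1) v l ∂Px := (hmean l).comp h1
    exact (h2.sub (hmean' l)).norm.pow_const 2
  have hUeq : ∀ᵐ a ∂P, ∀ l, U l ((x a, y a), w a)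
      = ‖p.gradX (x a) (p.argmaxDual (x a)) l - p.gradX (x a) (y a) l‖ ^ 2 := by
    filter_upwards [hyd] with a ha l
    simp only [hU]
    rw [ho.mean_x _ (hxd a) _ ha, ho.mean_x _ (hxd a) _ (hp.argmaxDual_spec hμ hne (hxd a)).1]
  have hUsum : ∀ᵐ a ∂P, ∑ l, U l ((x a, y a), w a)
      ≤ L ^ 2 * ‖y a - p.argmaxDual (x a)‖ ^ 2 := by
    filter_upwards [hyd, hUeq] with a ha hUa
    simp_rw [hUa]
    have h1 := hp.norm_gradX_sub_le (hxd a) (hp.argmaxDual_spec hμ hne (hxd a)).1 ha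
    rw [norm_sub_rev (p.argmaxDual _)] at h1
    have h2 := pow_le_pow_left₀ (norm_nonneg _) h1 2
    rw [mul_pow, PiLp.norm_sq_eq_of_L2] at h2
    exact h2
  have hU0 : ∀ l t, 0 ≤ U l t := fun l t => by positivity
  have he0 : ∀ l t, 0 ≤ e l t := fun l t => by positivity
  have hG0 : ∀ l t, 0 ≤ G l t := fun l t => by positivity
  have hUi : ∀ l, Integrable (fun a => U l ((x a, y a), w a)) P := fun l =>
    (hδ.const_mul (L ^ 2)).mono' ((hUm l).comp htm).aestronglyMeasurable (by
      filter_upwards [hUsum] with a ha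
      rw [Real.norm_of_nonneg (hU0 _ _)]
      exact (Finset.single_le_sum (fun l _ => hU0 l _) (Finset.mem_univ l)).trans ha)
  have hei := fun l => ho.error_x hMx hx hy hxd hyd hw hsw l
  have hHi : ∀ l, Integrable (fun a => e l ((x a, y a), w a) + U l ((x a, y a), w a)) P :=
    fun l => (hei l).1.add (hUi l)
  obtain ⟨hHiff, hHint⟩ := hi.integrable_iff hN htm hi_ind (H := fun l t => e l t + U l t)
    (fun l => (hem l).add (hUm l)) (fun l t => add_nonneg (he0 l t) (hU0 l t))
  have hH := hHiff.2 hHi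
  have hHE := hHint hH
  obtain ⟨hGiff, hGint⟩ := hi.integrable_iff hN htm hi_ind (H := G) hGm hG0
  -- the pathwise inequality
  have hpath : ∀ᵐ a ∂P, (p.F (primalStep p ox ηx (x a) (y a) (i a) (w a))).toReal
      + C * (ηx * G (i a) ((x a, y a), w a)) ≤ (p.F (x a)).toReal
        + ηx * (e (i a) ((x a, y a), w a) + U (i a) ((x a, y a), w a)) := by
    filter_upwards [hyd, hUeq] with a ha hUa
    rw [hUa]
    simp only [he]
    rw [ho.mean_x _ (hxd a) _ ha]
    exact hp.F_replaceBlock_prox_le hμ hη (hxd a) ha (i a)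
      (batch ox (x a) (y a) (w a) (i a)) _ rfl
  have hx'd : ∀ a, primalStep p ox ηx (x a) (y a) (i a) (w a) ∈ p.domG := fun a =>
    hp.replaceBlock_prox_mem hη (hxd a) _ _
  obtain ⟨b, hb⟩ := hp.exists_le_F hμ hne
  have hF'm := hp.measurable_toReal_F hμ hL hne
    (hp.measurable_primalStep hxne hη ho.measurable_x hx hy hi.1 hwm) hx'd
  have hR := hF.add (hH.const_mul ηx)
  have hF' : Integrable
      (fun a => (p.F (primalStep p ox ηx (x a) (y a) (i a) (w a))).toReal) P := by
    have hlow : ∀ᵐ a ∂P, b ≤ (p.F (primalStep p ox ηx (x a) (y a) (i a) (w a))).toReal :=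
      Filter.Eventually.of_forall fun a => hb _ (hx'd a)
    refine integrable_of_le_of_le (g₁ := fun _ => b) hF'm.aestronglyMeasurable hlow ?_
      (integrable_const b) hR
    filter_upwards [hpath] with a ha
    have : 0 ≤ C * (ηx * G (i a) ((x a, y a), w a)) :=
      mul_nonneg hC.le (mul_nonneg hη.le (hG0 _ _))
    simp only [Pi.add_apply]
    linarith
  have hGIm : Measurable fun a => G (i a) ((x a, y a), w a) :=
    measurable_apply_fin hi.1 htm hGm
  have hCη : 0 < C * ηx := mul_pos hC hη
  -- Since F is bounded below by b and C > 0, the pathwise inequality dominates G by an integrable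
  -- function.
  have hGI : Integrable (fun a => G (i a) ((x a, y a), w a)) P := by
    have hlow : ∀ᵐ a ∂P, 0 ≤ G (i a) ((x a, y a), w a) :=
      Filter.Eventually.of_forall fun a => hG0 _ _
    refine integrable_of_le_of_le (g₁ := fun _ => 0) hGIm.aestronglyMeasurable hlow ?_
      (integrable_const 0)
      ((hR.sub (integrable_const b)).const_mul (C * ηx)⁻¹)
    filter_upwards [hpath] with a ha
    have h1 := hb _ (hx'd a)
    simp only [Pi.add_apply, Pi.sub_apply]
    rw [le_inv_mul_iff₀ hCη]
    linarith
  have hGl := hGiff.1 hGI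
  have hsumG : ∀ a, ∑ l, G l ((x a, y a), w a) = ‖gradMapX p ox ηx (x a) (y a) (w a)‖ ^ 2 :=
    fun a => sum_norm_gradMapX_sq p ox ηx (x a) (y a) (w a)
  have hGX : Integrable (fun a => ‖gradMapX p ox ηx (x a) (y a) (w a)‖ ^ 2) P := by
    simp_rw [← hsumG]
    exact integrable_finsetSum _ fun l _ => hGl l
  have hGE : ∫ a, G (i a) ((x a, y a), w a) ∂P
      = (N : ℝ)⁻¹ * ∫ a, ‖gradMapX p ox ηx (x a) (y a) (w a)‖ ^ 2 ∂P := by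
    simp_rw [← hsumG]
    rw [hGint hGI, integral_finsetSum _ fun l _ => hGl l]
  have hstep : ∀ a, ‖primalStep p ox ηx (x a) (y a) (i a) (w a) - x a‖ ^ 2
      = ηx ^ 2 * G (i a) ((x a, y a), w a) := fun a => norm_primalStep_sub_sq hη _ _ _ _
  refine ⟨hF', hGX, ?_, ?_, ?_⟩
  · simp_rw [hstep]
    exact hGI.const_mul _
  · simp_rw [hstep]
    rw [integral_const_mul, hGE]
    ring
  · have hmono := integral_mono_ae (hF'.add ((hGI.const_mul ηx).const_mul C)) hR hpath
    rw [integral_add' hF' ((hGI.const_mul ηx).const_mul C), integral_add' hF (hH.const_mul ηx),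
      integral_const_mul, integral_const_mul, integral_const_mul, hGE, hHE] at hmono
    -- The N block variances σx²/N, divided by the batch size, add up to σx²/Mx.
    have hsum : ∑ l, ∫ a, (e l ((x a, y a), w a) + U l ((x a, y a), w a)) ∂P
        ≤ σx ^ 2 / Mx + L ^ 2 * ∫ a, ‖y a - p.argmaxDual (x a)‖ ^ 2 ∂P := by
      have h1 : ∀ l, ∫ a, (e l ((x a, y a), w a) + U l ((x a, y a), w a)) ∂P
          = ∫ a, e l ((x a, y a), w a) ∂P + ∫ a, U l ((x a, y a), w a) ∂P := fun l =>
        integral_add (hei l).1 (hUi l)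
      simp_rw [h1]
      rw [Finset.sum_add_distrib]
      refine add_le_add ((Finset.sum_le_sum fun l _ => (hei l).2).trans_eq ?_) ?_
      · simp only [Finset.sum_const, Finset.card_univ, Fintype.card_fin, nsmul_eq_mul]
        field_simp
      · rw [← integral_finsetSum _ fun l _ => hUi l, ← integral_const_mul]
        exact integral_mono_ae (integrable_finsetSum _ fun l _ => hUi l) (hδ.const_mul _) hUsum
    have h2 : ηx * ((N : ℝ)⁻¹ * ∑ l, ∫ a, (e l ((x a, y a), w a) + U l ((x a, y a), w a)) ∂P)
        ≤ ηx * ((N : ℝ)⁻¹ * (σx ^ 2 / Mx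
          + L ^ 2 * ∫ a, ‖y a - p.argmaxDual (x a)‖ ^ 2 ∂P)) := by gcongr
    rw [div_eq_mul_inv ηx]
    linarith

end ExpectedSteps

/-! ### The step-size constants and the Lyapunov recursion. -/

section Constants

lemma rho_pos {N : ℕ} (hN : 1 ≤ N) : 0 < rho N := by
  have hN0 : (0 : ℝ) < N := by exact_mod_cast hN
  have h : 1 < Real.sqrt (1 + 12 / (N : ℝ)) := by
    rw [Real.lt_sqrt zero_le_one]
    have : 0 < 12 / (N : ℝ) := by positivity
    linarith
  unfold rho
  linarith

/-- The quadratic equation that defines ρ. -/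
lemma four_mul_rho_eq {N : ℕ} (hN : 1 ≤ N) : 4 * (N * rho N) * (1 + 12 * rho N) = 1 := by
  have hN0 : (0 : ℝ) < N := by exact_mod_cast hN
  have h := Real.sq_sqrt (show 0 ≤ 1 + 12 / (N : ℝ) by positivity)
  have h2 : (N : ℝ) * Real.sqrt (1 + 12 / (N : ℝ)) ^ 2 = N + 12 := by
    rw [h]; field_simp
  unfold rho
  linear_combination h2 / 12

/-- In the scale-free variables l = ηy L, q = ηy μ, α = Nρ, with q ≤ l ≤ 1, the three losses are
αlq²/2, αl²q/2 and 6ρα(2−q)l². Their sum is at most α + 12ρα, which equals 1/4 by the equation for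
ρ. -/
lemma stepsize_margin {N : ℕ} (hN : 1 ≤ N) {L μ ηx ηy : ℝ} (hμ : 0 < μ) (hμL : μ ≤ L)
    (hη : 0 < ηy) (hηL : ηy * L ≤ 1) (hηx : ηx = N * rho N * ηy ^ 3 * μ ^ 2) :
    1 / 4 + 6 * rho N * μ * ((2 - ηy * μ) / (ηy * μ) * (L / μ) ^ 2 * ηx)
      ≤ 1 / 2 - L * ηx / 2 - L ^ 2 * ηx / (2 * μ) := by
  have hρ := rho_pos hN
  have h4 := four_mul_rho_eq hN
  set ρ := rho N
  set α := (N : ℝ) * ρ with hα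
  have hα0 : 0 < α := by positivity
  have hL : 0 < L := by linarith
  set q := ηy * μ with hq
  set l := ηy * L with hl
  have hq0 : 0 < q := by positivity
  have hql : q ≤ l := mul_le_mul_of_nonneg_left hμL hη.le
  have hq1 : q ≤ 1 := hql.trans hηL
  have hl0 : 0 < l := by positivity
  have e1 : L * ηx = α * (l * q ^ 2) := by rw [hηx, hl, hq]; ring
  have e2 : L ^ 2 * ηx / (2 * μ) = α * (l ^ 2 * q) / 2 := by
    rw [hηx, hl, hq]; field_simp
  have e3 : 6 * ρ * μ * ((2 - q) / q * (L / μ) ^ 2 * ηx) = 6 * ρ * α * ((2 - q) * l ^ 2) := by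
    rw [hηx, hl, hq]; field_simp
  rw [e1, e2, e3]
  have hl2 : l ^ 2 ≤ 1 := by nlinarith
  have hq2 : q ^ 2 ≤ 1 := by nlinarith
  have b1 : l * q ^ 2 ≤ 1 := by nlinarith [sq_nonneg q]
  have b2 : l ^ 2 * q ≤ q := by nlinarith
  have b3 : (2 - q) * l ^ 2 ≤ 2 - q := by nlinarith
  have c1 : α * (l * q ^ 2) ≤ α * 1 := by gcongr
  have c2 : α * (l ^ 2 * q) ≤ α * q := by gcongr
  have c3 : 6 * ρ * α * ((2 - q) * l ^ 2) ≤ 6 * ρ * α * (2 - q) := by gcongr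
  have c4 : α * q ≤ α * 1 := by gcongr
  have c5 : 0 ≤ 6 * ρ * α * q := by positivity
  have h5 : 4 * α + 48 * (ρ * α) = 1 := by linarith
  linarith

/-- Combination of the one-step estimates into the decrease of the Lyapunov function. -/
lemma lyapunov_decrease {N : ℕ} (hN : 1 ≤ N) {L μ ηx ηy θ : ℝ} (hμ : 0 < μ) (hμL : μ ≤ L)
    (hη : 0 < ηy) (hηL : ηy * L ≤ 1) (hηx : ηx = N * rho N * ηy ^ 3 * μ ^ 2)
    {F F' D D' gx gy sx sy : ℝ} (hD : 0 ≤ D) (hgx : 0 ≤ gx) (hsy : 0 ≤ sy)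
    (h1 : F' + (1 / 2 - L * ηx / 2 - L ^ 2 * ηx / (2 * μ)) * (ηx / N) * gx
      ≤ F + ηx / N * (sx + L ^ 2 * D))
    (h2 : D' ≤ (1 - ηy * μ / 2) * D
      + (2 - ηy * μ) / (ηy * μ) * (L / μ) ^ 2 * (ηx ^ 2 / N * gx) + θ * (2 * ηy ^ 2 * sy))
    (h3 : gy ≤ 8 / ηy ^ 2 * D + 2 * sy) :
    F' + 6 * rho N * μ * D' + ηx / (4 * N) * (gx + gy)
      ≤ F + 6 * rho N * μ * D
        + ηx / (4 * N) * (4 * sx + (1 + 12 / (ηy * μ) * θ) * (4 * sy)) := by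
  have hm := stepsize_margin hN hμ hμL hη hηL hηx
  have hρ := rho_pos hN
  have hN0 : (0 : ℝ) < N := by exact_mod_cast hN
  have hηx0 : 0 < ηx := by rw [hηx]; positivity
  have hL : 0 < L := by linarith
  have e1 : ηx / N = rho N * ηy ^ 3 * μ ^ 2 := by rw [hηx]; field_simp
  have e2 : ηx / (4 * N) = rho N * ηy ^ 3 * μ ^ 2 / 4 := by rw [hηx]; field_simp
  have k1 := mul_le_mul_of_nonneg_right hm (show 0 ≤ ηx / N * gx by positivity)
  have k2 := mul_le_mul_of_nonneg_left h2 (show 0 ≤ 6 * rho N * μ by positivity)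
  have k3 := mul_le_mul_of_nonneg_left h3 (show 0 ≤ ηx / (4 * N) by positivity)
  -- Budget for D: the contraction at rate ηyμ/2 with weight 6ρμ yields 3ρηyμ²D. One third pays for
  -- the primal error here, two thirds for the dual gradient map in `e3`.
  have k4 : ηx / N * (L ^ 2 * D) ≤ rho N * ηy * μ ^ 2 * D := by
    have hl2 : (ηy * L) ^ 2 ≤ 1 := by
      have : 0 ≤ ηy * L := by positivity
      nlinarith
    rw [e1]
    have := mul_le_mul_of_nonneg_left hl2 (show 0 ≤ rho N * ηy * μ ^ 2 * D by positivity)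
    linarith
  have e3 : ηx / (4 * N) * (8 / ηy ^ 2 * D) = 2 * (rho N * ηy * μ ^ 2 * D) := by
    rw [e2]; field_simp; ring
  -- The factor 12/(ηy μ) in the final bound is the weight 6ρμ of the dual noise expressed in units
  -- of ηx/(4N).
  have e4 : ηx / (4 * N) * (12 / (ηy * μ) * θ * (4 * sy))
      = 6 * rho N * μ * (θ * (2 * ηy ^ 2 * sy)) := by
    rw [e2]; field_simp; ring
  have e5 : ηx / N = 4 * (ηx / (4 * N)) := by field_simp
  have e6 : 6 * rho N * μ * ((2 - ηy * μ) / (ηy * μ) * (L / μ) ^ 2 * (ηx ^ 2 / N * gx))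
      = 6 * rho N * μ * ((2 - ηy * μ) / (ηy * μ) * (L / μ) ^ 2 * ηx) * (ηx / N * gx) := by ring
  have k5 : 0 ≤ ηx / (4 * N) * sy := by positivity
  rw [e5] at h1 k1 k4 e6
  linarith

/-- Telescoping; the last distance term is nonnegative and dropped. -/
lemma average_le_of_lyapunov_decrease {F D G : ℕ → ℝ} {B α S e : ℝ} (hα : 0 < α) (hB : 0 ≤ B)
    (hD : ∀ k, 0 ≤ D k) (h0 : B * D 0 ≤ e)
    (hstep : ∀ k, F (k + 1) + B * D (k + 1) + α * G k ≤ F k + B * D k + α * S) {K : ℕ}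
    (hK : 1 ≤ K) :
    1 / (K : ℝ) * ∑ k ∈ Finset.range K, G k ≤ 1 / (α * K) * (F 0 - F K + e) + S := by
  have key : ∀ K : ℕ, F K + B * D K + α * ∑ k ∈ Finset.range K, G k
      ≤ F 0 + B * D 0 + K * (α * S) := by
    intro K
    induction K with
    | zero => simp
    | succ K ih =>
      rw [Finset.sum_range_succ, mul_add]
      push_cast
      have := hstep K
      linarith
  have hK0 : (0 : ℝ) < K := by exact_mod_cast hK
  have h1 := key K
  have h2 : 0 ≤ B * D K := mul_nonneg hB (hD K)
  have h3 : α * ∑ k ∈ Finset.range K, G k ≤ F 0 - F K + e + K * (α * S) := by linarith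
  refine le_of_mul_le_mul_left ?_ (mul_pos hα hK0)
  have e1 : α * K * (1 / (K : ℝ) * ∑ k ∈ Finset.range K, G k)
      = α * ∑ k ∈ Finset.range K, G k := by field_simp
  have e2 : α * K * (1 / (α * K) * (F 0 - F K + e) + S)
      = F 0 - F K + e + K * (α * S) := by field_simp
  rw [e1, e2]
  exact h3

lemma norm_add_sq_le_of_pos {E : Type*} [NormedAddCommGroup E] (u v : E) {τ : ℝ} (hτ : 0 < τ) :
    ‖u + v‖ ^ 2 ≤ (1 + τ) * ‖u‖ ^ 2 + (1 + 1 / τ) * ‖v‖ ^ 2 := by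
  have h1 : ‖u + v‖ ^ 2 ≤ (‖u‖ + ‖v‖) ^ 2 :=
    pow_le_pow_left₀ (norm_nonneg _) (norm_add_le u v) 2
  have h2 : (1 + τ) * ‖u‖ ^ 2 + (1 + 1 / τ) * ‖v‖ ^ 2 - (‖u‖ + ‖v‖) ^ 2
      = (τ * ‖u‖ - ‖v‖) ^ 2 / τ := by field_simp; ring
  have h3 : 0 ≤ (τ * ‖u‖ - ‖v‖) ^ 2 / τ := by positivity
  linarith

end Constants

/-! ### Convergence for a general dual recursion. -/

section Convergence

lemma Problem.Regular.proxDual_mem {N : ℕ} {n : Fin N → ℕ} {m : ℕ} {p : Problem n m} {L μ ηy : ℝ}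
    {Wy : Type*} {oy : Primal n → Dual m → Wy → Dual m} {My : ℕ} (hp : p.Regular L μ)
    (hne : (dom p.h).Nonempty) (hη : 0 < ηy) (x : Primal n) (y : Dual m) (z : Fin My → Wy) :
    proxDual p oy ηy x y z ∈ dom p.h :=
  (hp.closedConvex_h.prox_spec hne hη _).1

variable {N : ℕ} {n : Fin N → ℕ} {m : ℕ} {p : Problem n m} {L μ : ℝ}
  {Wx Wy : Type*} [MeasurableSpace Wx] [MeasurableSpace Wy] {Px : Measure Wx} {Py : Measure Wy}
  {ox : Primal n → Dual m → Wx → Primal n} {oy : Primal n → Dual m → Wy → Dual m} {σx σy : ℝ}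
  {ηx ηy : ℝ} {Mx My : ℕ} {Ω : Type*} [MeasurableSpace Ω] {P : Measure Ω}

/-- The convergence bound for any scheme with the primal block step whose dual step satisfies the
mean square recursion `hrec`. -/
theorem average_gradMap_sq_le [IsProbabilityMeasure Px] [IsProbabilityMeasure Py]
    [IsProbabilityMeasure P] (hN : 1 ≤ N) (hμ : 0 < μ) (hμL : μ ≤ L) (hp : p.Regular L μ)
    (ho : p.OracleAssumption Px Py ox oy σx σy) (hη : 0 < ηy) (hηL : ηy * L ≤ 1)
    (hηx : ηx = N * rho N * ηy ^ 3 * μ ^ 2) (hMx : 1 ≤ Mx) (hMy : 1 ≤ My)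
    {x₀ : Primal n} {y₀ : Ω → Dual m}
    (hy₀i : Integrable (fun a => (p.lagrangian x₀ (y₀ a)).toReal) P) {ε' : ℝ}
    (hε' : (⨆ y, p.lagrangian x₀ y).toReal - ∫ a, (p.lagrangian x₀ (y₀ a)).toReal ∂P ≤ ε')
    {i : Ω → ℕ → Fin N} {w : Ω → ℕ → Fin Mx → Wx} {ψ : Ω → ℕ → Fin My → Wy}
    {s : Ω → ℕ → Primal n × Dual m} (hs0 : ∀ a, s a 0 = (x₀, y₀ a))
    (hs : ∀ a k, (s a (k + 1)).1 = primalStep p ox ηx (s a k).1 (s a k).2 (i a k) (w a k))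
    (hsm : ∀ k, Measurable fun a => s a k) (hxd : ∀ k a, (s a k).1 ∈ p.domG)
    (hyd : ∀ k, ∀ᵐ a ∂P, (s a k).2 ∈ dom p.h) (hi : ∀ k, IsUniformIndex P fun a => i a k)
    (hw : ∀ k, IsBatch P Px fun a => w a k) (hψ : ∀ k, IsBatch P Py fun a => ψ a k)
    (hind : ∀ k, IndepFun (fun a => s a k) (fun a => (i a k, w a k)) P)
    (hiw : ∀ k, IndepFun (fun a => i a k) (fun a => w a k) P)
    (hsψ : ∀ k, IndepFun (fun a => s a k) (fun a => ψ a k) P) {θ : ℝ}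
    (hrec : ∀ k, Integrable (fun a => ‖(s a k).2 - p.argmaxDual (s a k).1‖ ^ 2) P →
      Integrable (fun a => ‖(s a (k + 1)).1 - (s a k).1‖ ^ 2) P →
      Integrable (fun a => ‖(s a (k + 1)).2 - p.argmaxDual (s a (k + 1)).1‖ ^ 2) P ∧
      ∫ a, ‖(s a (k + 1)).2 - p.argmaxDual (s a (k + 1)).1‖ ^ 2 ∂P
        ≤ (1 - ηy * μ / 2) * ∫ a, ‖(s a k).2 - p.argmaxDual (s a k).1‖ ^ 2 ∂P
          + (2 - ηy * μ) / (ηy * μ) * (L / μ) ^ 2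
            * ∫ a, ‖(s a (k + 1)).1 - (s a k).1‖ ^ 2 ∂P
          + θ * (2 * ηy ^ 2 * (σy ^ 2 / My))) {K : ℕ} (hK : 1 ≤ K) :
    (∀ k, Integrable (fun a =>
      ‖gradMap p ox oy ηx ηy (s a k).1 (s a k).2 (w a k) (ψ a k)‖ ^ 2) P) ∧
    Integrable (fun a => (p.F (s a K).1).toReal) P ∧
    1 / (K : ℝ) * ∑ k ∈ Finset.range K, ∫ a,
        ‖gradMap p ox oy ηx ηy (s a k).1 (s a k).2 (w a k) (ψ a k)‖ ^ 2 ∂P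
      ≤ 4 * N / (ηx * K)
          * ∫ a, ((p.F x₀).toReal - (p.F (s a K).1).toReal + 12 * rho N * ε') ∂P
        + 4 * σx ^ 2 / Mx + (1 + 12 / (ηy * μ) * θ) * (4 * σy ^ 2 / My) := by
  have hN0 : (0 : ℝ) < N := by exact_mod_cast hN
  have hL : 0 < L := by linarith
  have hρ := rho_pos hN
  have hηx0 : 0 < ηx := by rw [hηx]; positivity
  have hC : 0 < 1 / 2 - L * ηx / 2 - L ^ 2 * ηx / (2 * μ) := by
    refine lt_of_lt_of_le ?_ (stepsize_margin hN hμ hμL hη hηL hηx)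
    have hq1 : ηy * μ ≤ 1 := (mul_le_mul_of_nonneg_left hμL hη.le).trans hηL
    have h2 : 0 ≤ 2 - ηy * μ := by linarith
    positivity
  have hxm : ∀ k, Measurable fun a => (s a k).1 := fun k => (hsm k).fst
  have hym : ∀ k, Measurable fun a => (s a k).2 := fun k => (hsm k).snd
  -- initial distance
  have hyd0 : ∀ᵐ a ∂P, y₀ a ∈ dom p.h := by simpa [hs0] using hyd 0
  obtain ⟨a₀, ha₀⟩ := hyd0.exists
  have hne : (dom p.h).Nonempty := ⟨_, ha₀⟩
  have hx₀ : x₀ ∈ p.domG := by simpa [hs0] using hxd 0 a₀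
  have ham := hp.measurable_argmaxDual hμ hL.le hne
  have hδm : ∀ k, Measurable fun a => ‖(s a k).2 - p.argmaxDual (s a k).1‖ ^ 2 := fun k =>
    ((hym k).sub (ham.comp (hxm k))).norm.pow_const 2
  have hδ0bd : ∀ᵐ a ∂P, μ / 2 * ‖(s a 0).2 - p.argmaxDual (s a 0).1‖ ^ 2
      ≤ (⨆ y, p.lagrangian x₀ y).toReal - (p.lagrangian x₀ (y₀ a)).toReal := by
    filter_upwards [hyd0] with a ha
    rw [hs0 a]
    exact hp.half_norm_sub_argmaxDual_sq_le hμ hx₀ ha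
  have hgap : Integrable
      (fun a => (⨆ y, p.lagrangian x₀ y).toReal - (p.lagrangian x₀ (y₀ a)).toReal) P :=
    (integrable_const _).sub hy₀i
  have hδ0 : Integrable (fun a => ‖(s a 0).2 - p.argmaxDual (s a 0).1‖ ^ 2) P := by
    refine (hgap.const_mul (2 / μ)).mono' (hδm 0).aestronglyMeasurable ?_
    filter_upwards [hδ0bd] with a ha
    rw [Real.norm_of_nonneg (by positivity)]
    refine le_of_mul_le_mul_left ?_ (show 0 < μ / 2 by positivity)
    refine ha.trans_eq ?_
    field_simp
  have hδ0E : μ / 2 * ∫ a, ‖(s a 0).2 - p.argmaxDual (s a 0).1‖ ^ 2 ∂P ≤ ε' := by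
    refine le_trans ?_ hε'
    rw [← integral_const_mul]
    refine (integral_mono_ae (hδ0.const_mul _) hgap hδ0bd).trans_eq ?_
    rw [integral_sub (integrable_const _) hy₀i]
    simp
  -- one step
  have hX := fun k (hF : Integrable (fun a => (p.F (s a k).1).toReal) P)
      (hδ : Integrable (fun a => ‖(s a k).2 - p.argmaxDual (s a k).1‖ ^ 2) P) =>
    hp.integral_F_primalStep_le hμ hL.le hN hηx0 hC ho hMx (hxm k) (hym k) (hxd k) (hyd k) (hi k)
      (hw k) (hind k) (hiw k) hF hδ
  simp only [← hs] at hX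
  -- Both integrabilities propagate together: the primal step needs the dual distance, and `hrec`
  -- needs the primal displacement.
  have hinv : ∀ k, Integrable (fun a => (p.F (s a k).1).toReal) P ∧
      Integrable (fun a => ‖(s a k).2 - p.argmaxDual (s a k).1‖ ^ 2) P := by
    intro k
    induction k with
    | zero =>
      refine ⟨?_, hδ0⟩
      simp_rw [hs0]
      exact integrable_const _
    | succ k ih =>
      obtain ⟨h1, -, h3, -⟩ := hX k ih.1 ih.2
      exact ⟨h1, (hrec k ih.2 h3).1⟩
  have hY := fun k => hp.integral_gradMapY_sq_le hμ hη hηL ho hMy (hxm k) (hym k) (hxd k) (hyd k)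
    (hψ k) (hsψ k) (hinv k).2
  have hGsum : ∀ k a, ‖gradMap p ox oy ηx ηy (s a k).1 (s a k).2 (w a k) (ψ a k)‖ ^ 2
      = ‖gradMapX p ox ηx (s a k).1 (s a k).2 (w a k)‖ ^ 2
        + ‖gradMapY p oy ηy (s a k).1 (s a k).2 (ψ a k)‖ ^ 2 := fun k a => by
    rw [WithLp.prod_norm_sq_eq_of_L2]
    rfl
  have hGE : ∀ k, ∫ a, ‖gradMap p ox oy ηx ηy (s a k).1 (s a k).2 (w a k) (ψ a k)‖ ^ 2 ∂P
      = ∫ a, ‖gradMapX p ox ηx (s a k).1 (s a k).2 (w a k)‖ ^ 2 ∂P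
        + ∫ a, ‖gradMapY p oy ηy (s a k).1 (s a k).2 (ψ a k)‖ ^ 2 ∂P := fun k => by
    simp_rw [hGsum]
    exact integral_add (hX k (hinv k).1 (hinv k).2).2.1 (hY k).1
  refine ⟨fun k => ?_, (hinv K).1, ?_⟩
  · simp_rw [hGsum]
    exact (hX k (hinv k).1 (hinv k).2).2.1.add (hY k).1
  have hstep : ∀ k, _ := fun k => lyapunov_decrease hN (θ := θ) hμ hμL hη hηL hηx
    (integral_nonneg fun a => by positivity) (integral_nonneg fun a => by positivity)
    (show 0 ≤ σy ^ 2 / My by positivity) (hX k (hinv k).1 (hinv k).2).2.2.2.2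
    ((hX k (hinv k).1 (hinv k).2).2.2.2.1 ▸ (hrec k (hinv k).2 (hX k (hinv k).1 (hinv k).2).2.2.1).2)
    (hY k).2
  have h := average_le_of_lyapunov_decrease
    (F := fun k => ∫ a, (p.F (s a k).1).toReal ∂P)
    (D := fun k => ∫ a, ‖(s a k).2 - p.argmaxDual (s a k).1‖ ^ 2 ∂P)
    (G := fun k => ∫ a, ‖gradMapX p ox ηx (s a k).1 (s a k).2 (w a k)‖ ^ 2 ∂P
        + ∫ a, ‖gradMapY p oy ηy (s a k).1 (s a k).2 (ψ a k)‖ ^ 2 ∂P)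
    (e := 12 * rho N * ε') (show 0 < ηx / (4 * N) by positivity)
    (show 0 ≤ 6 * rho N * μ by positivity) (fun k => integral_nonneg fun a => by positivity)
    -- Here 6ρμ D₀ = 12ρ·(μ/2) D₀, which is the origin of 12ρ ε'.
    (by
      have := mul_le_mul_of_nonneg_left hδ0E (show 0 ≤ 12 * rho N by positivity)
      linarith)
    hstep hK
  have hF0 : ∫ a, (p.F (s a 0).1).toReal ∂P = (p.F x₀).toReal := by
    simp_rw [hs0]
    simp
  have hFint : ∫ a, ((p.F x₀).toReal - (p.F (s a K).1).toReal + 12 * rho N * ε') ∂P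
      = (p.F x₀).toReal - ∫ a, (p.F (s a K).1).toReal ∂P + 12 * rho N * ε' := by
    have h1 : Integrable (fun a => (p.F x₀).toReal - (p.F (s a K).1).toReal) P :=
      (integrable_const _).sub (hinv K).1
    rw [integral_add h1 (integrable_const _), integral_sub (integrable_const _) (hinv K).1]
    simp
  simp_rw [hGE]
  rw [hFint]
  rw [hF0] at h
  refine h.trans_eq ?_
  field_simp
  ring

/-- Moving the primal point changes the distance to the dual maximizer in a controlled way. -/
lemma Problem.Regular.norm_sub_argmaxDual_sq_le (hp : p.Regular L μ) (hμ : 0 < μ)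
    (hne : (dom p.h).Nonempty) {x x' : Primal n} (hx : x ∈ p.domG) (hx' : x' ∈ p.domG)
    (y : Dual m) {τ : ℝ} (hτ : 0 < τ) :
    ‖y - p.argmaxDual x'‖ ^ 2 ≤ (1 + τ) * ‖y - p.argmaxDual x‖ ^ 2
      + (1 + 1 / τ) * ((L / μ) ^ 2 * ‖x' - x‖ ^ 2) := by
  have e : y - p.argmaxDual x' = (y - p.argmaxDual x) + (p.argmaxDual x - p.argmaxDual x') := by
    abel
  rw [e]
  refine (norm_add_sq_le_of_pos _ _ hτ).trans ?_
  have h1 := hp.norm_argmaxDual_sub_le hμ hne hx hx'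
  rw [norm_sub_rev] at h1
  have h2 := pow_le_pow_left₀ (norm_nonneg _) h1 2
  rw [mul_pow] at h2
  gcongr

/-- The mean square version of `norm_sub_argmaxDual_sq_le`. -/
lemma Problem.Regular.integral_norm_sub_argmaxDual_sq_le (hp : p.Regular L μ) (hμ : 0 < μ)
    (hL : 0 ≤ L) (hne : (dom p.h).Nonempty) {x x' : Ω → Primal n} {y : Ω → Dual m}
    (hxd : ∀ a, x a ∈ p.domG) (hxd' : ∀ a, x' a ∈ p.domG) (hx' : Measurable x')
    (hy : Measurable y) {τ : ℝ} (hτ : 0 < τ)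
    (hδ : Integrable (fun a => ‖y a - p.argmaxDual (x a)‖ ^ 2) P)
    (hr : Integrable (fun a => ‖x' a - x a‖ ^ 2) P) :
    Integrable (fun a => ‖y a - p.argmaxDual (x' a)‖ ^ 2) P ∧
    ∫ a, ‖y a - p.argmaxDual (x' a)‖ ^ 2 ∂P
      ≤ (1 + τ) * ∫ a, ‖y a - p.argmaxDual (x a)‖ ^ 2 ∂P
        + (1 + 1 / τ) * ((L / μ) ^ 2 * ∫ a, ‖x' a - x a‖ ^ 2 ∂P) := by
  have ham := hp.measurable_argmaxDual hμ hL hne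
  have hbd : ∀ a, ‖y a - p.argmaxDual (x' a)‖ ^ 2 ≤ (1 + τ) * ‖y a - p.argmaxDual (x a)‖ ^ 2
      + (1 + 1 / τ) * ((L / μ) ^ 2 * ‖x' a - x a‖ ^ 2) := fun a =>
    hp.norm_sub_argmaxDual_sq_le hμ hne (hxd a) (hxd' a) (y a) hτ
  have hR := (hδ.const_mul (1 + τ)).add ((hr.const_mul ((L / μ) ^ 2)).const_mul (1 + 1 / τ))
  have hI : Integrable (fun a => ‖y a - p.argmaxDual (x' a)‖ ^ 2) P :=
    hR.mono' ((hy.sub (ham.comp hx')).norm.pow_const 2).aestronglyMeasurable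
      (Filter.Eventually.of_forall fun a => by
        rw [Real.norm_of_nonneg (by positivity)]
        exact hbd a)
  refine ⟨hI, (integral_mono hI hR hbd).trans_eq ?_⟩
  rw [integral_add' (hδ.const_mul _) ((hr.const_mul _).const_mul _), integral_const_mul,
    integral_const_mul, integral_const_mul]

end Convergence

end RBSGDA

/-! ### The two schemes. -/

theorem mainTheorem5
    {N : ℕ} (hN : 1 ≤ N) {n : Fin N → ℕ} {m : ℕ}
    -- the problem
    (p : RBSGDA.Problem n m) (L μ : ℝ) (hμ : 0 < μ) (hμL : μ ≤ L) (hp : p.Regular L μ)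
    -- the stochastic oracles
    {Wx Wy : Type*} [MeasurableSpace Wx] [MeasurableSpace Wy]
    (Px : Measure Wx) (Py : Measure Wy) [IsProbabilityMeasure Px] [IsProbabilityMeasure Py]
    (ox : RBSGDA.Primal n → RBSGDA.Dual m → Wx → RBSGDA.Primal n)
    (oy : RBSGDA.Primal n → RBSGDA.Dual m → Wy → RBSGDA.Dual m) (σx σy : ℝ)
    (ho : p.OracleAssumption Px Py ox oy σx σy)
    -- step sizes and batch sizes
    (ηx ηy : ℝ) (hηy : 0 < ηy) (hηyL : ηy ≤ 1 / L)
    (hηx : ηx = N * RBSGDA.rho N * ηy ^ 3 * μ ^ 2)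
    {Mx My : ℕ} (hMx : 1 ≤ Mx) (hMy : 1 ≤ My)
    -- the probability space and the starting point
    {Ω : Type*} [MeasurableSpace Ω] (P : Measure Ω) [IsProbabilityMeasure P]
    (x₀ : RBSGDA.Primal n) (hx₀ : x₀ ∈ p.domG)
    (y₀ : Ω → RBSGDA.Dual m) (hy₀m : Measurable y₀) (hy₀ : ∀ᵐ a ∂P, y₀ a ∈ RBSGDA.dom p.h)
    (hy₀i : Integrable (fun a => (p.lagrangian x₀ (y₀ a)).toReal) P)
    (ε' : ℝ)
    (hε' : (⨆ y, p.lagrangian x₀ y).toReal - ∫ a, (p.lagrangian x₀ (y₀ a)).toReal ∂P ≤ ε') :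
    -- RB-SGDA (Jacobi updates)
    (ηy * μ < 1 →
      ∀ (i : Ω → ℕ → Fin N) (w : Ω → ℕ → Fin Mx → Wx) (z : Ω → ℕ → Fin My → Wy)
        (s : Ω → ℕ → RBSGDA.Primal n × RBSGDA.Dual m),
        (∀ a, s a = RBSGDA.sgda p ox oy ηx ηy x₀ (y₀ a) (i a) (w a) (z a)) →
        RBSGDA.JacobiSampling P Px Py s i w z →
        ∀ K : ℕ, 1 ≤ K →
          (∀ k, Integrable (fun a =>
            ‖RBSGDA.gradMap p ox oy ηx ηy (s a k).1 (s a k).2 (w a k) (z a k)‖ ^ 2) P) ∧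
          Integrable (fun a => (p.F (s a K).1).toReal) P ∧
          (1 / (K : ℝ)) * ∑ k ∈ Finset.range K, ∫ a,
              ‖RBSGDA.gradMap p ox oy ηx ηy (s a k).1 (s a k).2 (w a k) (z a k)‖ ^ 2 ∂P ≤
            4 * N / (ηx * K) *
                ∫ a, ((p.F x₀).toReal - (p.F (s a K).1).toReal + 12 * RBSGDA.rho N * ε') ∂P
              + 4 * σx ^ 2 / Mx
              + (1 + 6 / (ηy * μ) * ((2 - ηy * μ) / (1 - ηy * μ))) * (4 * σy ^ 2 / My)) ∧
    -- RB-SAGDA (Gauss-Seidel updates)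
    (∀ (i : Ω → ℕ → Fin N) (w : Ω → ℕ → Fin Mx → Wx) (z ψ : Ω → ℕ → Fin My → Wy)
        (s : Ω → ℕ → RBSGDA.Primal n × RBSGDA.Dual m),
        (∀ a, s a = RBSGDA.sagda p ox oy ηx ηy x₀ (y₀ a) (i a) (w a) (z a)) →
        RBSGDA.GaussSeidelSampling P Px Py s i w z ψ →
        ∀ K : ℕ, 1 ≤ K →
          (∀ k, Integrable (fun a =>
            ‖RBSGDA.gradMap p ox oy ηx ηy (s a k).1 (s a k).2 (w a k) (ψ a k)‖ ^ 2) P) ∧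
          Integrable (fun a => (p.F (s a K).1).toReal) P ∧
          (1 / (K : ℝ)) * ∑ k ∈ Finset.range K, ∫ a,
              ‖RBSGDA.gradMap p ox oy ηx ηy (s a k).1 (s a k).2 (w a k) (ψ a k)‖ ^ 2 ∂P ≤
            4 * N / (ηx * K) *
                ∫ a, ((p.F x₀).toReal - (p.F (s a K).1).toReal + 12 * RBSGDA.rho N * ε') ∂P
              + 4 * σx ^ 2 / Mx
              + (1 + 12 / (ηy * μ)) * (4 * σy ^ 2 / My)) := by
  open RBSGDA in
  have hN0 : (0 : ℝ) < N := by exact_mod_cast hN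
  have hL : 0 < L := by linarith
  have hηL : ηy * L ≤ 1 := by rwa [le_div_iff₀ hL] at hηyL
  have hq0 : 0 < ηy * μ := by positivity
  have hq1 : ηy * μ ≤ 1 := (mul_le_mul_of_nonneg_left hμL hηy.le).trans hηL
  have hηx0 : 0 < ηx := by have := rho_pos hN; rw [hηx]; positivity
  obtain ⟨a₀, ha₀⟩ := hy₀.exists
  have hne : (dom p.h).Nonempty := ⟨_, ha₀⟩
  have hxne : p.domG.Nonempty := ⟨_, hx₀⟩
  constructor
  · intro hq i w z s hs hsamp K hK
    have hs0 : ∀ a, s a 0 = (x₀, y₀ a) := fun a => by rw [hs a]; rfl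
    have hs1 : ∀ a k, (s a (k + 1)).1
        = primalStep p ox ηx (s a k).1 (s a k).2 (i a k) (w a k) := fun a k => by rw [hs a]; rfl
    have hs2 : ∀ a k, (s a (k + 1)).2
        = proxDual p oy ηy (s a k).1 (s a k).2 (z a k) := fun a k => by rw [hs a]; rfl
    have hsm : ∀ k, Measurable fun a => s a k := by
      intro k
      induction k with
      | zero => simp_rw [hs0]; exact measurable_const.prodMk hy₀m
      | succ k ih =>
        have h1 := hp.measurable_primalStep hxne hηx0 ho.measurable_x ih.fst ih.snd
          (hsamp.uniform k).1 (hsamp.batch_x k).measurable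
        have h2 := hp.measurable_proxDual hne hηy ho.measurable_y ih.fst ih.snd
          (hsamp.batch_y k).measurable
        simp only [← hs1, ← hs2] at h1 h2
        exact h1.prodMk h2
    have hxd : ∀ k a, (s a k).1 ∈ p.domG := by
      intro k a
      induction k with
      | zero => rw [hs0]; exact hx₀
      | succ k ih => rw [hs1]; exact hp.replaceBlock_prox_mem hηx0 ih _ _
    have hyd : ∀ k, ∀ᵐ a ∂P, (s a k).2 ∈ dom p.h := by
      intro k
      cases k with
      | zero => simpa [hs0] using hy₀
      | succ k =>
        exact Filter.Eventually.of_forall fun a => by rw [hs2]; exact hp.proxDual_mem hne hηy _ _ _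
    have hsz : ∀ k, IndepFun (fun a => s a k) (fun a => z a k) P := fun k =>
      (hsamp.indep_iterate k).comp measurable_id measurable_snd.snd
    have hsw : ∀ k, IndepFun (fun a => s a k) (fun a => (i a k, w a k)) P := fun k =>
      (hsamp.indep_iterate k).comp measurable_id (measurable_fst.prodMk measurable_snd.fst)
    -- θ is the Young factor 1 + τ, which multiplies the dual noise because the target moves after
    -- the dual step.
    obtain ⟨h1, h2, h3⟩ := average_gradMap_sq_le (θ := (2 - ηy * μ) / (2 * (1 - ηy * μ))) hN hμ hμL
      hp ho hηy hηL hηx hMx hMy hy₀i hε' hs0 hs1 hsm hxd hyd hsamp.uniform hsamp.batch_x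
      hsamp.batch_y hsw hsamp.indep_index hsz (fun k hδ hr => by
        have hy' := hp.integral_proxDual_sub_sq_le hμ hL.le hηy hηL hq1 ho hMy (hsm k).fst
          (hsm k).snd (hxd k) (hyd k) (hsamp.batch_y k) (hsz k) hδ
        simp only [← hs2] at hy'
        have h1q : 0 < 1 - ηy * μ := by linarith
        obtain ⟨hI, hle⟩ := hp.integral_norm_sub_argmaxDual_sq_le hμ hL.le hne (hxd k)
          (hxd (k + 1)) (hsm (k + 1)).fst (hsm (k + 1)).snd
          -- With q = ηy μ, this τ is the solution of (1 + τ)(1 − q) = 1 − q/2; it requires q < 1.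
          (show 0 < ηy * μ / (2 * (1 - ηy * μ)) by positivity) hy'.1 hr
        refine ⟨hI, hle.trans ?_⟩
        have e1 : 1 + ηy * μ / (2 * (1 - ηy * μ)) = (2 - ηy * μ) / (2 * (1 - ηy * μ)) := by
          field_simp; ring
        have e2 : 1 + 1 / (ηy * μ / (2 * (1 - ηy * μ))) = (2 - ηy * μ) / (ηy * μ) := by
          field_simp; ring
        rw [e1, e2]
        have hθ : 0 ≤ (2 - ηy * μ) / (2 * (1 - ηy * μ)) :=
          div_nonneg (by linarith) (by linarith)
        have h4 := mul_le_mul_of_nonneg_left hy'.2 hθ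
        have e3 : ∀ D : ℝ, (2 - ηy * μ) / (2 * (1 - ηy * μ)) * ((1 - ηy * μ) * D)
            = (1 - ηy * μ / 2) * D := fun D => by field_simp
        rw [mul_add, e3] at h4
        linarith) hK
    refine ⟨h1, h2, h3.trans_eq ?_⟩
    have h1q : 1 - ηy * μ ≠ 0 := by linarith
    have e : 12 / (ηy * μ) * ((2 - ηy * μ) / (2 * (1 - ηy * μ)))
        = 6 / (ηy * μ) * ((2 - ηy * μ) / (1 - ηy * μ)) := by
      field_simp; ring
    rw [e]
  · intro i w z ψ s hs hsamp K hK
    have hs0 : ∀ a, s a 0 = (x₀, y₀ a) := fun a => by rw [hs a]; rfl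
    have hs1 : ∀ a k, (s a (k + 1)).1
        = primalStep p ox ηx (s a k).1 (s a k).2 (i a k) (w a k) := fun a k => by rw [hs a]; rfl
    have hs2 : ∀ a k, (s a (k + 1)).2
        = proxDual p oy ηy (s a (k + 1)).1 (s a k).2 (z a k) := fun a k => by rw [hs a]; rfl
    have hsm : ∀ k, Measurable fun a => s a k := by
      intro k
      induction k with
      | zero => simp_rw [hs0]; exact measurable_const.prodMk hy₀m
      | succ k ih =>
        have h1 := hp.measurable_primalStep hxne hηx0 ho.measurable_x ih.fst ih.snd
          (hsamp.uniform k).1 (hsamp.batch_x k).measurable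
        simp only [← hs1] at h1
        have h2 := hp.measurable_proxDual hne hηy ho.measurable_y h1 ih.snd
          (hsamp.batch_y k).measurable
        simp only [← hs2] at h2
        exact h1.prodMk h2
    have hxd : ∀ k a, (s a k).1 ∈ p.domG := by
      intro k a
      induction k with
      | zero => rw [hs0]; exact hx₀
      | succ k ih => rw [hs1]; exact hp.replaceBlock_prox_mem hηx0 ih _ _
    have hyd : ∀ k, ∀ᵐ a ∂P, (s a k).2 ∈ dom p.h := by
      intro k
      cases k with
      | zero => simpa [hs0] using hy₀
      | succ k =>
        exact Filter.Eventually.of_forall fun a => by rw [hs2]; exact hp.proxDual_mem hne hηy _ _ _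
    have hsw : ∀ k, IndepFun (fun a => s a k) (fun a => (i a k, w a k)) P := fun k =>
      (hsamp.indep_iterate k).comp measurable_id (measurable_fst.prodMk measurable_snd.fst)
    -- The dual oracle is called at (x^{k+1}, y^k), a measurable function of the iterate, the index
    -- and the primal batch, so z^k has to be independent of all three jointly.
    have hzind : ∀ k, IndepFun (fun a => ((s a (k + 1)).1, (s a k).2)) (fun a => z a k) P := by
      intro k
      have h1 : IndepFun (fun a => s a k) (fun a => (z a k, (i a k, w a k))) P :=
        (hsamp.indep_iterate k).comp measurable_id
          (measurable_snd.snd.prodMk (measurable_fst.prodMk measurable_snd.fst))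
      have h2 := indepFun_prodMk_of_indepFun_prodMk (hsm k) (hsamp.batch_y k).measurable
        ((hsamp.uniform k).1.prodMk (hsamp.batch_x k).measurable) h1 (hsamp.indep_batches k).symm
      have h3 := hp.measurable_primalStep hxne hηx0 ho.measurable_x
        (x := fun t : (Primal n × Dual m) × (Fin N × (Fin Mx → Wx)) => t.1.1)
        (y := fun t => t.1.2) (i := fun t => t.2.1) (w := fun t => t.2.2)
        (by fun_prop) (by fun_prop) (by fun_prop) (by fun_prop)
      have h4 := (h2.comp measurable_id (h3.prodMk measurable_fst.snd)).symm
      simp_rw [hs1]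
      exact h4
    obtain ⟨h1, h2, h3⟩ := average_gradMap_sq_le (θ := 1) hN hμ hμL hp ho hηy hηL hηx hMx hMy hy₀i
      hε' hs0 hs1 hsm hxd hyd hsamp.uniform hsamp.batch_x hsamp.batch_psi hsw hsamp.indep_index
      hsamp.indep_psi (fun k hδ hr => by
        -- The target moves first, with τ = q/2, and the contraction at x^{k+1} follows; the dual
        -- noise is then not amplified.
        obtain ⟨hI, hle⟩ := hp.integral_norm_sub_argmaxDual_sq_le hμ hL.le hne (hxd k)
          (hxd (k + 1)) (hsm (k + 1)).fst (hsm k).snd (show 0 < ηy * μ / 2 by positivity) hδ hr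
        have hy' := hp.integral_proxDual_sub_sq_le hμ hL.le hηy hηL hq1 ho hMy (hsm (k + 1)).fst
          (hsm k).snd (hxd (k + 1)) (hyd k) (hsamp.batch_y k) (hzind k) hI
        simp only [← hs2] at hy'
        refine ⟨hy'.1, hy'.2.trans ?_⟩
        have hD : 0 ≤ ∫ a, ‖(s a k).2 - p.argmaxDual (s a k).1‖ ^ 2 ∂P :=
          integral_nonneg fun a => by positivity
        have hR : 0 ≤ (L / μ) ^ 2 * ∫ a, ‖(s a (k + 1)).1 - (s a k).1‖ ^ 2 ∂P :=
          mul_nonneg (by positivity) (integral_nonneg fun a => by positivity)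
        have h4 := mul_le_mul_of_nonneg_left hle (show 0 ≤ 1 - ηy * μ by linarith)
        -- The left sides of `h5` and `h6` are 1 − q/2 − q²/2 and (2 − q − q²)/q, so the
        -- coefficients of the Jacobi recursion are met even when q = 1.
        have h5 : (1 - ηy * μ) * (1 + ηy * μ / 2) ≤ 1 - ηy * μ / 2 := by nlinarith
        have h6 : (1 - ηy * μ) * (1 + 1 / (ηy * μ / 2)) ≤ (2 - ηy * μ) / (ηy * μ) := by
          rw [le_div_iff₀ hq0]
          have : (1 - ηy * μ) * (1 + 1 / (ηy * μ / 2)) * (ηy * μ)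
              = (1 - ηy * μ) * (ηy * μ + 2) := by field_simp
          rw [this]
          nlinarith
        have h7 := mul_le_mul_of_nonneg_right h5 hD
        have h8 := mul_le_mul_of_nonneg_right h6 hR
        linarith) hK
    refine ⟨h1, h2, h3.trans_eq ?_⟩
    rw [mul_one]
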